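/- **Conventions.** For a number field $K$ let $P_K$ be the set of maximal ideals of $O_K$, $\hat O_K=\prod_{\mathfrak p\in P_K}O_{\mathfrak p}$ (completions), $\mathbb A_{K,f}$ and $\mathbb A_K$ the rings of finite adeles and of adeles, $K_\infty^{\times,\circ}$ the identity component of $K_\infty^\times=(K\otimes_{\mathbb Q}\mathbb R)^\times$, and $G_K^{ab}=\mathbb A_K^\times/\overline{K^\times K_\infty^{\times,\circ}}$ (the abelianized Galois group of $K$, in its idelic form). For a finite idele $x$, let $[x]\in G_K^{ab}$ be the class of the idele that is $x$ at the finite places and $1$ at the infinite ones. The Deligne–Ribet monoid $DR_K=\hat O_K\times_{\hat O_K^\times}G_K^{ab}$ is the topological monoid obtained from $\hat O_K\times G_K^{ab}$ by identifying $(\rho,s)$ with $(\rho u,[u]^{-1}s)$ for all $u\in\hat O_K^\times$; $[\rho,s]$ denotes the class of $(\rho,s)$. The monoid of nonzero ideals of $O_K$ maps to $DR_K$ by $\iota_K:\mathfrak a\mapsto[\rho,[\rho]^{-1}]$, where $\rho\in\hat O_K\cap\mathbb A_{K,f}^\times$ generates $\mathfrak a$ locally everywhere; its image is the submonoid $I_K\subseteq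 DR_K$. The *arithmetic data* of $K$ are $$\mathcal D(K)=\bigl(K,\;O_K,\;P_K,\;\{1+\mathfrak pO_{K,\mathfrak p}\}_{\mathfrak p\in P_K}\bigr),$$ where $K$ is regarded only as a multiplicative monoid, $O_K$, the $\mathfrak p\in P_K$ and the $1+\mathfrak pO_{K,\mathfrak p}$ as subsets of it, and $O_{K,\mathfrak p}\subseteq K$ is the local ring at $\mathfrak p$. An isomorphism of such data is an isomorphism of multiplicative monoids together with a bijection of the index sets $P$, compatible with all the subsets. **The reconstruction.** Let $M$ be a commutative topological monoid and $I\subseteq M$ a submonoid. Define data $\mathcal R(M,I)$ of the same kind as follows. - $P$ is the set of maximal idempotents of $M$: idempotents $e\ne1$ such that, for every idempotent $e'$, $ee'=e$ implies $e'=e$ or $e'=1$. - For $e\in P$ let $O_e^*$ be the submonoid of $M$ generated by $\{x: xe=e,\ x\neq e\}$, $K_e^\times$ its group completion, and $O_e^\times\subseteq K_e^\times$ the image of the group of units of $O_e^*$. For a prime number $\ell$ let $T_{e,\ell}$ be the set of units $u$ of $O_e^*$ with $u^{\ell^n}\to1$ in $M$, and let $U_e\subseteq K_e^\times$ be the union of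 the images of those $T_{e,\ell}$ that are infinite. - Let $\Gamma_e\subseteq K_e^\times\times M^\times$ be the subgroup generated by the pairs $(\rho,\sigma)$ with $\rho\in O_e^*$, $\sigma\in M^\times$ and $\rho\sigma\in I$ (for $M=DR_K$, $I=I_K$ it is the graph of a homomorphism $K_e^\times\to M^\times$). Let $N\subseteq\prod_eK_e^\times$ be the group of all $(x_e)_e$ such that $x_e\in O_e^\times$ for all but finitely many $e$ and there are $s_e\in M^\times$ with $(x_e,s_e)\in\Gamma_e$ for all $e$ whose unordered product converges to $1$ in $M^\times$. - Let $F^\times\subseteq\prod_eK_e^\times$ be the subgroup generated by $N$ and the families $(\varepsilon_e)_e$ all of whose components have order $2$. Put $F=F^\times\cup\{0\}$. Its subsets are $O=\{0\}\cup\{x\in F^\times: x_e\in\operatorname{im}(O_e^*\to K_e^\times)\ \forall e\}$, $\mathfrak p_e=\{0\}\cup\{x\in O\cap F^\times: x_e\notin O_e^\times\}$ and $\{x\in F^\times:x_e\in U_e\}$ for $e\in P$. **Theorem.** Let $K$ be $\mathbb Q$ or an imaginary quadratic field. 1. *(Reconstruction.)* Let $M$ be a commutative topological monoid, $I\subseteq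 M$ a submonoid, and $\varphi:M\to DR_K$ an isomorphism of topological monoids with $\varphi(I)=I_K$. - (a) There is exactly one isomorphism of data $f_\varphi:\mathcal R(M,I)\to\mathcal D(K)$ such that, for every $\mathfrak p\in P_K$, the maximal idempotent $e$ of $M$ that corresponds to $\mathfrak p$ satisfies $\varphi(e)=\lim_{n\to\infty}\iota_K(\mathfrak p)^{n!}$. - (b) The data $\mathcal R(M,I)$ determine the addition: there is exactly one binary operation $+$ on $F$ such that every isomorphism of data from $\mathcal R(M,I)$ to $\mathcal D(K')$, where $K'$ is $\mathbb Q$ or an imaginary quadratic field, is additive. In particular $(F,+,\cdot)$ is a field, and $f_\varphi$ is an isomorphism of fields from it onto $K$. 2. *(Isomorphisms.)* Let $L$ also be $\mathbb Q$ or an imaginary quadratic field, and let $\varphi:DR_K\to DR_L$ be an isomorphism of topological monoids that restricts to an isomorphism $I_K\to I_L$. Then there is exactly one isomorphism of fields $\psi:K\to L$ such that $\varphi(\iota_K(\mathfrak a))=\iota_L(\psi(\mathfrak a))$ for all nonzero ideals $\mathfrak a$ of $O_K$. It is the isomorphism given by the reconstruction: $\psi\circ f_{\mathrm{id}}=f_\varphi$,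 where $f_{\mathrm{id}}:\mathcal R(DR_K,I_K)\to\mathcal D(K)$ and $f_\varphi:\mathcal R(DR_K,I_K)\to\mathcal D(L)$ are the isomorphisms of 1(a) for $\mathrm{id}_{DR_K}$ and for $\varphi$. -/

import Mathlib

open NumberField IsDedekindDomain Filter Topology nonZeroDivisors

/-! ## The Deligne-Ribet monoid of a number field -/

section DeligneRibet

variable (K : Type*) [Field K] [NumberField K]

/-- The ring `Ô_K = ∏_𝔭 O_𝔭` of finite integral adeles, with the product topology. -/
abbrev IntegralAdeles : Type _ := ∀ v : HeightOneSpectrum (𝓞 K), v.adicCompletionIntegers K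

/-- The inclusion of `Ô_K` in the finite adele ring `𝔸_{K,f}`. -/
noncomputable def IntegralAdeles.toFinite : IntegralAdeles K →* FiniteAdeleRing (𝓞 K) K where
  toFun ρ := ⟨fun v => (ρ v : v.adicCompletion K), Eventually.of_forall fun v => (ρ v).2⟩
  map_one' := rfl
  map_mul' _ _ := rfl

/-- `𝔸_{K,f} → 𝔸_K`, `x ↦ (1, x)` (multiplicative). -/
noncomputable def finiteToAdele : FiniteAdeleRing (𝓞 K) K →* AdeleRing (𝓞 K) K where
  toFun x := ((1 : InfiniteAdeleRing K), x)
  map_one' := rfl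
  map_mul' _ _ := Prod.ext (mul_one (1 : InfiniteAdeleRing K)).symm rfl

/-- `K_∞ → 𝔸_K`, `x ↦ (x, 1)` (multiplicative). -/
noncomputable def infiniteToAdele : InfiniteAdeleRing K →* AdeleRing (𝓞 K) K where
  toFun x := (x, (1 : FiniteAdeleRing (𝓞 K) K))
  map_one' := rfl
  map_mul' _ _ := Prod.ext rfl (mul_one (1 : FiniteAdeleRing (𝓞 K) K)).symm

/-- The subgroup `K^× · K_∞^{×,°}` of the idele group, where `K_∞^{×,°}` is the connected
component of `1` in `K_∞^×`. -/
noncomputable def globalIdeles : Subgroup (AdeleRing (𝓞 K) K)ˣ :=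
  (Units.map (algebraMap K (AdeleRing (𝓞 K) K)).toMonoidHom).range ⊔
    (Subgroup.connectedComponentOfOne (InfiniteAdeleRing K)ˣ).map (Units.map (infiniteToAdele K))

/-- The Galois group `G_K^{ab}` of the maximal abelian extension in its idelic form: the
quotient `𝔸_K^× / closure (K^× · K_∞^{×,°})` of the idele group. -/
def GalAb : Type _ := (AdeleRing (𝓞 K) K)ˣ ⧸ (globalIdeles K).topologicalClosure

noncomputable instance : CommGroup (GalAb K) :=
  QuotientGroup.Quotient.commGroup (globalIdeles K).topologicalClosure

noncomputable instance : TopologicalSpace (GalAb K) :=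
  QuotientGroup.instTopologicalSpace (globalIdeles K).topologicalClosure

instance : IsTopologicalGroup (GalAb K) :=
  QuotientGroup.instIsTopologicalGroup (globalIdeles K).topologicalClosure

/-- The class `[x]` in `G_K^{ab}` of a finite idele `x`. -/
noncomputable def finiteRec : (FiniteAdeleRing (𝓞 K) K)ˣ →* GalAb K :=
  (QuotientGroup.mk' (globalIdeles K).topologicalClosure).comp (Units.map (finiteToAdele K))

/-- The map `Ô_K^× → G_K^{ab}`. -/
noncomputable def unitRec : (IntegralAdeles K)ˣ →* GalAb K :=
  (finiteRec K).comp (Units.map (IntegralAdeles.toFinite K))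

/-- The relation `(ρ, s) ∼ (ρ u, [u]⁻¹ s)`, `u ∈ Ô_K^×`, on `Ô_K × G_K^{ab}`. -/
def drCon : Con (IntegralAdeles K × GalAb K) where
  r a b := ∃ u : (IntegralAdeles K)ˣ, b = (a.1 * u, (unitRec K u)⁻¹ * a.2)
  iseqv :=
    { refl := fun a => ⟨1, by simp⟩
      symm := by
        rintro a _ ⟨u, rfl⟩
        exact ⟨u⁻¹, by simp⟩
      trans := by
        rintro a _ _ ⟨u, rfl⟩ ⟨w, rfl⟩
        exact ⟨u * w, by simp [mul_assoc, mul_left_comm]⟩ }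
  mul' := by
    rintro a _ c _ ⟨u, rfl⟩ ⟨w, rfl⟩
    refine ⟨u * w, Prod.ext ?_ ?_⟩
    · simp only [Prod.fst_mul, Units.val_mul]
      exact mul_mul_mul_comm _ _ _ _
    · simp only [Prod.snd_mul, map_mul, mul_inv]
      exact mul_mul_mul_comm _ _ _ _

/-- The Deligne-Ribet monoid `DR_K = Ô_K ×_{Ô_K^×} G_K^{ab}`. -/
def DR : Type _ := (drCon K).Quotient

noncomputable instance : CommMonoid (DR K) := inferInstanceAs (CommMonoid (drCon K).Quotient)

/-- The projection `Ô_K × G_K^{ab} → DR_K`, `(ρ, s) ↦ [ρ, s]`. -/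
noncomputable def DR.mk : IntegralAdeles K × GalAb K →* DR K := (drCon K).mk'

/-- `DR_K` carries the quotient topology. -/
noncomputable instance : TopologicalSpace (DR K) := TopologicalSpace.coinduced (DR.mk K) inferInstance

theorem DR.isOpenQuotientMap_mk : IsOpenQuotientMap (DR.mk K) := by
  refine ⟨Con.mk'_surjective, continuous_coinduced_rng, fun U hU => ?_⟩
  change IsOpen (DR.mk K ⁻¹' (DR.mk K '' U))
  have : DR.mk K ⁻¹' (DR.mk K '' U) = ⋃ u : (IntegralAdeles K)ˣ,
      (fun a : IntegralAdeles K × GalAb K => (a.1 * (u : IntegralAdeles K),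
        (unitRec K u)⁻¹ * a.2)) ⁻¹' U := by
    ext a
    simp only [Set.mem_preimage, Set.mem_image, Set.mem_iUnion]
    constructor
    · rintro ⟨b, hb, h⟩
      obtain ⟨u, rfl⟩ := (drCon K).symm ((drCon K).eq.mp h)
      exact ⟨u, hb⟩
    · rintro ⟨u, hu⟩
      exact ⟨_, hu, (drCon K).eq.mpr ((drCon K).symm ⟨u, rfl⟩)⟩
  rw [this]
  refine isOpen_iUnion fun u => hU.preimage ?_
  exact ((continuous_mul_const (u : IntegralAdeles K)).comp continuous_fst).prodMk ((continuous_const_mul (unitRec K u)⁻¹).comp continuous_snd)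

instance : ContinuousMul (DR K) where
  continuous_mul := by
    have h := (DR.isOpenQuotientMap_mk K).prodMap (DR.isOpenQuotientMap_mk K)
    rw [h.isQuotientMap.continuous_iff]
    have : (fun p : DR K × DR K => p.1 * p.2) ∘ Prod.map (DR.mk K) (DR.mk K) =
        fun p => DR.mk K (p.1 * p.2) := by
      funext p
      exact (map_mul (DR.mk K) p.1 p.2).symm
    rw [this]
    exact (DR.isOpenQuotientMap_mk K).continuous.comp continuous_mul

/-! ### The submonoid of integral ideals -/

/-- A uniformizer at each maximal ideal. -/
noncomputable def unif (v : HeightOneSpectrum (𝓞 K)) : 𝓞 K :=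
  v.intValuation_exists_uniformizer.choose

theorem unif_spec (v : HeightOneSpectrum (𝓞 K)) :
    v.intValuation (unif K v) = WithZero.exp (-1 : ℤ) :=
  v.intValuation_exists_uniformizer.choose_spec

open Classical in
/-- The exponent of `v` in the factorization of a nonzero ideal. -/
noncomputable def idealExp (v : HeightOneSpectrum (𝓞 K)) (𝔞 : (Ideal (𝓞 K))⁰) : ℕ :=
  (Associates.mk v.asIdeal).count (Associates.mk (𝔞 : Ideal (𝓞 K))).factors

theorem idealExp_one (v : HeightOneSpectrum (𝓞 K)) : idealExp K v 1 = 0 := by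
  classical
  have h : (Associates.mk (((1 : (Ideal (𝓞 K))⁰) : Ideal (𝓞 K)))) = 1 := rfl
  rw [idealExp, h, Associates.factors_one, Associates.count_zero v.associates_irreducible]

theorem idealExp_mul (v : HeightOneSpectrum (𝓞 K)) (𝔞 𝔟 : (Ideal (𝓞 K))⁰) :
    idealExp K v (𝔞 * 𝔟) = idealExp K v 𝔞 + idealExp K v 𝔟 := by
  classical
  have h : Associates.mk ((𝔞 * 𝔟 : (Ideal (𝓞 K))⁰) : Ideal (𝓞 K)) =
      Associates.mk (𝔞 : Ideal (𝓞 K)) * Associates.mk (𝔟 : Ideal (𝓞 K)) := rfl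
  rw [idealExp, h, Associates.count_mul (Associates.mk_ne_zero.mpr (nonZeroDivisors.coe_ne_zero 𝔞))
    (Associates.mk_ne_zero.mpr (nonZeroDivisors.coe_ne_zero 𝔟)) v.associates_irreducible]
  rfl

theorem idealExp_finite (𝔞 : (Ideal (𝓞 K))⁰) :
    ∀ᶠ v : HeightOneSpectrum (𝓞 K) in cofinite, idealExp K v 𝔞 = 0 := by
  classical
  refine (Ideal.finite_factors (nonZeroDivisors.coe_ne_zero 𝔞)).subset fun v hv => ?_
  exact (Associates.count_ne_zero_iff_dvd (nonZeroDivisors.coe_ne_zero 𝔞) v.irreducible).mp hv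

/-- The integral adele `ρ_𝔞` with `ρ_v = ϖ_v ^ ord_v(𝔞)`. -/
noncomputable def idealAdele : (Ideal (𝓞 K))⁰ →* IntegralAdeles K where
  toFun 𝔞 := fun v =>
    algebraMap (𝓞 K) (v.adicCompletionIntegers K) (unif K v) ^ idealExp K v 𝔞
  map_one' := funext fun v => by simp [idealExp_one]
  map_mul' 𝔞 𝔟 := funext fun v => by simp [idealExp_mul, pow_add]

theorem valued_idealAdele (𝔞 : (Ideal (𝓞 K))⁰) (v : HeightOneSpectrum (𝓞 K)) :
    Valued.v (idealAdele K 𝔞 v : v.adicCompletion K) =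
      WithZero.exp (-(idealExp K v 𝔞 : ℤ)) := by
  have h : ((algebraMap (𝓞 K) (v.adicCompletionIntegers K) (unif K v) :
      v.adicCompletionIntegers K) : v.adicCompletion K) = ((unif K v : K) : v.adicCompletion K) :=
    rfl
  change Valued.v (((algebraMap (𝓞 K) (v.adicCompletionIntegers K) (unif K v) ^
    idealExp K v 𝔞 : v.adicCompletionIntegers K)) : v.adicCompletion K) = _
  rw [SubmonoidClass.coe_pow, map_pow, h, HeightOneSpectrum.valuedAdicCompletion_eq_valuation',
    HeightOneSpectrum.valuation_of_algebraMap, unif_spec, ← WithZero.exp_nsmul]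
  simp

theorem isUnit_idealAdele (𝔞 : (Ideal (𝓞 K))⁰) :
    IsUnit (IntegralAdeles.toFinite K (idealAdele K 𝔞)) := by
  rw [FiniteAdeleRing.isUnit_iff]
  constructor
  · intro v hv
    have h := valued_idealAdele K 𝔞 v
    change (idealAdele K 𝔞 v : v.adicCompletion K) = 0 at hv
    rw [hv, map_zero] at h
    exact WithZero.exp_ne_zero h.symm
  · filter_upwards [idealExp_finite K 𝔞] with v hv
    change Valued.v (idealAdele K 𝔞 v : v.adicCompletion K) = 1
    rw [valued_idealAdele, hv]
    simp

/-- The finite idele `ρ_𝔞`. -/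
noncomputable def idealIdele : (Ideal (𝓞 K))⁰ →* (FiniteAdeleRing (𝓞 K) K)ˣ where
  toFun 𝔞 := (isUnit_idealAdele K 𝔞).unit
  map_one' := Units.ext (by simp)
  map_mul' 𝔞 𝔟 := Units.ext (by simp)

/-- The natural homomorphism from the monoid of nonzero integral ideals to `DR_K`,
`𝔞 ↦ [ρ_𝔞, [ρ_𝔞]⁻¹]`. -/
noncomputable def idealToDR : (Ideal (𝓞 K))⁰ →* DR K where
  toFun 𝔞 := DR.mk K (idealAdele K 𝔞, (finiteRec K (idealIdele K 𝔞))⁻¹)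
  map_one' := by
    rw [← map_one (DR.mk K)]
    simp only [map_one, inv_one]
    rfl
  map_mul' 𝔞 𝔟 := by
    rw [← map_mul (DR.mk K)]
    simp only [map_mul, mul_inv]
    rfl

/-- `idealToDR` does not depend on the choice of uniformizers: the class of `𝔞` is
`[ρ, [ρ]⁻¹]` for every `ρ ∈ Ô_K ∩ 𝔸_{K,f}^×` that generates `𝔞` locally everywhere. -/
theorem idealToDR_eq (𝔞 : (Ideal (𝓞 K))⁰) (ρ : IntegralAdeles K)
    (x : (FiniteAdeleRing (𝓞 K) K)ˣ) (hx : IntegralAdeles.toFinite K ρ = x)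
    (hρ : ∀ v : HeightOneSpectrum (𝓞 K), Valued.v (ρ v : v.adicCompletion K) =
      WithZero.exp (-(idealExp K v 𝔞 : ℤ))) :
    idealToDR K 𝔞 = DR.mk K (ρ, (finiteRec K x)⁻¹) := by
  have key : ∀ v, ∃ u : (v.adicCompletionIntegers K)ˣ, ρ v = idealAdele K 𝔞 v * (u : v.adicCompletionIntegers K) := by
    intro v
    have h0 : (idealAdele K 𝔞 v : v.adicCompletion K) ≠ 0 := by
      intro h
      have h1 := valued_idealAdele K 𝔞 v
      rw [h, map_zero] at h1
      exact WithZero.exp_ne_zero h1.symm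
    have h1 : Valued.v ((ρ v : v.adicCompletion K) / idealAdele K 𝔞 v) = 1 := by
      rw [map_div₀, hρ, valued_idealAdele, div_self WithZero.exp_ne_zero]
    have hu : IsUnit (⟨(ρ v : v.adicCompletion K) / idealAdele K 𝔞 v,
        (HeightOneSpectrum.mem_adicCompletionIntegers _ _ _).mpr h1.le⟩ :
        v.adicCompletionIntegers K) :=
      HeightOneSpectrum.adicCompletionIntegers.isUnit_iff_valued_eq_one.mpr h1
    refine ⟨hu.unit, Subtype.ext ?_⟩
    change (ρ v : v.adicCompletion K) = idealAdele K 𝔞 v * (ρ v / idealAdele K 𝔞 v)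
    rw [mul_div_cancel₀ _ h0]
  choose u hu using key
  let w : (IntegralAdeles K)ˣ := MulEquiv.piUnits.symm u
  have hw : ρ = idealAdele K 𝔞 * w := funext hu
  refine ((drCon K).eq).mpr ⟨w, Prod.ext hw ?_⟩
  have hx' : x = idealIdele K 𝔞 * Units.map (IntegralAdeles.toFinite K) w := by
    refine Units.ext ?_
    rw [← hx, hw, map_mul]
    rfl
  change (finiteRec K x)⁻¹ = (unitRec K w)⁻¹ * (finiteRec K (idealIdele K 𝔞))⁻¹
  rw [hx', map_mul, mul_inv, mul_comm]
  rfl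

/-- The submonoid `I_K` of `DR_K`, the image of the monoid of nonzero integral ideals. -/
noncomputable def DR.ideals : Submonoid (DR K) := MonoidHom.mrange (idealToDR K)

end DeligneRibet

/-! ## Arithmetic data on multiplicative monoids -/

/-- A multiplicative monoid with zero `F`, with a subset `O`, a family of subsets `ideal 𝔭`
and a family of subsets `U 𝔭`, both indexed by a type `P`. There is no addition. -/
structure MulFieldData.{u} where
  F : Type u
  [monoid : CommMonoidWithZero F]
  O : Set F
  P : Type u
  ideal : P → Set F
  U : P → Set F

attribute [instance] MulFieldData.monoid

/-- Isomorphisms of such data: a multiplicative bijection and a bijection of the index types,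
compatible with all the subsets. -/
structure MulFieldData.Iso.{u, v} (D : MulFieldData.{u}) (E : MulFieldData.{v}) where
  toMulEquiv : D.F ≃* E.F
  primes : D.P ≃ E.P
  mem_O : ∀ x, toMulEquiv x ∈ E.O ↔ x ∈ D.O
  mem_ideal : ∀ p x, toMulEquiv x ∈ E.ideal (primes p) ↔ x ∈ D.ideal p
  mem_U : ∀ p x, toMulEquiv x ∈ E.U (primes p) ↔ x ∈ D.U p

/-- The data `(K, O_K, P_K, {1 + 𝔭 O_{K,𝔭}}_𝔭)` of a number field: the multiplicative monoid of
`K`, the subset `O_K`, the maximal ideals `𝔭 ⊆ O_K`, and the groups `1 + 𝔭 O_{K,𝔭}`, where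
`O_{K,𝔭} ⊆ K` is the local ring at `𝔭`. -/
noncomputable def numberFieldData (K : Type*) [Field K] [NumberField K] : MulFieldData where
  F := K
  O := Set.range (algebraMap (𝓞 K) K)
  P := HeightOneSpectrum (𝓞 K)
  ideal 𝔭 := algebraMap (𝓞 K) K '' (𝔭.asIdeal : Set (𝓞 K))
  U 𝔭 := {x | 𝔭.valuation K (x - 1) < 1}

/-- The multiplicative bijection underlying an isomorphism with the data of a number field. -/
def MulFieldData.Iso.toField {D : MulFieldData} {K : Type*} [Field K] [NumberField K]
    (f : D.Iso (numberFieldData K)) : D.F ≃* K :=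
  f.toMulEquiv

/-! ## The reconstruction from a topological monoid with a submonoid -/

section Reconstruction

variable {M : Type*} [CommMonoid M]

/-- The maximal idempotents of `M`, for the order `e ≤ e' ↔ e * e' = e`. -/
def MaxIdempotent (M : Type*) [CommMonoid M] : Type _ :=
  {e : M // e * e = e ∧ e ≠ 1 ∧ ∀ e' : M, e' * e' = e' → e * e' = e → e' = e ∨ e' = 1}

/-- The monoid `O_𝔭^* = O_𝔭 ∖ {0}` attached to an idempotent `e`. Here `O_𝔭` is
`{x | x * e = e}`, the stabilizer of `e`, and `e` is its absorbing element `0_𝔭`. (The closure is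
there to have a submonoid for arbitrary `M`.) -/
def localNonzero (e : M) : Submonoid M := Submonoid.closure {x | x * e = e ∧ x ≠ e}

/-- The group `K_𝔭^×`, the groupification of `O_𝔭^*`. -/
abbrev LocalMul (e : M) : Type _ := Algebra.GrothendieckGroup (localNonzero e)

/-- The image of `O_𝔭^*` in `K_𝔭^×`. -/
def localIntegers (e : M) : Submonoid (LocalMul e) :=
  MonoidHom.mrange (Algebra.GrothendieckGroup.of (M := localNonzero e))

/-- The subgroup `O_𝔭^×` of `K_𝔭^×`. -/
def localUnits (e : M) : Subgroup (LocalMul e) :=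
  ((Algebra.GrothendieckGroup.of (M := localNonzero e)).comp
    (Units.coeHom (localNonzero e))).range

/-- The graph of the homomorphism `K_𝔭^× → Mˣ` that sends `ρ ∈ O_𝔭^*` to the element `σ ∈ Mˣ` with
`ρ * σ ∈ I`. -/
def localRec (I : Submonoid M) (e : M) : Subgroup (LocalMul e × Mˣ) :=
  Subgroup.closure {z | ∃ (ρ : localNonzero e) (σ : Mˣ),
    (ρ : M) * (σ : M) ∈ I ∧ z = (Algebra.GrothendieckGroup.of ρ, σ)}

/-- The elements `ε` of the product of the groups `K_𝔭^×` all of whose components have order two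
(in the case of number fields: `ε = (-1)_𝔭`). -/
def signs (M : Type*) [CommMonoid M] : Set (∀ e : MaxIdempotent M, LocalMul e.1) :=
  {ε | ∀ e, orderOf (ε e) = 2}

variable [TopologicalSpace M]

/-- The `ℓ`-primary units: those `u ∈ O_𝔭^×` for which `u ^ (ℓ ^ n)` tends to `1`. -/
def primaryUnits (e : M) (ℓ : ℕ) : Set (localNonzero e)ˣ :=
  {u | Tendsto (fun n : ℕ => ((u : localNonzero e) : M) ^ ℓ ^ n) atTop (𝓝 1)}

/-- The subset `1 + 𝔭 O_𝔭` of `K_𝔭^×`: the `ℓ`-primary units for the residue characteristic `ℓ` of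
`𝔭`, the prime number for which there are infinitely many of them. -/
def principalUnits (e : M) : Set (LocalMul e) :=
  {x | ∃ ℓ : ℕ, ℓ.Prime ∧ (primaryUnits e ℓ).Infinite ∧
    ∃ u ∈ primaryUnits e ℓ, x = Algebra.GrothendieckGroup.of (u : localNonzero e)}

variable [ContinuousMul M]

/-- The kernel of the homomorphism `𝔸_{K,f}^× → Mˣ`, where `𝔸_{K,f}^×` is the restricted product
of the groups `K_𝔭^×` with respect to the `O_𝔭^×`, and the homomorphism is the (infinite)
product of the local homomorphisms `K_𝔭^× → Mˣ`. -/
def recKernel (I : Submonoid M) : Subgroup (∀ e : MaxIdempotent M, LocalMul e.1) where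
  carrier := {x | (∀ᶠ e in cofinite, x e ∈ localUnits e.1) ∧
    ∃ s : MaxIdempotent M → Mˣ, (∀ e, (x e, s e) ∈ localRec I e.1) ∧ HasProd s 1}
  one_mem' := ⟨Eventually.of_forall fun e => (localUnits e.1).one_mem,
    fun _ => 1, fun e => (localRec I e.1).one_mem, hasProd_one⟩
  mul_mem' := by
    rintro x y ⟨hx, s, hs, hs'⟩ ⟨hy, t, ht, ht'⟩
    refine ⟨?_, fun e => s e * t e, fun e => (localRec I e.1).mul_mem (hs e) (ht e), ?_⟩
    · filter_upwards [hx, hy] with e h₁ h₂ using (localUnits e.1).mul_mem h₁ h₂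
    · simpa using hs'.mul ht'
  inv_mem' := by
    rintro x ⟨hx, s, hs, hs'⟩
    refine ⟨?_, fun e => (s e)⁻¹, fun e => (localRec I e.1).inv_mem (hs e), ?_⟩
    · filter_upwards [hx] with e h₁ using (localUnits e.1).inv_mem h₁
    · simpa using hs'.inv

/-- The reconstructed multiplicative group `K^×`: generated by the kernel and by `(-1)_𝔭`. -/
def recUnits (I : Submonoid M) : Subgroup (∀ e : MaxIdempotent M, LocalMul e.1) :=
  recKernel I ⊔ Subgroup.closure (signs M)

/-- The reconstructed data `(K, O_K, P_K, {1 + 𝔭 O_{K,𝔭}}_𝔭)`. -/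
def reconstruction (I : Submonoid M) : MulFieldData where
  F := WithZero (recUnits I)
  O := {x | ∀ y : recUnits I, x = y → ∀ e, y.1 e ∈ localIntegers e.1}
  P := MaxIdempotent M
  ideal e := {x | ∀ y : recUnits I, x = y →
    (∀ e', y.1 e' ∈ localIntegers e'.1) ∧ y.1 e ∉ localUnits e.1}
  U e := {x | ∃ y : recUnits I, x = y ∧ y.1 e ∈ principalUnits e.1}

end Reconstruction

/-- `K` is the field of rational numbers or an imaginary quadratic field. -/
def IsRationalOrImaginaryQuadratic (K : Type*) [Field K] [NumberField K] : Prop :=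
  Nonempty (K ≃+* ℚ) ∨ (Module.finrank ℚ K = 2 ∧ IsTotallyComplex K)

/-- Compatibility of an isomorphism between the reconstructed data of `(M, I)` and the data of `K`
with a given isomorphism `φ : M ≃ DR_K`: the maximal idempotent of `DR_K` that corresponds to a
maximal ideal `𝔭` is `𝔭 ^ ω = lim 𝔭 ^ (n!)`. -/
def IsCompatible {M : Type*} [CommMonoid M] [TopologicalSpace M] [ContinuousMul M]
    {I : Submonoid M} {K : Type*} [Field K] [NumberField K] (φ : M ≃ₜ* DR K)
    (f : MulFieldData.Iso (reconstruction I) (numberFieldData K)) : Prop :=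
  ∀ 𝔭 : HeightOneSpectrum (𝓞 K),
    Tendsto (fun n : ℕ =>
      idealToDR K ⟨𝔭.asIdeal, mem_nonZeroDivisors_of_ne_zero 𝔭.ne_bot⟩ ^ n.factorial) atTop
      (𝓝 (φ (Subtype.val (f.primes.symm 𝔭))))

/-- The restriction of `φ : DR_K → DR_L` to the monoids of ideals is the map `𝔞 ↦ ψ(𝔞)`. -/
def RestrictsTo {K L : Type*} [Field K] [NumberField K] [Field L] [NumberField L]
    (φ : DR K ≃ₜ* DR L) (ψ : K ≃+* L) : Prop :=
  ∀ (𝔞 : (Ideal (𝓞 K))⁰) (𝔟 : (Ideal (𝓞 L))⁰),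
    (𝔟 : Ideal (𝓞 L)) = (𝔞 : Ideal (𝓞 K)).map (RingOfIntegers.mapRingEquiv ψ) →
      φ (idealToDR K 𝔞) = idealToDR L 𝔟

universe u v w

/-! ### Residue fields, and congruences between field elements and integers -/

section ResidueFields

variable {K : Type*} [Field K] [NumberField K]

/-! The hypothesis on `K` is used through two consequences: `𝓞 K` has finitely many units, and `K`
has a single infinite place. Finiteness of the units makes `Kˣ` closed in the finite ideles, so that
a finite idele with trivial class in `GalAb K` is a global element, in spite of the closure in the
definition (`exists_finiteEmbedding_eq_of_finiteRec_eq_one`). Having one infinite place, `k` or `-k`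
is positive at the real place, if there is one, and then its class is trivial
(`finiteRec_finiteEmbedding_eq_one_or`).

Reconstruction. An idempotent of `DR K` is `[χ, 1]` with all components of `χ` in `{0, 1}`, and the
maximal ones vanish at exactly one place `v`. The elements absorbed by such an idempotent form a
topological copy of `O_v` (`DR.mul_localMap_zero_iff`, `DR.isClosedEmbedding_localMap`), so the
group completion of its nonzero part is `K_vˣ`. Integers and units are read off algebraically, and
the principal units from convergence of `ℓ`-power sequences (`mem_principalUnits_iff`). The ideals
pin down the class map: `[a, s]` with `a` in `O_v` is an ideal exactly when `s = [a]⁻¹`. A family of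
local elements whose classes multiply to `1` is therefore an idele with trivial class, that is, an
element of `Kˣ`; adjoining `-1`, the only family of components of order two, yields all of `Kˣ`
(`mem_recUnits_iff`).

Addition. An isomorphism `f` of arithmetic data preserves congruences modulo each `v` between
`v`-units, uniformizers, and the sizes of residue fields. For an integer `n` prime to the ramified
primes, `f n / n` has valuation `1` everywhere, so it is a unit; if moreover `n ≡ 1` at a place
where distinct units stay incongruent to `1`, that unit is `1`. Hence `f` fixes a whole progression
`1 + D m`. Every nonzero `x` is congruent to a positive integer at some place outside any given
finite set (`exists_valuation_sub_natCast_lt_one`), and this integer can be moved into the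
progression. So `f (1 + x)` and `1 + f x` agree modulo places outside every finite set, and are
equal (`MulFieldData.Iso.fieldEquiv_one_add`). The same congruences show that an automorphism
preserving all places is trivial, which gives the uniqueness statements.

For the second part, `φ` induces an isomorphism of ideal monoids, hence a bijection of primes; the
limits of `𝔭 ^ n!` tie the primes to the maximal idempotents, so this bijection is the one induced
by the reconstructed field isomorphism. -/

open WithZero in
theorem WithZero.le_exp_neg_one_of_lt_one {a : ℤᵐ⁰} (h : a < 1) : a ≤ exp (-1 : ℤ) := by
  rcases eq_or_ne a 0 with rfl | h0
  · exact zero_le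
  · rw [← exp_log h0] at h ⊢
    rw [← exp_zero, exp_lt_exp] at h
    rw [exp_le_exp]
    omega

namespace NumberField

/-- The number of elements of the residue field. -/
noncomputable def residueCard (v : HeightOneSpectrum (𝓞 K)) : ℕ := Ideal.absNorm v.asIdeal

theorem residueCard_eq (v : HeightOneSpectrum (𝓞 K)) :
    residueCard v = Nat.card (𝓞 K ⧸ v.asIdeal) := by
  rw [residueCard, Ideal.absNorm_apply, Submodule.cardQuot_apply]

theorem one_lt_residueCard (v : HeightOneSpectrum (𝓞 K)) : 1 < residueCard v :=
  HeightOneSpectrum.one_lt_absNorm v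

theorem residueCard_mem (v : HeightOneSpectrum (𝓞 K)) : (residueCard v : 𝓞 K) ∈ v.asIdeal :=
  Ideal.absNorm_mem _

theorem valuation_natCast_lt_one_iff (v : HeightOneSpectrum (𝓞 K)) (n : ℕ) :
    v.valuation K (n : K) < 1 ↔ (n : 𝓞 K) ∈ v.asIdeal := by
  have h := v.valuation_lt_one_iff_mem (K := K) (n : 𝓞 K)
  rwa [Algebra.cast, map_natCast (algebraMap (𝓞 K) K)] at h

theorem valuation_natCast_le_one (v : HeightOneSpectrum (𝓞 K)) (n : ℕ) :
    v.valuation K (n : K) ≤ 1 := by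
  simpa using v.valuation_le_one (K := K) (n : 𝓞 K)

theorem pow_residueCard_sub_one_sub_one_mem (v : HeightOneSpectrum (𝓞 K)) {r : 𝓞 K}
    (hr : r ∉ v.asIdeal) : r ^ (residueCard v - 1) - 1 ∈ v.asIdeal := by
  have := v.isMaximal
  let := Ideal.Quotient.field v.asIdeal
  have := v.asIdeal.finiteQuotientOfFreeOfNeBot v.ne_bot
  have := Fintype.ofFinite (𝓞 K ⧸ v.asIdeal)
  rw [← Ideal.Quotient.eq_zero_iff_mem, map_sub, map_pow, map_one, sub_eq_zero, residueCard_eq,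
    Nat.card_eq_fintype_card]
  exact FiniteField.pow_card_sub_one_eq_one _ (by rwa [ne_eq, Ideal.Quotient.eq_zero_iff_mem])

/-- An integer that generates the multiplicative group of the residue field. -/
theorem exists_generator_residueField (v : HeightOneSpectrum (𝓞 K)) :
    ∃ g : 𝓞 K, g ∉ v.asIdeal ∧
      ∀ n : ℕ, g ^ n - 1 ∈ v.asIdeal ↔ residueCard v - 1 ∣ n := by
  have := v.isMaximal
  let := Ideal.Quotient.field v.asIdeal
  have := v.asIdeal.finiteQuotientOfFreeOfNeBot v.ne_bot
  obtain ⟨u, hu⟩ := IsCyclic.exists_ofOrder_eq_natCard (α := (𝓞 K ⧸ v.asIdeal)ˣ)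
  obtain ⟨g, hg⟩ := Ideal.Quotient.mk_surjective (u : 𝓞 K ⧸ v.asIdeal)
  refine ⟨g, ?_, fun n => ?_⟩
  · rw [← Ideal.Quotient.eq_zero_iff_mem, hg]
    exact u.ne_zero
  · rw [residueCard_eq, ← Nat.card_units, ← hu, orderOf_dvd_iff_pow_eq_one,
      ← Ideal.Quotient.eq_zero_iff_mem, map_sub, map_pow, map_one, sub_eq_zero, hg,
      ← Units.val_inj]
    simp

theorem prime_mem_iff_dvd_residueCard (v : HeightOneSpectrum (𝓞 K)) {p : ℕ} (hp : p.Prime) :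
    (p : 𝓞 K) ∈ v.asIdeal ↔ p ∣ residueCard v := by
  have := v.isMaximal
  let := Ideal.Quotient.field v.asIdeal
  have := v.asIdeal.finiteQuotientOfFreeOfNeBot v.ne_bot
  have := Fintype.ofFinite (𝓞 K ⧸ v.asIdeal)
  obtain ⟨n, hl, hn⟩ := FiniteField.card (𝓞 K ⧸ v.asIdeal) (ringChar (𝓞 K ⧸ v.asIdeal))
  rw [← Ideal.Quotient.eq_zero_iff_mem, map_natCast, residueCard_eq, Nat.card_eq_fintype_card, hn,
    ringChar.spec]
  rw [Nat.prime_dvd_prime_iff_eq hl hp]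
  constructor
  · rintro h
    rw [h]
    exact dvd_pow_self _ n.ne_zero
  · intro h
    exact ((Nat.prime_dvd_prime_iff_eq hp hl).mp (hp.dvd_of_dvd_pow h)).symm

theorem exists_prime_mem (v : HeightOneSpectrum (𝓞 K)) :
    ∃ p : ℕ, p.Prime ∧ (p : 𝓞 K) ∈ v.asIdeal := by
  obtain ⟨p, hp, h⟩ := Nat.exists_prime_and_dvd (one_lt_residueCard v).ne'
  exact ⟨p, hp, (prime_mem_iff_dvd_residueCard v hp).mpr h⟩

theorem finite_valuation_lt_one {z : K} (hz : z ≠ 0) :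
    {v : HeightOneSpectrum (𝓞 K) | v.valuation K z < 1}.Finite := by
  refine (HeightOneSpectrum.Support.finite (𝓞 K) z⁻¹).subset fun v hv => ?_
  have h0 : v.valuation K z ≠ 0 := (Valuation.ne_zero_iff _).mpr hz
  change 1 < v.valuation K z⁻¹
  rw [map_inv₀]
  exact (one_lt_inv₀ (zero_lt_iff.mpr h0)).mpr hv

theorem finite_natCast_mem {n : ℕ} (hn : n ≠ 0) :
    {v : HeightOneSpectrum (𝓞 K) | (n : 𝓞 K) ∈ v.asIdeal}.Finite := by
  refine (finite_valuation_lt_one (K := K) (z := n) (mod_cast hn)).subset fun v hv => ?_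
  exact (valuation_natCast_lt_one_iff v n).mpr hv

theorem exists_natCast_mem_of_finite {S : Set (HeightOneSpectrum (𝓞 K))} (hS : S.Finite) :
    ∃ D : ℕ, D ≠ 0 ∧ ∀ v ∈ S, (D : 𝓞 K) ∈ v.asIdeal := by
  refine ⟨∏ v ∈ hS.toFinset, residueCard v,
    Finset.prod_ne_zero_iff.mpr fun v _ => (one_lt_residueCard v).ne_bot, fun v hv => ?_⟩
  rw [Nat.cast_prod]
  exact Ideal.mem_of_dvd _ (Finset.dvd_prod_of_mem (fun v => (residueCard v : 𝓞 K))
    (hS.mem_toFinset.mpr hv)) (residueCard_mem v)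

theorem exists_prime_dividing {F : Type*} [Field F] {t : 𝓞 F} (h : ¬ IsUnit t) (h0 : t ≠ 0) :
    ∃ v : HeightOneSpectrum (𝓞 F), t ∈ v.asIdeal := by
  obtain ⟨m, hm, hle⟩ := exists_max_ideal_of_mem_nonunits h
  exact ⟨⟨m, hm.isPrime, fun h' => h0 (by simpa [h'] using hle)⟩, hle⟩

/-- If the group of units is finite, every nonzero element of `K` is congruent to a positive
integer at some place outside a given finite set. -/
theorem exists_valuation_sub_natCast_lt_one [Finite (𝓞 K)ˣ] {x : K} (hx : x ≠ 0)
    {S : Set (HeightOneSpectrum (𝓞 K))} (hS : S.Finite) :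
    ∃ v : HeightOneSpectrum (𝓞 K), v ∉ S ∧ ∃ m : ℕ, v.valuation K (x - (m + 1 : ℕ)) < 1 := by
  obtain ⟨D, hD, hDS⟩ := exists_natCast_mem_of_finite hS
  obtain ⟨⟨y, s, hs⟩, hy⟩ := IsLocalization.surj (nonZeroDivisors (𝓞 K)) x
  simp only at hy
  have hs0 : s ≠ 0 := nonZeroDivisors.ne_zero hs
  obtain ⟨c, w, hc, hw⟩ : ∃ (c : ℕ) (w : 𝓞 K), c ≠ 0 ∧ (c : 𝓞 K) = s * w := by
    obtain ⟨w, hw⟩ := Ideal.mem_span_singleton.mp (Ideal.absNorm_mem (Ideal.span {s}))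
    refine ⟨_, w, ?_, hw⟩
    have := (Ideal.span {s}).finiteQuotientOfFreeOfNeBot (by simpa using hs0)
    exact (Ideal.absNorm_ne_zero_iff _).mpr this
  have hxy : (c : K) * x = algebraMap (𝓞 K) K (y * w) := by
    rw [map_mul, ← hy, ← map_natCast (algebraMap (𝓞 K) K), hw, map_mul]
    ring
  have hyw : y * w ≠ 0 := by
    intro h
    rw [h, map_zero] at hxy
    rcases mul_eq_zero.mp hxy with h | h
    · exact hc (by exact_mod_cast h)
    · exact hx h
  -- With `y * w = c * x`, this is `t m = 1 + N x` for `N = D (m + 1) c²`. A prime containing `t m`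
  -- cannot contain `D`, so it lies outside `S`; as units are finite in number and `t` is injective,
  -- some `t m` has such a prime.
  let t : ℕ → 𝓞 K := fun m => 1 + (D * (m + 1) * c : ℕ) * (y * w)
  have ht : Function.Injective t := by
    intro a b hab
    have h1 := mul_right_cancel₀ hyw (add_left_cancel hab)
    have h2 : D * (a + 1) * c = D * (b + 1) * c := by exact_mod_cast h1
    have h3 := Nat.eq_of_mul_eq_mul_right (Nat.pos_of_ne_zero hc) h2
    have h4 := Nat.eq_of_mul_eq_mul_left (Nat.pos_of_ne_zero hD) h3
    omega
  have hfin : {r : 𝓞 K | IsUnit r ∨ r = 0}.Finite :=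
    ((Set.finite_range ((↑) : (𝓞 K)ˣ → 𝓞 K)).subset fun r hr => hr).union (Set.finite_singleton 0)
  obtain ⟨m, hm⟩ : ∃ m, t m ∉ {r : 𝓞 K | IsUnit r ∨ r = 0} := by
    by_contra! h
    exact Set.infinite_univ ((hfin.preimage ht.injOn).subset fun m _ => h m)
  simp only [Set.mem_ofPred_eq, not_or] at hm
  obtain ⟨v, hv⟩ := exists_prime_dividing hm.1 hm.2
  set N : ℕ := D * (m + 1) * c * c with hN
  have hNx : 1 + (N : K) * x = algebraMap (𝓞 K) K (t m) := by
    simp only [t, map_add, map_one, map_mul, map_natCast, hN] at hxy ⊢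
    rw [← hxy]
    push_cast
    ring
  have hDc : ((D * (m + 1) * c : ℕ) : 𝓞 K) ∉ v.asIdeal := fun h =>
    v.isPrime.ne_top ((Ideal.eq_top_iff_one _).mpr (by
      have := v.asIdeal.sub_mem hv (v.asIdeal.mul_mem_right (y * w) h)
      simpa [t] using this))
  have hNv : (N : 𝓞 K) ∉ v.asIdeal := by
    intro h
    rw [hN, Nat.cast_mul] at h
    rcases v.isPrime.mem_or_mem h with h | h
    · exact hDc h
    · exact hDc (by rw [Nat.cast_mul]; exact v.asIdeal.mul_mem_left _ h)
  have hDv : (D : 𝓞 K) ∉ v.asIdeal := fun h => hDc (by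
    rw [mul_assoc, Nat.cast_mul]; exact v.asIdeal.mul_mem_right _ h)
  refine ⟨v, fun h => hDv (hDS v h), ?_⟩
  have hN0 : N ≠ 0 := fun h => hNv (by simp [h])
  have hq := one_lt_residueCard v
  -- Modulo `v`, `N x ≡ -1` and `N⁻¹ ≡ N ^ (q - 2)` with `q` the residue cardinality, so `x ≡ -N⁻¹ ≡
  -- (q - 1) N ^ (q - 2)`. The final `- 1` offsets the `m + 1` of the statement.
  refine ⟨(residueCard v - 1) * N ^ (residueCard v - 2) - 1, ?_⟩
  rw [Nat.sub_add_cancel (Nat.mul_pos (by omega) (pow_pos (Nat.pos_of_ne_zero hN0) _))]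
  have hvN : v.valuation K (N : K) = 1 :=
    le_antisymm (valuation_natCast_le_one v N)
      (not_lt.mp fun h => hNv ((valuation_natCast_lt_one_iff v N).mp h))
  rw [← one_mul (v.valuation K _), ← hvN, ← map_mul]
  have key : (N : K) * (x - ((residueCard v - 1) * N ^ (residueCard v - 2) : ℕ)) =
      algebraMap (𝓞 K) K (t m - residueCard v * N ^ (residueCard v - 1) +
        (N ^ (residueCard v - 1) - 1)) := by
    obtain ⟨q, hq'⟩ : ∃ q, residueCard v = q + 2 := ⟨residueCard v - 2, by omega⟩
    rw [hq', map_add, map_sub, ← hNx]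
    simp only [show q + 2 - 1 = q + 1 by omega, show q + 2 - 2 = q by omega]
    simp only [map_mul, map_sub, map_pow, map_natCast, map_one]
    push_cast
    ring
  rw [key, hvN, HeightOneSpectrum.valuation_lt_one_iff_mem]
  exact v.asIdeal.add_mem (v.asIdeal.sub_mem hv (v.asIdeal.mul_mem_right _ (residueCard_mem v)))
    (pow_residueCard_sub_one_sub_one_mem v hNv)

theorem exists_heightOneSpectrum_notMem [Finite (𝓞 K)ˣ] {S : Set (HeightOneSpectrum (𝓞 K))}
    (hS : S.Finite) : ∃ v : HeightOneSpectrum (𝓞 K), v ∉ S :=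
  (exists_valuation_sub_natCast_lt_one (one_ne_zero (α := K)) hS).imp fun _ h => h.1

/-- An automorphism that preserves all places is trivial. -/
theorem ringEquiv_eq_refl_of_valuation_lt_one [Finite (𝓞 K)ˣ] (τ : K ≃+* K)
    (h : ∀ (v : HeightOneSpectrum (𝓞 K)) (x : K), v.valuation K x < 1 →
      v.valuation K (τ x) < 1) (x : K) : τ x = x := by
  by_contra hne
  have hx : x ≠ 0 := by
    rintro rfl
    exact hne (map_zero τ)
  obtain ⟨v, hv, m, hm⟩ := exists_valuation_sub_natCast_lt_one hx
    (finite_valuation_lt_one (sub_ne_zero.mpr hne))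
  refine hv ?_
  -- `τ` fixes integers, so both `x` and `τ x` are congruent to `m + 1` at `v`, although `v` was
  -- chosen not to divide `τ x - x`.
  have h1 := h v _ hm
  rw [map_sub, map_natCast] at h1
  have : τ x - x = (τ x - (m + 1 : ℕ)) - (x - (m + 1 : ℕ)) := by ring
  change v.valuation K (τ x - x) < 1
  rw [this]
  exact (v.valuation K).map_sub_lt h1 hm

/-- Rational primes outside a finite set are unramified. -/
theorem exists_forall_valuation_natCast_eq_exp (K : Type*) [Field K] [NumberField K] :
    ∃ D : ℕ, D ≠ 0 ∧ ∀ p : ℕ, p.Prime → ¬ p ∣ D → ∀ v : HeightOneSpectrum (𝓞 K),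
      (p : 𝓞 K) ∈ v.asIdeal → v.valuation K (p : K) = WithZero.exp (-1 : ℤ) := by
  -- If `v ^ 2` divided `p`, then `v` would divide the different and contain its norm; that norm is
  -- prime to `p`, which also lies in `v`.
  refine ⟨Ideal.absNorm (differentIdeal ℤ (𝓞 K)), ?_, fun p hp hpD v hv => ?_⟩
  · have := (differentIdeal ℤ (𝓞 K)).finiteQuotientOfFreeOfNeBot differentIdeal_ne_bot
    exact (Ideal.absNorm_ne_zero_iff _).mpr this
  refine le_antisymm (WithZero.le_exp_neg_one_of_lt_one
    ((valuation_natCast_lt_one_iff v p).mpr hv)) (not_lt.mp fun hlt => ?_)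
  have h2 : v.asIdeal ^ 2 ∣ (Ideal.span {(p : ℤ)}).map (algebraMap ℤ (𝓞 K)) := by
    rw [Ideal.map_span, Set.image_singleton, ← v.intValuation_le_pow_iff_dvd,
      ← HeightOneSpectrum.valuation_of_algebraMap (K := K)]
    simp only [map_natCast, algebraMap_int_eq]
    have hp0 : v.valuation K (p : K) ≠ 0 := by simp [hp.ne_zero]
    rw [← WithZero.exp_log hp0, WithZero.exp_lt_exp] at hlt
    rw [← WithZero.exp_log hp0, WithZero.exp_le_exp]
    push_cast
    omega
  have hmax : (Ideal.span {(p : ℤ)}).IsMaximal :=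
    PrincipalIdealRing.isMaximal_of_irreducible (Nat.prime_iff_prime_int.mp hp).irreducible
  have h3 := pow_sub_one_dvd_differentIdeal ℤ v.asIdeal 2
    (by simpa using hp.ne_zero) h2
  have h4 : ((Ideal.absNorm (differentIdeal ℤ (𝓞 K)) : ℕ) : 𝓞 K) ∈ v.asIdeal :=
    Ideal.le_of_dvd (by simpa using h3) (Ideal.absNorm_mem _)
  have hcop : IsCoprime ((p : ℤ) : 𝓞 K)
      ((Ideal.absNorm (differentIdeal ℤ (𝓞 K)) : ℤ) : 𝓞 K) :=
    (Nat.isCoprime_iff_coprime.mpr ((Nat.Prime.coprime_iff_not_dvd hp).mpr hpD)).map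
      (Int.castRingHom (𝓞 K))
  obtain ⟨a, b, hab⟩ := hcop
  refine v.isPrime.ne_top ((Ideal.eq_top_iff_one _).mpr ?_)
  rw [← hab]
  exact v.asIdeal.add_mem (v.asIdeal.mul_mem_left _ (by simpa using hv))
    (v.asIdeal.mul_mem_left _ (by simpa using h4))

theorem exists_units_eq_of_valuation_eq_one {x : K} (hx : x ≠ 0)
    (h : ∀ v : HeightOneSpectrum (𝓞 K), v.valuation K x = 1) :
    ∃ u : (𝓞 K)ˣ, x = algebraMap (𝓞 K) K u := by
  obtain ⟨a, rfl⟩ := HeightOneSpectrum.mem_integers_of_valuation_le_one K x fun v => (h v).le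
  have ha : a ≠ 0 := by
    rintro rfl
    exact hx (map_zero _)
  by_cases hu : IsUnit a
  · exact ⟨hu.unit, rfl⟩
  · obtain ⟨v, hv⟩ := exists_prime_dividing hu ha
    exact absurd (h v) ((v.valuation_lt_one_iff_mem (K := K) a).mpr hv).ne

end NumberField
end ResidueFields

/-! ### Isomorphisms of arithmetic data are additive -/

namespace MulFieldData.Iso

/-- The inverse isomorphism. -/
def symm {D E : MulFieldData} (f : D.Iso E) : E.Iso D where
  toMulEquiv := f.toMulEquiv.symm
  primes := f.primes.symm
  mem_O x := by
    rw [← f.mem_O, MulEquiv.apply_symm_apply]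
  mem_ideal p x := by
    rw [← f.mem_ideal, MulEquiv.apply_symm_apply, Equiv.apply_symm_apply]
  mem_U p x := by
    rw [← f.mem_U, MulEquiv.apply_symm_apply, Equiv.apply_symm_apply]

/-- The composition of isomorphisms. -/
def trans {D E F : MulFieldData} (f : D.Iso E) (g : E.Iso F) : D.Iso F where
  toMulEquiv := f.toMulEquiv.trans g.toMulEquiv
  primes := f.primes.trans g.primes
  mem_O x := (g.mem_O _).trans (f.mem_O x)
  mem_ideal p x := (g.mem_ideal _ _).trans (f.mem_ideal p x)
  mem_U p x := (g.mem_U _ _).trans (f.mem_U p x)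

section NumberFields

variable {K L : Type*} [Field K] [NumberField K] [Field L] [NumberField L]

/-- An isomorphism between the data of number fields, as a map between the fields. -/
def fieldEquiv (f : (numberFieldData K).Iso (numberFieldData L)) : K ≃* L := f.toMulEquiv

/-- An isomorphism between the data of number fields, as a map between the maximal ideals. -/
def primeEquiv (f : (numberFieldData K).Iso (numberFieldData L)) :
    HeightOneSpectrum (𝓞 K) ≃ HeightOneSpectrum (𝓞 L) := f.primes

variable (f : (numberFieldData K).Iso (numberFieldData L))

theorem fieldEquiv_symm_apply (x : L) : f.symm.fieldEquiv x = f.fieldEquiv.symm x := rfl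

theorem symm_primeEquiv_apply (v : HeightOneSpectrum (𝓞 K)) :
    f.symm.primeEquiv (f.primeEquiv v) = v := f.primeEquiv.symm_apply_apply v

theorem fieldEquiv_zero : f.fieldEquiv 0 = 0 := map_zero f.fieldEquiv

theorem exists_fieldEquiv_eq (r : 𝓞 K) :
    ∃ s : 𝓞 L, f.fieldEquiv (algebraMap (𝓞 K) K r) = algebraMap (𝓞 L) L s ∧
      ∀ v : HeightOneSpectrum (𝓞 K),
        s ∈ (f.primeEquiv v).asIdeal ↔ r ∈ v.asIdeal := by
  obtain ⟨s, hs⟩ := (f.mem_O (algebraMap (𝓞 K) K r)).mpr ⟨r, rfl⟩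
  refine ⟨s, hs.symm, fun v => ?_⟩
  have h := f.mem_ideal v (algebraMap (𝓞 K) K r)
  rw [← hs] at h
  exact ((FaithfulSMul.algebraMap_injective (𝓞 L) L).mem_set_image.symm.trans h).trans
    (FaithfulSMul.algebraMap_injective (𝓞 K) K).mem_set_image

theorem valuation_fieldEquiv_algebraMap_lt_one_iff (v : HeightOneSpectrum (𝓞 K)) (r : 𝓞 K) :
    (f.primeEquiv v).valuation L (f.fieldEquiv (algebraMap (𝓞 K) K r)) < 1 ↔
      r ∈ v.asIdeal := by
  obtain ⟨s, hs, h⟩ := f.exists_fieldEquiv_eq r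
  rw [hs, HeightOneSpectrum.valuation_lt_one_iff_mem, h]

theorem valuation_fieldEquiv_algebraMap_le_one (v : HeightOneSpectrum (𝓞 K)) (r : 𝓞 K) :
    (f.primeEquiv v).valuation L (f.fieldEquiv (algebraMap (𝓞 K) K r)) ≤ 1 := by
  obtain ⟨s, hs, h⟩ := f.exists_fieldEquiv_eq r
  rw [hs]
  exact HeightOneSpectrum.valuation_le_one _ s

/-- The data only see global integers. A local integer is a fraction `r / s` with `s` outside `v`,
and the image of `s` is again a unit at the corresponding place, so the numerator carries the
valuation on both sides. -/
theorem exists_valuation_fieldEquiv_eq (v : HeightOneSpectrum (𝓞 K)) {x : K}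
    (hx : v.valuation K x ≤ 1) : ∃ r s : 𝓞 K, s ∉ v.asIdeal ∧
      x * algebraMap (𝓞 K) K s = algebraMap (𝓞 K) K r ∧
      v.valuation K x = v.valuation K (algebraMap (𝓞 K) K r) ∧
      (f.primeEquiv v).valuation L (f.fieldEquiv x) =
        (f.primeEquiv v).valuation L (f.fieldEquiv (algebraMap (𝓞 K) K r)) := by
  obtain ⟨r, ⟨s, hs⟩, h⟩ := v.exists_primeCompl_mul_eq_of_integer (K := K) x hx
  refine ⟨r, s, hs, h, ?_, ?_⟩
  · rw [← h, map_mul, (v.valuation_eq_one_iff_notMem (K := K)).mpr hs, mul_one]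
  · rw [← h, map_mul, map_mul]
    have : (f.primeEquiv v).valuation L (f.fieldEquiv (algebraMap (𝓞 K) K s)) = 1 :=
      le_antisymm (f.valuation_fieldEquiv_algebraMap_le_one v s) (not_lt.mp fun hlt =>
        hs ((f.valuation_fieldEquiv_algebraMap_lt_one_iff v s).mp hlt))
    rw [this, mul_one]

theorem valuation_fieldEquiv_le_one (v : HeightOneSpectrum (𝓞 K)) {x : K}
    (hx : v.valuation K x ≤ 1) :
    (f.primeEquiv v).valuation L (f.fieldEquiv x) ≤ 1 := by
  obtain ⟨r, s, -, -, -, h⟩ := f.exists_valuation_fieldEquiv_eq v hx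
  rw [h]
  exact f.valuation_fieldEquiv_algebraMap_le_one v r

theorem valuation_fieldEquiv_lt_one (v : HeightOneSpectrum (𝓞 K)) {x : K}
    (hx : v.valuation K x < 1) :
    (f.primeEquiv v).valuation L (f.fieldEquiv x) < 1 := by
  obtain ⟨r, s, -, -, h', h⟩ := f.exists_valuation_fieldEquiv_eq v hx.le
  rw [h, f.valuation_fieldEquiv_algebraMap_lt_one_iff, ← v.valuation_lt_one_iff_mem (K := K)]
  exact h' ▸ hx

theorem valuation_fieldEquiv_le_one_iff (v : HeightOneSpectrum (𝓞 K)) (x : K) :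
    (f.primeEquiv v).valuation L (f.fieldEquiv x) ≤ 1 ↔ v.valuation K x ≤ 1 := by
  refine ⟨fun h => ?_, f.valuation_fieldEquiv_le_one v⟩
  have := f.symm.valuation_fieldEquiv_le_one _ h
  rwa [f.symm_primeEquiv_apply, fieldEquiv_symm_apply, MulEquiv.symm_apply_apply] at this

theorem valuation_fieldEquiv_lt_one_iff (v : HeightOneSpectrum (𝓞 K)) (x : K) :
    (f.primeEquiv v).valuation L (f.fieldEquiv x) < 1 ↔ v.valuation K x < 1 := by
  refine ⟨fun h => ?_, f.valuation_fieldEquiv_lt_one v⟩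
  have := f.symm.valuation_fieldEquiv_lt_one _ h
  rwa [f.symm_primeEquiv_apply, fieldEquiv_symm_apply, MulEquiv.symm_apply_apply] at this

theorem valuation_fieldEquiv_eq_one_iff (v : HeightOneSpectrum (𝓞 K)) (x : K) :
    (f.primeEquiv v).valuation L (f.fieldEquiv x) = 1 ↔ v.valuation K x = 1 := by
  have h1 := f.valuation_fieldEquiv_lt_one_iff v x
  have h2 := f.valuation_fieldEquiv_le_one_iff v x
  constructor
  · intro h
    exact le_antisymm (h2.mp h.le) (not_lt.mp fun hlt => (h1.mpr hlt).ne h)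
  · intro h
    exact le_antisymm (h2.mpr h.le) (not_lt.mp fun hlt => (h1.mp hlt).ne h)

theorem valuation_fieldEquiv_sub_one_lt_one_iff (v : HeightOneSpectrum (𝓞 K)) (x : K) :
    (f.primeEquiv v).valuation L (f.fieldEquiv x - 1) < 1 ↔
      v.valuation K (x - 1) < 1 :=
  f.mem_U v x

/-- Congruences modulo a maximal ideal are preserved. -/
theorem valuation_fieldEquiv_sub_lt_one (v : HeightOneSpectrum (𝓞 K)) {x y : K}
    (hy : v.valuation K y = 1) (hxy : v.valuation K (x - y) < 1) :
    (f.primeEquiv v).valuation L (f.fieldEquiv x - f.fieldEquiv y) < 1 := by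
  have hy0 : y ≠ 0 := by
    rintro rfl
    simp at hy
  -- Without addition, a congruence between `v`-units is expressed by their quotient lying in `1 + 𝔭
  -- O_{K,𝔭}`, which `f` preserves.
  have h1 : v.valuation K (x / y - 1) < 1 := by
    rwa [div_sub_one hy0, map_div₀, hy, div_one]
  rw [← f.valuation_fieldEquiv_sub_one_lt_one_iff] at h1
  have hy0' : f.fieldEquiv y ≠ 0 := by simpa using hy0
  rwa [map_div₀, div_sub_one hy0', map_div₀, (f.valuation_fieldEquiv_eq_one_iff v y).mpr hy,
    div_one] at h1

/-- This describes uniformizers through division and the relations `< 1` and `≤ 1` alone, all of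
which are respected by an isomorphism of data. -/
theorem _root_.NumberField.valuation_eq_exp_neg_one_iff (v : HeightOneSpectrum (𝓞 K)) {x : K}
    (hx : x ≠ 0) : v.valuation K x = WithZero.exp (-1 : ℤ) ↔
      v.valuation K x < 1 ∧ ∀ y : K, v.valuation K y < 1 → v.valuation K (y / x) ≤ 1 := by
  have hx0 : 0 < v.valuation K x := zero_lt_iff.mpr ((Valuation.ne_zero_iff _).mpr hx)
  constructor
  · intro h
    refine ⟨by rw [h, ← WithZero.exp_zero, WithZero.exp_lt_exp]; omega, fun y hy => ?_⟩
    rw [map_div₀, div_le_one₀ hx0, h]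
    exact WithZero.le_exp_neg_one_of_lt_one hy
  · rintro ⟨h1, h2⟩
    refine le_antisymm (WithZero.le_exp_neg_one_of_lt_one h1) ?_
    obtain ⟨π, hπ⟩ := v.valuation_exists_uniformizer K
    have h3 := h2 π (by rw [hπ, ← WithZero.exp_zero, WithZero.exp_lt_exp]; omega)
    rwa [map_div₀, div_le_one₀ hx0, hπ] at h3

theorem valuation_fieldEquiv_eq_exp_neg_one (v : HeightOneSpectrum (𝓞 K)) {x : K}
    (hx : v.valuation K x = WithZero.exp (-1 : ℤ)) :
    (f.primeEquiv v).valuation L (f.fieldEquiv x) = WithZero.exp (-1 : ℤ) := by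
  have hx0 : x ≠ 0 := by
    rintro rfl
    rw [map_zero] at hx
    exact WithZero.exp_ne_zero hx.symm
  rw [NumberField.valuation_eq_exp_neg_one_iff _ hx0] at hx
  rw [NumberField.valuation_eq_exp_neg_one_iff _ (by simpa using hx0)]
  refine ⟨f.valuation_fieldEquiv_lt_one v hx.1, fun y hy => ?_⟩
  obtain ⟨z, rfl⟩ := f.fieldEquiv.surjective y
  rw [← map_div₀, f.valuation_fieldEquiv_le_one_iff]
  exact hx.2 z ((f.valuation_fieldEquiv_lt_one_iff v z).mp hy)

/-- Take a generator `g` of the multiplicative group of the residue field. The image of `g` becomes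
congruent to `1` in the power `q' - 1`, where `q'` is the target cardinality; as the subsets `U`
correspond, so does `g`, and its order `q - 1` divides `q' - 1`. -/
theorem residueCard_sub_one_dvd (v : HeightOneSpectrum (𝓞 K)) :
    residueCard v - 1 ∣ residueCard (f.primeEquiv v) - 1 := by
  obtain ⟨g, hg, h⟩ := exists_generator_residueField v
  obtain ⟨s, hs, hs'⟩ := f.exists_fieldEquiv_eq g
  have h1 := pow_residueCard_sub_one_sub_one_mem (K := L) (f.primeEquiv v) (r := s)
    (fun hmem => hg ((hs' v).mp hmem))
  rw [← h, ← v.valuation_lt_one_iff_mem (K := K), Algebra.cast, map_sub, map_pow, map_one,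
    ← f.valuation_fieldEquiv_sub_one_lt_one_iff, map_pow, hs]
  rw [← HeightOneSpectrum.valuation_lt_one_iff_mem (K := L), Algebra.cast, map_sub, map_pow,
    map_one] at h1
  exact h1

theorem residueCard_primes (v : HeightOneSpectrum (𝓞 K)) :
    residueCard (f.primeEquiv v) = residueCard v := by
  have h1 := f.residueCard_sub_one_dvd v
  have h2 := f.symm.residueCard_sub_one_dvd (f.primeEquiv v)
  rw [f.symm_primeEquiv_apply] at h2
  have h3 := Nat.dvd_antisymm h1 h2
  have h4 := one_lt_residueCard v
  have h5 := one_lt_residueCard (f.primeEquiv v)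
  omega

theorem prime_mem_primes_iff (v : HeightOneSpectrum (𝓞 K)) {p : ℕ} (hp : p.Prime) :
    (p : 𝓞 L) ∈ (f.primeEquiv v).asIdeal ↔ (p : 𝓞 K) ∈ v.asIdeal := by
  rw [prime_mem_iff_dvd_residueCard v hp, prime_mem_iff_dvd_residueCard (K := L) _ hp,
    f.residueCard_primes]

/-- Away from the ramified primes, an integer is mapped to a unit multiple of itself. -/
theorem exists_valuation_fieldEquiv_natCast_eq :
    ∃ D : ℕ, D ≠ 0 ∧ ∀ n : ℕ, n.Coprime D → ∀ w : HeightOneSpectrum (𝓞 L),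
      w.valuation L (f.fieldEquiv n) = w.valuation L n := by
  obtain ⟨D₁, hD₁, h₁⟩ := exists_forall_valuation_natCast_eq_exp K
  obtain ⟨D₂, hD₂, h₂⟩ := exists_forall_valuation_natCast_eq_exp L
  -- A prime `p` not dividing `D₁ * D₂` is a uniformizer at every place above it in either field,
  -- and places above `p` correspond to places above `p`; at all other places both sides are units.
  refine ⟨D₁ * D₂, mul_ne_zero hD₁ hD₂, fun n => ?_⟩
  induction n using induction_on_primes with
  | zero => intro _ w; simp
  | one => intro _ w; simp
  | prime_mul p a hp ih =>
    intro hcop w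
    obtain ⟨v, rfl⟩ := f.primeEquiv.surjective w
    rw [Nat.cast_mul, Nat.cast_mul, map_mul, map_mul, map_mul,
      ih (Nat.Coprime.coprime_mul_left hcop)]
    congr 1
    have hpD : ¬ p ∣ D₁ * D₂ :=
      (Nat.Prime.coprime_iff_not_dvd hp).mp (Nat.Coprime.coprime_mul_right hcop)
    by_cases hv : (p : 𝓞 K) ∈ v.asIdeal
    · rw [f.valuation_fieldEquiv_eq_exp_neg_one v
        (h₁ p hp (fun h => hpD (h.mul_right _)) v hv)]
      exact (h₂ p hp (fun h => hpD (h.mul_left _)) _ ((f.prime_mem_primes_iff v hp).mpr hv)).symm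
    · have e1 : v.valuation K (p : K) = 1 := le_antisymm (valuation_natCast_le_one v p)
        (not_lt.mp fun h => hv ((valuation_natCast_lt_one_iff v p).mp h))
      have e2 : (f.primeEquiv v).valuation L (p : L) = 1 :=
        le_antisymm (valuation_natCast_le_one (K := L) (f.primeEquiv v) p)
        (not_lt.mp fun h => hv ((f.prime_mem_primes_iff v hp).mp
          ((valuation_natCast_lt_one_iff (K := L) (f.primeEquiv v) p).mp h)))
      rw [e2, f.valuation_fieldEquiv_eq_one_iff, e1]

/-- Outside these finitely many places, a global unit congruent to `1` is equal to `1`. -/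
theorem _root_.NumberField.finite_units_sub_one_mem [Finite (𝓞 L)ˣ] :
    {w : HeightOneSpectrum (𝓞 L) | ∃ u : (𝓞 L)ˣ, u ≠ 1 ∧
      w.valuation L (algebraMap (𝓞 L) L u - 1) < 1}.Finite := by
  have : {w : HeightOneSpectrum (𝓞 L) | ∃ u : (𝓞 L)ˣ, u ≠ 1 ∧
      w.valuation L (algebraMap (𝓞 L) L u - 1) < 1} ⊆ ⋃ u ∈ {u : (𝓞 L)ˣ | u ≠ 1},
      {w : HeightOneSpectrum (𝓞 L) | w.valuation L (algebraMap (𝓞 L) L u - 1) < 1} := by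
    rintro w ⟨u, hu, hw⟩
    exact Set.mem_biUnion hu hw
  refine (Set.Finite.biUnion (Set.toFinite _) fun u hu => finite_valuation_lt_one ?_).subset this
  rw [ne_eq, sub_eq_zero]
  intro h
  exact hu (Units.ext (FaithfulSMul.algebraMap_injective (𝓞 L) L (by simpa using h)))

/-- The integers in a suitable residue class are fixed. -/
theorem exists_fieldEquiv_natCast_eq [Finite (𝓞 L)ˣ] :
    ∃ D : ℕ, D ≠ 0 ∧ ∀ m : ℕ, f.fieldEquiv (1 + D * m : ℕ) = (1 + D * m : ℕ) := by
  obtain ⟨D, hD, h⟩ := f.exists_valuation_fieldEquiv_natCast_eq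
  obtain ⟨w, hw⟩ := exists_heightOneSpectrum_notMem
    ((finite_units_sub_one_mem (L := L)).union (finite_natCast_mem (K := L) hD))
  obtain ⟨v, rfl⟩ := f.primeEquiv.surjective w
  have hN := one_lt_residueCard v
  -- The factor `D` makes `n` prime to the exceptional primes, so `f n / n` is a unit of `𝓞 L`. The
  -- factor `residueCard v` is also the residue cardinality at the image of `v`; it makes `n`, hence
  -- `f n` and this unit, congruent to `1` there, and by the choice of the place the unit is `1`.
  refine ⟨D * residueCard v, mul_ne_zero hD (by omega), fun m => ?_⟩
  set n : ℕ := 1 + D * residueCard v * m with hn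
  have hn0 : (n : L) ≠ 0 := by
    rw [hn]; exact_mod_cast (by omega : 1 + D * residueCard v * m ≠ 0)
  have hcop : n.Coprime D := by
    rw [hn, mul_assoc]
    simp [Nat.coprime_add_mul_left_left]
  have hfn0 : f.fieldEquiv n ≠ 0 := by
    rw [map_ne_zero]; exact_mod_cast (by omega : 1 + D * residueCard v * m ≠ 0)
  obtain ⟨u, hu⟩ := exists_units_eq_of_valuation_eq_one (x := f.fieldEquiv n / n)
    (div_ne_zero hfn0 hn0) (fun w => by
      rw [map_div₀, h n hcop w, div_self]
      simpa using hn0)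
  have hvn : v.valuation K ((n : K) - 1) < 1 := by
    have e : (n : K) - 1 = (residueCard v * (D * m) : ℕ) := by rw [hn]; push_cast; ring
    rw [e, valuation_natCast_lt_one_iff, Nat.cast_mul]
    exact v.asIdeal.mul_mem_right _ (residueCard_mem v)
  have hwn : (f.primeEquiv v).valuation L ((n : L) - 1) < 1 := by
    have e : (n : L) - 1 = (residueCard (f.primeEquiv v) * (D * m) : ℕ) := by
      rw [f.residueCard_primes, hn]; push_cast; ring
    rw [e, valuation_natCast_lt_one_iff (K := L), Nat.cast_mul]
    exact Ideal.mul_mem_right _ _ (residueCard_mem (K := L) (f.primeEquiv v))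
  have hwn1 : (f.primeEquiv v).valuation L (n : L) = 1 := by
    rw [← ((f.primeEquiv v).valuation L).map_one]
    have := ((f.primeEquiv v).valuation L).map_sub_swap (n : L) 1
    exact (((f.primeEquiv v).valuation L).map_eq_of_sub_lt
      (by simpa using hwn))
  have hfn : (f.primeEquiv v).valuation L (f.fieldEquiv n - 1) < 1 :=
    (f.valuation_fieldEquiv_sub_one_lt_one_iff v n).mpr hvn
  have hu1 : (f.primeEquiv v).valuation L (algebraMap (𝓞 L) L u - 1) < 1 := by
    rw [← hu, div_sub_one hn0, map_div₀, hwn1, div_one]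
    have e : f.fieldEquiv n - n = (f.fieldEquiv n - 1) - (n - 1) := by ring
    rw [e]
    exact Valuation.map_sub_lt _ hfn hwn
  have : u = 1 := by
    by_contra hne
    exact hw (Or.inl ⟨u, hne, hu1⟩)
  rw [this, Units.val_one, map_one, div_eq_one_iff_eq hn0] at hu
  exact hu

/-- If the two sides differed, only finitely many places would divide the difference. At a place
outside these, `x` is congruent to an integer that may be taken among those fixed by `f`; this
determines `f x` and `f (1 + x)` there and forces the congruence that was excluded. -/
theorem fieldEquiv_one_add [Finite (𝓞 K)ˣ] [Finite (𝓞 L)ˣ] (x : K) :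
    f.fieldEquiv (1 + x) = 1 + f.fieldEquiv x := by
  rcases eq_or_ne x 0 with rfl | hx
  · simp
  rcases eq_or_ne (1 + x) 0 with hx1 | hx1
  · have hx' : x = -1 := by linear_combination hx1
    subst hx'
    -- The case `x = -1`, where `1 + x` is not a unit anywhere: the image of `-1` is a square root
    -- of `1` other than `1`.
    have h1 : f.fieldEquiv (-1) * f.fieldEquiv (-1) = 1 := by
      rw [← map_mul, neg_mul_neg, one_mul, map_one]
    rcases mul_self_eq_one_iff.mp h1 with h | h
    · rw [← map_one f.fieldEquiv] at h
      have := f.fieldEquiv.injective h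
      norm_num at this
    · rw [h, hx1, fieldEquiv_zero]; ring
  by_contra hne
  obtain ⟨D, hD, hDm⟩ := f.exists_fieldEquiv_natCast_eq
  have hfin1 := (finite_valuation_lt_one (sub_ne_zero.mpr hne)).preimage
    (f.primeEquiv.injective.injOn)
  have hfin2 := (finite_natCast_mem (K := L) hD).preimage (f.primeEquiv.injective.injOn)
  obtain ⟨v, hv, m, hm⟩ := exists_valuation_sub_natCast_lt_one hx
    ((((hfin1.union hfin2).union (finite_natCast_mem (K := K) hD)).union
      (finite_valuation_lt_one hx)).union (finite_valuation_lt_one hx1))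
  simp only [Set.mem_union, not_or, Set.mem_preimage, Set.mem_ofPred_eq] at hv
  obtain ⟨⟨⟨⟨hv1, hv2⟩, hv3⟩, hv4⟩, hv5⟩ := hv
  have hq := one_lt_residueCard v
  -- `N` is divisible by `D`, so `1 + N k` is fixed by `f`, and `N ≡ 1` at `v` and at its image, so
  -- `1 + N k ≡ k + 1` at both.
  set N : ℕ := D ^ (residueCard v - 1) with hN
  obtain ⟨N', hN'⟩ : D ∣ N := dvd_pow_self D (by omega)
  have hvN : v.valuation K ((N : K) - 1) < 1 := by
    have := pow_residueCard_sub_one_sub_one_mem v hv3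
    rw [← v.valuation_lt_one_iff_mem (K := K), Algebra.cast, map_sub, map_pow, map_one,
      map_natCast] at this
    rwa [hN, Nat.cast_pow]
  have hwN : (f.primeEquiv v).valuation L ((N : L) - 1) < 1 := by
    have := pow_residueCard_sub_one_sub_one_mem (K := L) (f.primeEquiv v) hv2
    rw [← HeightOneSpectrum.valuation_lt_one_iff_mem (K := L), Algebra.cast, map_sub, map_pow,
      map_one, map_natCast, f.residueCard_primes] at this
    rwa [hN, Nat.cast_pow]
  have hmulN : ∀ k : ℕ, v.valuation K (((N : K) - 1) * k) < 1 := fun k => by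
    rw [map_mul]
    exact mul_lt_one_of_lt_of_le hvN (valuation_natCast_le_one v k)
  have hfix : ∀ k : ℕ, f.fieldEquiv (1 + N * k : ℕ) = (1 + N * k : ℕ) := fun k => by
    rw [hN', mul_assoc]
    exact hDm _
  have hcong : ∀ (y : K) (k : ℕ), ¬ v.valuation K y < 1 → v.valuation K (y - (k + 1 : ℕ)) < 1 →
      (f.primeEquiv v).valuation L (f.fieldEquiv y - (1 + N * k : ℕ)) < 1 := by
    intro y k hy hyk
    have e : y - (1 + N * k : ℕ) = (y - (k + 1 : ℕ)) - ((N : K) - 1) * k := by push_cast; ring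
    have h1 : v.valuation K (y - (1 + N * k : ℕ)) < 1 := by
      rw [e]
      exact Valuation.map_sub_lt _ hyk (hmulN k)
    rw [← hfix]
    refine f.valuation_fieldEquiv_sub_lt_one v (le_antisymm (valuation_natCast_le_one v _)
      (not_lt.mp fun h => hy ?_)) h1
    have := Valuation.map_add_lt _ h1 h
    rwa [sub_add_cancel] at this
  have c1 := hcong x m hv4 hm
  have c2 := hcong (1 + x) (m + 1) hv5 (by
    have e : 1 + x - ((m + 1 + 1 : ℕ) : K) = x - (m + 1 : ℕ) := by push_cast; ring
    rwa [e])
  refine hv1 ?_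
  have e : f.fieldEquiv (1 + x) - (1 + f.fieldEquiv x) =
      (f.fieldEquiv (1 + x) - (1 + N * (m + 1) : ℕ)) - (f.fieldEquiv x - (1 + N * m : ℕ)) +
        ((N : L) - 1) := by push_cast; ring
  rw [e]
  exact Valuation.map_add_lt _ (Valuation.map_sub_lt _ c2 c1) hwN

/-- An isomorphism between the arithmetic data of number fields with finitely many units is
additive. -/
theorem fieldEquiv_add [Finite (𝓞 K)ˣ] [Finite (𝓞 L)ˣ] (x y : K) :
    f.fieldEquiv (x + y) = f.fieldEquiv x + f.fieldEquiv y := by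
  rcases eq_or_ne x 0 with rfl | hx
  · simp
  have : x + y = x * (1 + y / x) := by field_simp
  rw [this, map_mul, f.fieldEquiv_one_add, map_div₀, mul_add, mul_one, mul_div_cancel₀]
  simpa using hx

/-- An isomorphism between the arithmetic data of number fields with finitely many units, as an
isomorphism of fields. -/
def fieldRingEquiv [Finite (𝓞 K)ˣ] [Finite (𝓞 L)ˣ]
    (f : (numberFieldData K).Iso (numberFieldData L)) : K ≃+* L :=
  { f.fieldEquiv with map_add' := f.fieldEquiv_add }

end NumberFields

end MulFieldData.Iso

/-! ### The infinite place, and global elements with trivial class -/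

section Archimedean

variable {K : Type*} [Field K] [NumberField K]

namespace NumberField

theorem IsRationalOrImaginaryQuadratic.subsingleton_infinitePlace
    (hK : IsRationalOrImaginaryQuadratic K) : Subsingleton (InfinitePlace K) := by
  have h := InfinitePlace.card_add_two_mul_card_eq_rank K
  rw [← Fintype.card_le_one_iff_subsingleton,
    InfinitePlace.card_eq_nrRealPlaces_add_nrComplexPlaces]
  rcases hK with ⟨⟨e⟩⟩ | ⟨h2, hc⟩
  · have : Module.finrank ℚ K = 1 := by
      rw [← Module.finrank_self ℚ]
      exact LinearEquiv.finrank_eq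
        ({ e with map_smul' := map_rat_smul e.toAddMonoidHom } : K ≃ₗ[ℚ] ℚ)
    omega
  · have := IsTotallyComplex.nrRealPlaces_eq_zero K
    omega

/-- The logarithmic embedding takes values in functions on the infinite places other than a
distinguished one. Here there are none, so every unit is a root of unity. -/
theorem finite_units_of_subsingleton_infinitePlace [Subsingleton (InfinitePlace K)] :
    Finite (𝓞 K)ˣ := by
  have : Units.torsion K = ⊤ := by
    rw [eq_top_iff]
    intro x _
    rw [← Units.dirichletUnitTheorem.logEmbedding_eq_zero_iff]
    funext w
    exact absurd (Subsingleton.elim _ _) w.2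
  exact Finite.of_equiv (Units.torsion K) ((MulEquiv.subgroupCongr this).trans
    Subgroup.topEquiv).toEquiv

theorem continuous_unitsMk0_exp :
    Continuous fun t : ℝ => Units.mk0 (Real.exp t) (Real.exp_ne_zero t) := by
  rw [Units.continuous_iff]
  exact ⟨Real.continuous_exp, Real.continuous_exp.inv₀ Real.exp_ne_zero⟩

theorem continuous_unitsMk0_cexp :
    Continuous fun t : ℂ => Units.mk0 (Complex.exp t) (Complex.exp_ne_zero t) := by
  rw [Units.continuous_iff]
  exact ⟨Complex.continuous_exp, Complex.continuous_exp.inv₀ Complex.exp_ne_zero⟩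

/-- An element that is positive at the real places lies in the connected component of `1` at
every infinite place. -/
theorem exists_isPreconnected_completion {K : Type*} [Field K] (w : InfinitePlace K) (k : Kˣ)
    (hk : ∀ hw : w.IsReal, 0 < InfinitePlace.embedding_of_isReal hw (k : K)) :
    ∃ S : Set (w.Completion)ˣ, IsPreconnected S ∧ 1 ∈ S ∧
      Units.map (algebraMap K w.Completion).toMonoidHom k ∈ S := by
  rcases w.isReal_or_isComplex with hw | hw
  · let e := InfinitePlace.Completion.ringEquivRealOfIsReal hw
    have he : Continuous e.symm.toMonoidHom :=
      (InfinitePlace.Completion.isometryEquivRealOfIsReal hw).symm.continuous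
    -- The image of the exponential is connected and contains `1`; it contains `k` by positivity. At
    -- a complex place the complex exponential reaches every nonzero element.
    refine ⟨Set.range fun t : ℝ => Units.map e.symm.toMonoidHom
      (Units.mk0 (Real.exp t) (Real.exp_ne_zero t)), isPreconnected_range
        ((he.units_map _).comp continuous_unitsMk0_exp), ⟨0, ?_⟩,
        ⟨Real.log (InfinitePlace.embedding_of_isReal hw (k : K)), ?_⟩⟩
    · refine Units.ext ?_
      simp
    · refine Units.ext ?_
      change e.symm (Real.exp (Real.log _)) = algebraMap K w.Completion k
      rw [Real.exp_log (hk hw), RingEquiv.symm_apply_eq]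
      exact (InfinitePlace.Completion.extensionEmbeddingOfIsReal_coe hw
        ((WithAbs.equiv w.1).symm (k : K))).symm
  · let e := InfinitePlace.Completion.ringEquivComplexOfIsComplex hw
    have he : Continuous e.symm.toMonoidHom :=
      (InfinitePlace.Completion.isometryEquivComplexOfIsComplex hw).symm.continuous
    refine ⟨Set.range fun t : ℂ => Units.map e.symm.toMonoidHom
      (Units.mk0 (Complex.exp t) (Complex.exp_ne_zero t)), isPreconnected_range
        ((he.units_map _).comp continuous_unitsMk0_cexp), ⟨0, ?_⟩,
        ⟨Complex.log (w.embedding (k : K)), ?_⟩⟩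
    · refine Units.ext ?_
      simp
    · refine Units.ext ?_
      change e.symm (Complex.exp (Complex.log _)) = algebraMap K w.Completion k
      rw [Complex.exp_log (by simp), RingEquiv.symm_apply_eq]
      exact (InfinitePlace.Completion.extensionEmbedding_coe w
        ((WithAbs.equiv w.1).symm (k : K))).symm

/-- The component of an element of `Kˣ` at the infinite places. -/
noncomputable def infiniteEmbedding (K : Type*) [Field K] [NumberField K] :
    Kˣ →* (InfiniteAdeleRing K)ˣ :=
  Units.map (algebraMap K (InfiniteAdeleRing K)).toMonoidHom

theorem infiniteEmbedding_mem_connectedComponentOfOne (k : Kˣ)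
    (hk : ∀ (w : InfinitePlace K) (hw : w.IsReal),
      0 < InfinitePlace.embedding_of_isReal hw (k : K)) :
    infiniteEmbedding K k ∈ Subgroup.connectedComponentOfOne (InfiniteAdeleRing K)ˣ := by
  choose S hS h1 hkS using fun w => exists_isPreconnected_completion w k (hk w)
  let Φ : (∀ w : InfinitePlace K, (w.Completion)ˣ) ≃ₜ* (InfiniteAdeleRing K)ˣ :=
    (ContinuousMulEquiv.piUnits (M := fun w : InfinitePlace K => w.Completion)).symm
  have hpre : IsPreconnected (Φ '' Set.pi Set.univ S) :=
    (isPreconnected_univ_pi hS).image _ Φ.continuous.continuousOn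
  refine hpre.subset_connectedComponent ⟨1, fun w _ => h1 w, map_one Φ⟩
    ⟨fun w => Units.map (algebraMap K w.Completion).toMonoidHom k, fun w _ => hkS w, ?_⟩
  ext
  rfl

/-- For a rational or imaginary quadratic field, `k` or `-k` is positive at the real places. -/
theorem infiniteEmbedding_mem_or_neg_mem [Subsingleton (InfinitePlace K)] (k : Kˣ) :
    infiniteEmbedding K k ∈ Subgroup.connectedComponentOfOne (InfiniteAdeleRing K)ˣ ∨
      infiniteEmbedding K (-k) ∈ Subgroup.connectedComponentOfOne (InfiniteAdeleRing K)ˣ := by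
  by_cases h : ∀ (w : InfinitePlace K) (hw : w.IsReal),
      0 < InfinitePlace.embedding_of_isReal hw (k : K)
  · exact Or.inl (infiniteEmbedding_mem_connectedComponentOfOne k h)
  · push Not at h
    obtain ⟨w, hw, hle⟩ := h
    refine Or.inr (infiniteEmbedding_mem_connectedComponentOfOne (-k) fun w' hw' => ?_)
    obtain rfl := Subsingleton.elim w w'
    rw [Units.val_neg, map_neg, neg_pos]
    exact lt_of_le_of_ne hle (by simp)

end NumberField

/-- The diagonal embedding of `Kˣ` into the finite ideles. -/
noncomputable abbrev finiteEmbedding (K : Type*) [Field K] [NumberField K] :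
    Kˣ →* (FiniteAdeleRing (𝓞 K) K)ˣ :=
  Units.map (algebraMap K (FiniteAdeleRing (𝓞 K) K)).toMonoidHom

/-- The principal idele of `k` is the product of its infinite and finite components. The principal
idele and the infinite component both lie in `globalIdeles K`, so the finite one does too. -/
theorem finiteRec_finiteEmbedding_eq_one {k : Kˣ}
    (hk : infiniteEmbedding K k ∈ Subgroup.connectedComponentOfOne (InfiniteAdeleRing K)ˣ) :
    finiteRec K (finiteEmbedding K k) = 1 := by
  refine (QuotientGroup.eq_one_iff _).mpr (Subgroup.le_topologicalClosure _ ?_)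
  have h1 : Units.map (algebraMap K (AdeleRing (𝓞 K) K)).toMonoidHom k ∈ globalIdeles K :=
    Subgroup.mem_sup_left ⟨k, rfl⟩
  have h2 : Units.map (infiniteToAdele K) (infiniteEmbedding K k) ∈ globalIdeles K :=
    Subgroup.mem_sup_right (Subgroup.mem_map_of_mem _ hk)
  have h3 : Units.map (algebraMap K (AdeleRing (𝓞 K) K)).toMonoidHom k =
      Units.map (infiniteToAdele K) (infiniteEmbedding K k) *
        Units.map (finiteToAdele K) (finiteEmbedding K k) := by
    ext : 1
    exact Prod.ext (mul_one (algebraMap K (InfiniteAdeleRing K) k)).symm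
      (one_mul (algebraMap K (FiniteAdeleRing (𝓞 K) K) k)).symm
  rw [h3] at h1
  exact (Subgroup.mul_mem_cancel_left _ h2).mp h1

theorem finiteRec_finiteEmbedding_eq_one_or [Subsingleton (InfinitePlace K)] (k : Kˣ) :
    finiteRec K (finiteEmbedding K k) = 1 ∨ finiteRec K (finiteEmbedding K (-k)) = 1 :=
  (infiniteEmbedding_mem_or_neg_mem k).imp finiteRec_finiteEmbedding_eq_one
    finiteRec_finiteEmbedding_eq_one

end Archimedean

/-! ### Powers and convergence in the completions -/

section LocalFields

open WithZero

variable {K : Type*} [Field K] [NumberField K] (v : HeightOneSpectrum (𝓞 K))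

namespace NumberField

theorem tendsto_adicCompletion_of_forall_le {ι : Type*} {F : Filter ι}
    {f : ι → v.adicCompletion K} {a : v.adicCompletion K}
    (h : ∀ k : ℕ, ∀ᶠ i in F, Valued.v (f i - a) ≤ exp (-(k : ℤ))) : Tendsto f F (𝓝 a) := by
  intro s hs
  obtain ⟨γ, hγ⟩ := Valued.mem_nhds.mp hs
  have h0 : MonoidWithZeroHom.ValueGroup₀.embedding (γ : MonoidWithZeroHom.ValueGroup₀
      (.ofClass (Valued.v : Valuation (v.adicCompletion K) ℤᵐ⁰))) ≠ 0 := by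
    rw [map_ne_zero]
    exact γ.ne_zero
  set g : ℤᵐ⁰ := MonoidWithZeroHom.ValueGroup₀.embedding (γ : MonoidWithZeroHom.ValueGroup₀
      (.ofClass (Valued.v : Valuation (v.adicCompletion K) ℤᵐ⁰))) with hg
  rw [Filter.mem_map]
  filter_upwards [h ((log g).natAbs + 1)] with i hi
  refine hγ ?_
  rw [Set.mem_ofPred_eq, Valuation.restrict_lt_iff_lt_embedding]
  refine hi.trans_lt ?_
  rw [← hg]
  conv_rhs => rw [← exp_log h0]
  rw [exp_lt_exp]
  omega

theorem isOpen_valued_sub_lt (a b : v.adicCompletion K) :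
    IsOpen {y : v.adicCompletion K | Valued.v (y - a) < Valued.v b} := by
  have h := (Valued.isOpen_ball (v.adicCompletion K)
    ((Valued.v : Valuation (v.adicCompletion K) ℤᵐ⁰).restrict b)).preimage
      (continuous_id.sub (continuous_const (y := a)))
  convert h using 1
  ext y
  exact (Valuation.restrict_lt_iff (Valued.v : Valuation (v.adicCompletion K) ℤᵐ⁰)).symm

theorem eventually_valued_sub_lt {ι : Type*} {F : Filter ι}
    {f : ι → v.adicCompletion K} {a : v.adicCompletion K} (h : Tendsto f F (𝓝 a))
    {b : v.adicCompletion K} (hb : b ≠ 0) : ∀ᶠ i in F, Valued.v (f i - a) < Valued.v b :=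
  h ((isOpen_valued_sub_lt v a b).mem_nhds (by
    rw [Set.mem_ofPred_eq, sub_self, map_zero]
    exact zero_lt_iff.mpr ((Valuation.ne_zero_iff _).mpr hb)))

theorem valued_natCast (n : ℕ) :
    Valued.v (n : v.adicCompletion K) = v.valuation K (n : K) := by
  rw [← HeightOneSpectrum.adicCompletion.valued_coe]
  congr 1
  exact (map_natCast (algebraMap K (v.adicCompletion K)) n).symm

theorem valued_natCast_le_one (n : ℕ) : Valued.v (n : v.adicCompletion K) ≤ 1 := by
  rw [valued_natCast]
  exact valuation_natCast_le_one v n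

/-- Every local integer is congruent to a global one. -/
theorem exists_ringOfIntegers_sub_lt_one {a : v.adicCompletion K} (ha : Valued.v a ≤ 1) :
    ∃ r : 𝓞 K, Valued.v (a - (algebraMap (𝓞 K) K r : K)) < 1 := by
  obtain ⟨x, hx⟩ := (HeightOneSpectrum.denseRange_algebraMap (K := K) v).exists_mem_open
    (isOpen_valued_sub_lt v a 1) ⟨a, by simp⟩
  rw [Set.mem_ofPred_eq, map_one] at hx
  change Valued.v ((x : v.adicCompletion K) - a) < 1 at hx
  have hx1 : v.valuation K x ≤ 1 := by
    rw [← HeightOneSpectrum.adicCompletion.valued_coe, ← sub_add_cancel (x : v.adicCompletion K) a]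
    exact (Valuation.map_add _ _ _).trans (max_le hx.le ha)
  obtain ⟨r, hr⟩ := v.exists_valuation_sub_lt_of_integer (K := K) hx1 1
  refine ⟨r, ?_⟩
  rw [← HeightOneSpectrum.adicCompletion.valued_coe] at hr
  have e1 : ((algebraMap (𝓞 K) K r - x : K) : v.adicCompletion K) =
      ((algebraMap (𝓞 K) K r : K) : v.adicCompletion K) - (x : v.adicCompletion K) :=
    map_sub (algebraMap K (v.adicCompletion K)) _ _
  rw [e1, Units.val_one] at hr
  have e2 : a - ((algebraMap (𝓞 K) K r : K) : v.adicCompletion K) =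
      -((x : v.adicCompletion K) - a) -
        (((algebraMap (𝓞 K) K r : K) : v.adicCompletion K) - (x : v.adicCompletion K)) := by ring
  rw [e2]
  exact Valuation.map_sub_lt _ (by rwa [Valuation.map_neg]) hr

/-- The order of the residue field. -/
theorem valued_pow_residueCard_sub_one_lt_one {a : v.adicCompletion K} (ha : Valued.v a = 1) :
    Valued.v (a ^ (residueCard v - 1) - 1) < 1 := by
  obtain ⟨r, hr⟩ := exists_ringOfIntegers_sub_lt_one v ha.le
  set c : v.adicCompletion K := ((algebraMap (𝓞 K) K r : K) : v.adicCompletion K) with hc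
  have hcv : Valued.v c = v.valuation K (algebraMap (𝓞 K) K r) :=
    HeightOneSpectrum.adicCompletion.valued_coe ..
  have hrv : r ∉ v.asIdeal := by
    rw [← v.valuation_lt_one_iff_mem (K := K)]
    intro h
    have h2 := Valuation.map_add_lt _ hr (hcv ▸ h)
    rw [sub_add_cancel, ha] at h2
    exact lt_irrefl _ h2
  have h1 : Valued.v (c ^ (residueCard v - 1) - 1) < 1 := by
    have h3 := pow_residueCard_sub_one_sub_one_mem v hrv
    rw [← v.valuation_lt_one_iff_mem (K := K)] at h3
    rw [← HeightOneSpectrum.adicCompletion.valued_coe] at h3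
    have e : c ^ (residueCard v - 1) - 1 =
        ((algebraMap (𝓞 K) K (r ^ (residueCard v - 1) - 1) : K) : v.adicCompletion K) := by
      change algebraMap K (v.adicCompletion K) (algebraMap (𝓞 K) K r) ^ _ - 1 =
        algebraMap K (v.adicCompletion K) (algebraMap (𝓞 K) K (r ^ (residueCard v - 1) - 1))
      simp only [map_sub, map_pow, map_one]
    rw [e]
    exact h3
  obtain ⟨d, hd⟩ := sub_dvd_pow_sub_pow (⟨a, ha.le⟩ : v.adicCompletionIntegers K)
    ⟨c, by rw [HeightOneSpectrum.mem_adicCompletionIntegers, hcv]; exact v.valuation_le_one _⟩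
    (residueCard v - 1)
  have hd' : a ^ (residueCard v - 1) - c ^ (residueCard v - 1) = (a - c) * d :=
    congrArg Subtype.val hd
  have h4 : Valued.v (a ^ (residueCard v - 1) - c ^ (residueCard v - 1)) < 1 := by
    rw [hd', map_mul]
    exact mul_lt_one_of_lt_of_le hr d.2
  have e : a ^ (residueCard v - 1) - 1 =
      (a ^ (residueCard v - 1) - c ^ (residueCard v - 1)) + (c ^ (residueCard v - 1) - 1) := by
    ring
  rw [e]
  exact Valuation.map_add_lt _ h4 h1

/-- Every residue class is represented in `𝓞 K`, so the finite ring `𝓞 K ⧸ v` surjects onto the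
residue field. -/
instance finite_residueField_adicCompletionIntegers :
    Finite (IsLocalRing.ResidueField (v.adicCompletionIntegers K)) := by
  have := v.asIdeal.finiteQuotientOfFreeOfNeBot v.ne_bot
  have hker : ∀ r ∈ v.asIdeal, ((IsLocalRing.residue (v.adicCompletionIntegers K)).comp
      (algebraMap (𝓞 K) (v.adicCompletionIntegers K))) r = 0 := by
    intro r hr
    rw [RingHom.comp_apply, IsLocalRing.residue_eq_zero_iff, IsLocalRing.mem_maximalIdeal,
      mem_nonunits_iff, HeightOneSpectrum.adicCompletionIntegers.isUnit_iff_valued_eq_one]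
    have h1 := (v.valuation_lt_one_iff_mem (K := K) r).mpr hr
    rw [← HeightOneSpectrum.adicCompletion.valued_coe] at h1
    exact h1.ne
  refine Finite.of_surjective (Ideal.Quotient.lift v.asIdeal _ hker) fun x => ?_
  obtain ⟨a, rfl⟩ := IsLocalRing.residue_surjective x
  obtain ⟨r, hr⟩ := exists_ringOfIntegers_sub_lt_one v a.2
  refine ⟨Ideal.Quotient.mk _ r, ?_⟩
  rw [Ideal.Quotient.lift_mk, RingHom.comp_apply, eq_comm, ← sub_eq_zero, ← map_sub,
    IsLocalRing.residue_eq_zero_iff, IsLocalRing.mem_maximalIdeal,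
      mem_nonunits_iff, HeightOneSpectrum.adicCompletionIntegers.isUnit_iff_valued_eq_one]
  exact hr.ne

/-- Compactness is what makes `DR K` Hausdorff and the maps `O_v → DR K` closed embeddings. -/
instance compactSpace_adicCompletionIntegers : CompactSpace (v.adicCompletionIntegers K) := by
  refine (Valued.integer.compactSpace_iff_completeSpace_and_isDiscreteValuationRing_and_finite_residueField
    (K := v.adicCompletion K)).mpr ⟨?_, ?_, ?_⟩
  · exact (Valued.isClosed_valuationSubring (v.adicCompletion K)).completeSpace_coe
  · exact inferInstanceAs (IsDiscreteValuationRing (v.adicCompletionIntegers K))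
  · exact finite_residueField_adicCompletionIntegers v

/-- The valuation of `y ^ p - 1`. -/
theorem valued_pow_sub_one {y : v.adicCompletion K} (hy : Valued.v (y - 1) < 1) (p : ℕ) :
    ∃ s : v.adicCompletion K, Valued.v (s - p) < 1 ∧ y ^ p - 1 = (y - 1) * s := by
  have hy1 : Valued.v y ≤ 1 := by
    rw [← sub_add_cancel y 1]
    exact (Valuation.map_add _ _ _).trans (max_le hy.le (by simp))
  -- The cofactor is a sum of `p` terms, each congruent to `1`.
  refine ⟨∑ i ∈ Finset.range p, y ^ i, ?_, by rw [mul_comm, geom_sum_mul]⟩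
  have e : ∑ i ∈ Finset.range p, y ^ i - p = ∑ i ∈ Finset.range p, (y ^ i - 1) := by
    rw [Finset.sum_sub_distrib]
    simp
  rw [e]
  refine Valuation.map_sum_lt _ one_ne_zero fun i _ => ?_
  rw [← geom_sum_mul, map_mul]
  refine (mul_le_of_le_one_left' ?_).trans_lt hy
  refine Valuation.map_sum_le _ fun j _ => ?_
  rw [map_pow]
  exact pow_le_one₀ zero_le hy1

theorem valued_pow_sub_one_lt_one {y : v.adicCompletion K} (hy : Valued.v (y - 1) < 1) (p : ℕ) :
    Valued.v (y ^ p - 1) < 1 := by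
  obtain ⟨s, hs, h⟩ := valued_pow_sub_one v hy p
  rw [h, map_mul]
  refine mul_lt_one_of_lt_of_le hy ?_
  rw [← sub_add_cancel s p]
  exact (Valuation.map_add _ _ _).trans (max_le hs.le (valued_natCast_le_one v p))

/-- Each `p`-th power multiplies the distance to `1` by the value of a cofactor congruent to `p`,
which lies in the maximal ideal. -/
theorem valued_pow_prime_pow_sub_one_le {p : ℕ} (hp : Valued.v (p : v.adicCompletion K) < 1)
    {y : v.adicCompletion K} (hy : Valued.v (y - 1) < 1) (n : ℕ) :
    Valued.v (y ^ p ^ n - 1) ≤ exp (-(n + 1 : ℤ)) := by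
  induction n with
  | zero => simpa using WithZero.le_exp_neg_one_of_lt_one hy
  | succ n ih =>
    obtain ⟨s, hs, h⟩ := valued_pow_sub_one v (valued_pow_sub_one_lt_one v hy (p ^ n)) p
    have hs1 : Valued.v s < 1 := by
      rw [← sub_add_cancel s p]
      exact Valuation.map_add_lt _ hs hp
    rw [pow_succ, pow_mul, h, map_mul]
    refine (mul_le_mul' ih (WithZero.le_exp_neg_one_of_lt_one hs1)).trans ?_
    rw [← exp_add, exp_le_exp]
    push_cast
    omega

/-- Here the cofactor is congruent to the unit `p`, so the distance to `1` never changes. This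
separates the other primes from the residue characteristic. -/
theorem valued_pow_prime_pow_sub_one_eq {p : ℕ} (hp : Valued.v (p : v.adicCompletion K) = 1)
    {y : v.adicCompletion K} (hy : Valued.v (y - 1) < 1) (n : ℕ) :
    Valued.v (y ^ p ^ n - 1) = Valued.v (y - 1) := by
  induction n with
  | zero => simp
  | succ n ih =>
    obtain ⟨s, hs, h⟩ := valued_pow_sub_one v (valued_pow_sub_one_lt_one v hy (p ^ n)) p
    have hs1 : Valued.v s = 1 := by
      rw [← hp]
      exact Valuation.map_eq_of_sub_lt _ (by rwa [hp])
    rw [pow_succ, pow_mul, h, map_mul, ih, hs1, mul_one]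

theorem tendsto_pow_prime_pow {p : ℕ} (hp : Valued.v (p : v.adicCompletion K) < 1)
    {y : v.adicCompletion K} (hy : Valued.v (y - 1) < 1) :
    Tendsto (fun n : ℕ => y ^ p ^ n) atTop (𝓝 1) := by
  refine tendsto_adicCompletion_of_forall_le v fun k => ?_
  filter_upwards [eventually_ge_atTop k] with n hn
  refine (valued_pow_prime_pow_sub_one_le v hp hy n).trans ?_
  rw [exp_le_exp]
  omega

/-- In residue characteristic `p`, `(y - 1) ^ p ^ n` is congruent to `y ^ p ^ n - 1` modulo `p`, and
the latter is small for some `n`; the residue field has no nilpotents. -/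
theorem valued_sub_one_lt_one_of_tendsto {p : ℕ} (hp' : p.Prime)
    (hp : Valued.v (p : v.adicCompletion K) < 1) {y : v.adicCompletion K} (hy : Valued.v y ≤ 1)
    (h : Tendsto (fun n : ℕ => y ^ p ^ n) atTop (𝓝 1)) : Valued.v (y - 1) < 1 := by
  obtain ⟨n, hn⟩ := (eventually_valued_sub_lt v h one_ne_zero).exists
  rw [map_one] at hn
  have hy1 : Valued.v (y - 1) ≤ 1 := (Valuation.map_sub _ _ _).trans (max_le hy (by simp))
  obtain ⟨r, hr⟩ := exists_add_pow_prime_pow_eq hp'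
    (⟨y - 1, hy1⟩ : v.adicCompletionIntegers K) 1 n
  have hr' : (y - 1 + 1) ^ p ^ n = (y - 1) ^ p ^ n + 1 ^ p ^ n + p * (y - 1) * 1 * r :=
    congrArg Subtype.val hr
  rw [sub_add_cancel, one_pow] at hr'
  have e : (y - 1) ^ p ^ n = (y ^ p ^ n - 1) - p * ((y - 1) * r) := by rw [hr']; ring
  have h2 : Valued.v ((y - 1) ^ p ^ n) < 1 := by
    rw [e]
    refine Valuation.map_sub_lt _ hn ?_
    rw [map_mul, map_mul]
    exact mul_lt_one_of_lt_of_le hp (mul_le_one' hy1 r.2)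
  rw [map_pow] at h2
  exact (pow_lt_one_iff_of_nonneg zero_le (pow_ne_zero n hp'.ne_zero)).mp h2

theorem eq_one_of_tendsto {p : ℕ} (hp : Valued.v (p : v.adicCompletion K) = 1)
    {y : v.adicCompletion K} (hy : Valued.v (y - 1) < 1)
    (h : Tendsto (fun n : ℕ => y ^ p ^ n) atTop (𝓝 1)) : y = 1 := by
  by_contra hne
  obtain ⟨n, hn⟩ := (eventually_valued_sub_lt v h (sub_ne_zero.mpr hne)).exists
  rw [valued_pow_prime_pow_sub_one_eq v hp hy] at hn
  exact lt_irrefl _ hn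

theorem tendsto_pow_of_valued_lt_one {a : v.adicCompletion K} (ha : Valued.v a < 1) :
    Tendsto (fun n : ℕ => a ^ n) atTop (𝓝 0) := by
  refine tendsto_adicCompletion_of_forall_le v fun k => ?_
  filter_upwards [eventually_ge_atTop k] with n hn
  rw [sub_zero, map_pow]
  refine (pow_le_pow_left₀ zero_le (WithZero.le_exp_neg_one_of_lt_one ha) n).trans ?_
  rw [← exp_nsmul, exp_le_exp]
  simp
  omega

/-- Powers with highly divisible exponents tend to `1`. -/
theorem tendsto_pow_one_of_eventually_dvd {a : v.adicCompletion K} (ha : Valued.v a = 1)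
    {m : ℕ → ℕ} (hm : ∀ d : ℕ, d ≠ 0 → ∀ᶠ n in atTop, d ∣ m n) :
    Tendsto (fun n => a ^ m n) atTop (𝓝 1) := by
  obtain ⟨p, hp, hpv⟩ := exists_prime_mem v
  have hpv' : Valued.v (p : v.adicCompletion K) < 1 := by
    rw [valued_natCast]
    exact (valuation_natCast_lt_one_iff v p).mpr hpv
  refine tendsto_adicCompletion_of_forall_le v fun k => ?_
  have hq := one_lt_residueCard v
  -- The exponent `residueCard v - 1` moves a unit into `1 + 𝔭 O_𝔭`, and the further exponent `p ^
  -- k` brings it within `exp (-(k + 1))` of `1`.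
  filter_upwards [hm ((residueCard v - 1) * p ^ k)
    (mul_ne_zero (by omega) (pow_ne_zero _ hp.ne_zero))] with n ⟨c, hc⟩
  have h1 := valued_pow_prime_pow_sub_one_le v hpv' (valued_pow_sub_one_lt_one v
    (valued_pow_residueCard_sub_one_lt_one v ha) c) k
  rw [hc]
  have e : (residueCard v - 1) * p ^ k * c = (residueCard v - 1) * c * p ^ k := by ring
  rw [e, pow_mul, pow_mul]
  refine h1.trans ?_
  rw [exp_le_exp]
  omega

end NumberField

end LocalFields

/-! ### The kernel of the class map, and separation of `DR K` -/

section DeligneRibetTopology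

variable (K : Type*) [Field K] [NumberField K]

instance t2Space_finiteAdeleRing : T2Space (FiniteAdeleRing (𝓞 K) K) :=
  inferInstanceAs (T2Space (RestrictedProduct (fun v : HeightOneSpectrum (𝓞 K) =>
    v.adicCompletion K) (fun v => (v.adicCompletionIntegers K : Set (v.adicCompletion K)))
    cofinite))

theorem continuous_toFinite : Continuous (IntegralAdeles.toFinite K) :=
  (RestrictedProduct.isEmbedding_structureMap (R := fun v : HeightOneSpectrum (𝓞 K) =>
    v.adicCompletion K) (A := fun v => (v.adicCompletionIntegers K : Set (v.adicCompletion K)))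
    (𝓕 := cofinite)).continuous

theorem toFinite_apply (ρ : IntegralAdeles K) (v : HeightOneSpectrum (𝓞 K)) :
    IntegralAdeles.toFinite K ρ v = (ρ v : v.adicCompletion K) := rfl

theorem toFinite_injective : Function.Injective (IntegralAdeles.toFinite K) := fun _ _ h =>
  funext fun v => Subtype.ext (congrArg (fun x : FiniteAdeleRing (𝓞 K) K => x v) h)

/-- The component of a finite adele at `v`. -/
noncomputable def finiteEval (v : HeightOneSpectrum (𝓞 K)) :
    FiniteAdeleRing (𝓞 K) K →* v.adicCompletion K where
  toFun x := x v
  map_one' := rfl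
  map_mul' _ _ := rfl

/-- The component of a finite idele at `v`. -/
noncomputable abbrev ideleEval (v : HeightOneSpectrum (𝓞 K)) :
    (FiniteAdeleRing (𝓞 K) K)ˣ →* (v.adicCompletion K)ˣ :=
  Units.map (finiteEval K v)

variable {K} in
theorem idele_ext {x y : (FiniteAdeleRing (𝓞 K) K)ˣ}
    (h : ∀ v, ideleEval K v x = ideleEval K v y) : x = y :=
  Units.ext (FiniteAdeleRing.ext _ fun v => congrArg Units.val (h v))

theorem continuous_finiteRec : Continuous (finiteRec K) := by
  refine continuous_quot_mk.comp (Units.continuous_map ?_)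
  exact continuous_const.prodMk continuous_id

theorem continuous_unitRec : Continuous (unitRec K) :=
  (continuous_finiteRec K).comp (Units.continuous_map (continuous_toFinite K))

/-- The finite ideles that are units everywhere. -/
def unitIdeles : Set (FiniteAdeleRing (𝓞 K) K)ˣ :=
  {x | ∀ v, Valued.v (x.1 v : v.adicCompletion K) = 1}

/-- An idele is a unit everywhere when it and its inverse are integral everywhere, and integrality
everywhere is an open condition on finite adeles. -/
theorem isOpen_unitIdeles : IsOpen (unitIdeles K) := by
  have h := RestrictedProduct.isOpen_forall_mem (R := fun v : HeightOneSpectrum (𝓞 K) =>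
    v.adicCompletion K) (A := fun v => (v.adicCompletionIntegers K : Set (v.adicCompletion K)))
    (fun v => Valued.isOpen_valuationSubring (v.adicCompletion K))
  have h1 : IsOpen {x : FiniteAdeleRing (𝓞 K) K | ∀ v, Valued.v (x v : v.adicCompletion K) ≤ 1} :=
    h
  convert (h1.preimage Units.continuous_val).inter
    ((h1.preimage Units.continuous_val).preimage continuous_inv) using 1
  ext x
  have hinv : ∀ v, Valued.v (x.1 v : v.adicCompletion K) *
      Valued.v ((x⁻¹).1 v : v.adicCompletion K) = 1 := by
    intro v
    rw [← map_mul]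
    have : (x.1 v : v.adicCompletion K) * (x⁻¹).1 v = 1 :=
      congrArg (fun y : FiniteAdeleRing (𝓞 K) K => y v) x.mul_inv
    rw [this, map_one]
  constructor
  · intro hx
    refine ⟨fun v => (hx v).le, fun v => ?_⟩
    have := hinv v
    rw [hx v, one_mul] at this
    exact this.le
  · rintro ⟨h1, h2⟩ v
    refine le_antisymm (h1 v) ?_
    rw [← hinv v]
    exact mul_le_of_le_one_right' (h2 v)

variable {K}

theorem mul_inv_mem_unitIdeles {x y : (FiniteAdeleRing (𝓞 K) K)ˣ} (hx : x ∈ unitIdeles K)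
    (hy : y ∈ unitIdeles K) : x * y⁻¹ ∈ unitIdeles K := by
  intro v
  have h : Valued.v ((ideleEval K v (x * y⁻¹) : (v.adicCompletion K)ˣ) : v.adicCompletion K) =
      Valued.v (ideleEval K v x : v.adicCompletion K) *
        (Valued.v (ideleEval K v y : v.adicCompletion K))⁻¹ := by
    rw [map_mul, map_inv, Units.val_mul, map_mul, Units.val_inv_eq_inv_val, map_inv₀]
  change Valued.v ((ideleEval K v (x * y⁻¹) : (v.adicCompletion K)ˣ) : v.adicCompletion K) = 1
  rw [h]
  change Valued.v (x.1 v : v.adicCompletion K) * (Valued.v (y.1 v : v.adicCompletion K))⁻¹ = 1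
  rw [hx v, hy v, inv_one, one_mul]

theorem exists_units_of_finiteEmbedding_mem {k : Kˣ} (hk : finiteEmbedding K k ∈ unitIdeles K) :
    ∃ u : (𝓞 K)ˣ, k = Units.map (algebraMap (𝓞 K) K).toMonoidHom u := by
  obtain ⟨u, hu⟩ := exists_units_eq_of_valuation_eq_one (K := K) (x := k) k.ne_zero fun v => by
    rw [← HeightOneSpectrum.adicCompletion.valued_coe]
    exact hk v
  exact ⟨u, Units.ext hu⟩

/-- Two such `k` differ by an element that is a unit at every place, hence by one of the finitely
many units of `𝓞 K`. This is the discreteness of `Kˣ` in the finite ideles. -/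
theorem finite_setOf_finiteEmbedding_mem [Finite (𝓞 K)ˣ] (x : (FiniteAdeleRing (𝓞 K) K)ˣ) :
    {k : Kˣ | finiteEmbedding K k * x ∈ unitIdeles K}.Finite := by
  rcases Set.eq_empty_or_nonempty {k : Kˣ | finiteEmbedding K k * x ∈ unitIdeles K}
    with h | ⟨k₀, h₀⟩
  · rw [h]
    exact Set.finite_empty
  · refine (Set.finite_range fun u : (𝓞 K)ˣ =>
      Units.map (algebraMap (𝓞 K) K).toMonoidHom u * k₀).subset fun k hk => ?_
    have h1 := mul_inv_mem_unitIdeles hk h₀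
    rw [mul_inv, mul_mul_mul_comm, mul_inv_cancel, mul_one, ← map_inv, ← map_mul] at h1
    obtain ⟨u, hu⟩ := exists_units_of_finiteEmbedding_mem h1
    refine ⟨u, ?_⟩
    dsimp only
    rw [← hu, inv_mul_cancel_right]

/-- The finite component of ideles. -/
noncomputable def adeleToFinite (K : Type*) [Field K] [NumberField K] :
    AdeleRing (𝓞 K) K →* FiniteAdeleRing (𝓞 K) K where
  toFun x := x.2
  map_one' := rfl
  map_mul' _ _ := rfl

/-- Projecting to the finite components sends `globalIdeles K` into `Kˣ`, so `x` lies in the closure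
of `Kˣ`. The open neighbourhood of `x` formed by its unit multiples contains only finitely many
elements of `Kˣ`; a finite set being closed, `x` is one of them. -/
theorem exists_finiteEmbedding_eq_of_finiteRec_eq_one [Finite (𝓞 K)ˣ]
    {x : (FiniteAdeleRing (𝓞 K) K)ˣ} (hx : finiteRec K x = 1) :
    ∃ k : Kˣ, finiteEmbedding K k = x := by
  have h1 : Units.map (finiteToAdele K) x ∈ (globalIdeles K).topologicalClosure :=
    (QuotientGroup.eq_one_iff _).mp hx
  have hq : Continuous (Units.map (adeleToFinite K)) := Units.continuous_map continuous_snd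
  have h2 : globalIdeles K ≤ (finiteEmbedding K).range.comap (Units.map (adeleToFinite K)) := by
    refine sup_le ?_ ?_
    · rintro _ ⟨k, rfl⟩
      exact ⟨k, rfl⟩
    · rintro _ ⟨z, _, rfl⟩
      exact ⟨1, by rw [map_one]; rfl⟩
  have h3 : x ∈ closure ((finiteEmbedding K).range : Set (FiniteAdeleRing (𝓞 K) K)ˣ) := by
    have h4 := map_mem_closure hq h1 (t := ((finiteEmbedding K).range :
      Set (FiniteAdeleRing (𝓞 K) K)ˣ)) fun a ha => h2 ha
    exact h4
  have hO : IsOpen {y : (FiniteAdeleRing (𝓞 K) K)ˣ | y * x⁻¹ ∈ unitIdeles K} :=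
    (isOpen_unitIdeles K).preimage (continuous_mul_const x⁻¹)
  have h5 := hO.inter_closure ⟨show x * x⁻¹ ∈ unitIdeles K by
    rw [mul_inv_cancel]; exact fun v => map_one _, h3⟩
  have h6 : ({y : (FiniteAdeleRing (𝓞 K) K)ˣ | y * x⁻¹ ∈ unitIdeles K} ∩
      ((finiteEmbedding K).range : Set (FiniteAdeleRing (𝓞 K) K)ˣ)).Finite := by
    refine ((finite_setOf_finiteEmbedding_mem x⁻¹).image (finiteEmbedding K)).subset ?_
    rintro _ ⟨hy, k, rfl⟩
    exact ⟨k, hy, rfl⟩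
  rw [h6.isClosed.closure_eq] at h5
  obtain ⟨k, hk⟩ := h5.2
  exact ⟨k, hk⟩

instance t2Space_galAb : T2Space (GalAb K) := by
  have : IsClosed ((globalIdeles K).topologicalClosure : Set (AdeleRing (𝓞 K) K)ˣ) :=
    (globalIdeles K).isClosed_topologicalClosure
  exact inferInstanceAs (T2Space ((AdeleRing (𝓞 K) K)ˣ ⧸ (globalIdeles K).topologicalClosure))

theorem DR.mk_eq_mk_iff {a b : IntegralAdeles K × GalAb K} : DR.mk K a = DR.mk K b ↔
    ∃ u : (IntegralAdeles K)ˣ, b = (a.1 * u, (unitRec K u)⁻¹ * a.2) :=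
  (drCon K).eq

theorem DR.mk_surjective : Function.Surjective (DR.mk K) := Con.mk'_surjective

/-- The quotient map is open, and the equivalence relation is closed, being the projection of a
closed set along the compact group of units of `Ô_K`. -/
instance t2Space_DR : T2Space (DR K) := by
  rw [t2Space_iff_of_isOpenQuotientMap (DR.isOpenQuotientMap_mk K)]
  have h : {q : (IntegralAdeles K × GalAb K) × (IntegralAdeles K × GalAb K) |
      DR.mk K q.1 = DR.mk K q.2} = Prod.snd '' {z : (IntegralAdeles K)ˣ ×
        ((IntegralAdeles K × GalAb K) × (IntegralAdeles K × GalAb K)) |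
        z.2.2 = (z.2.1.1 * z.1, (unitRec K z.1)⁻¹ * z.2.1.2)} := by
    ext q
    simp only [Set.mem_ofPred_eq, DR.mk_eq_mk_iff, Set.mem_image, Prod.exists,
      exists_eq_right]
  rw [h]
  refine isClosedMap_snd_of_compactSpace _ (isClosed_eq (by fun_prop) ?_)
  have h1 : Continuous fun z : (IntegralAdeles K)ˣ ×
        ((IntegralAdeles K × GalAb K) × (IntegralAdeles K × GalAb K)) => unitRec K z.1 :=
    (continuous_unitRec K).comp continuous_fst
  have h2 : Continuous fun z : (IntegralAdeles K)ˣ ×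
        ((IntegralAdeles K × GalAb K) × (IntegralAdeles K × GalAb K)) =>
          (z.1 : IntegralAdeles K) := Units.continuous_val.comp continuous_fst
  exact ((continuous_fst.comp (continuous_fst.comp continuous_snd)).mul h2).prodMk
    (h1.inv.mul (continuous_snd.comp (continuous_fst.comp continuous_snd)))

end DeligneRibetTopology

/-! ### Ideles as products of local components, and the limits of `𝔭 ^ n!` -/

section LocalIdeles

variable {K : Type*} [Field K] [NumberField K]

open Classical in
/-- The finite adele with component `a` at `v` and `1` elsewhere. -/
noncomputable def localAdele (v : HeightOneSpectrum (𝓞 K)) :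
    v.adicCompletion K →* FiniteAdeleRing (𝓞 K) K where
  toFun a := ⟨Pi.mulSingle v a, by
    refine (Set.finite_singleton v).subset fun w hw => ?_
    by_contra h
    refine hw ?_
    change (Pi.mulSingle v a : ∀ w : HeightOneSpectrum (𝓞 K), w.adicCompletion K) w ∈
      w.adicCompletionIntegers K
    rw [Pi.mulSingle_eq_of_ne h]
    exact one_mem _⟩
  map_one' := Subtype.ext (Pi.mulSingle_one v)
  map_mul' a b := Subtype.ext (Pi.mulSingle_mul v a b)

open Classical in
/-- The integral adele with component `a` at `v` and `1` elsewhere. -/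
noncomputable def localIntegral (v : HeightOneSpectrum (𝓞 K)) :
    v.adicCompletionIntegers K →* IntegralAdeles K :=
  MonoidHom.mulSingle (fun v : HeightOneSpectrum (𝓞 K) => v.adicCompletionIntegers K) v

/-- The finite idele with component `a` at `v` and `1` elsewhere. -/
noncomputable abbrev localIdele (v : HeightOneSpectrum (𝓞 K)) :
    (v.adicCompletion K)ˣ →* (FiniteAdeleRing (𝓞 K) K)ˣ :=
  Units.map (localAdele v)

variable (v : HeightOneSpectrum (𝓞 K))

@[simp]
theorem localAdele_same (a : v.adicCompletion K) : localAdele v a v = a := by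
  classical
  exact Pi.mulSingle_eq_same v a

theorem localAdele_of_ne {w : HeightOneSpectrum (𝓞 K)} (h : w ≠ v) (a : v.adicCompletion K) :
    localAdele v a w = 1 := by
  classical
  exact Pi.mulSingle_eq_of_ne h a

@[simp]
theorem localIntegral_same (a : v.adicCompletionIntegers K) : localIntegral v a v = a := by
  classical
  exact Pi.mulSingle_eq_same (M := fun v : HeightOneSpectrum (𝓞 K) =>
    v.adicCompletionIntegers K) v a

theorem localIntegral_of_ne {w : HeightOneSpectrum (𝓞 K)} (h : w ≠ v)
    (a : v.adicCompletionIntegers K) : localIntegral v a w = 1 := by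
  classical
  exact Pi.mulSingle_eq_of_ne (M := fun v : HeightOneSpectrum (𝓞 K) =>
    v.adicCompletionIntegers K) h a

theorem toFinite_localIntegral (a : v.adicCompletionIntegers K) :
    IntegralAdeles.toFinite K (localIntegral v a) = localAdele v a := by
  refine FiniteAdeleRing.ext _ fun w => ?_
  rw [toFinite_apply]
  by_cases h : w = v
  · subst h
    rw [localIntegral_same, localAdele_same]
  · rw [localIntegral_of_ne v h, localAdele_of_ne v h]
    rfl

theorem continuous_localIntegral : Continuous (localIntegral v) := by
  classical
  exact continuous_mulSingle (A := fun v : HeightOneSpectrum (𝓞 K) =>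
    v.adicCompletionIntegers K) v

@[simp]
theorem ideleEval_localIdele_same (a : (v.adicCompletion K)ˣ) :
    ideleEval K v (localIdele v a) = a := Units.ext (localAdele_same v a)

theorem ideleEval_localIdele_of_ne {w : HeightOneSpectrum (𝓞 K)} (h : w ≠ v)
    (a : (v.adicCompletion K)ˣ) : ideleEval K w (localIdele v a) = 1 :=
  Units.ext (localAdele_of_ne v h a)

theorem eventually_valued_ideleEval (x : (FiniteAdeleRing (𝓞 K) K)ˣ) :
    ∀ᶠ v in cofinite, Valued.v (ideleEval K v x : v.adicCompletion K) = 1 :=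
  (FiniteAdeleRing.isUnit_iff.mp x.isUnit).2

theorem exists_idele_of_local (x : ∀ v : HeightOneSpectrum (𝓞 K), (v.adicCompletion K)ˣ)
    (hx : ∀ᶠ v in cofinite, Valued.v (x v : v.adicCompletion K) = 1) :
    ∃ y : (FiniteAdeleRing (𝓞 K) K)ˣ, ∀ v, ideleEval K v y = x v := by
  let a : FiniteAdeleRing (𝓞 K) K := ⟨fun v => (x v : v.adicCompletion K), hx.mono fun v hv =>
    (show Valued.v (x v : v.adicCompletion K) ≤ 1 from hv.le)⟩
  have ha : IsUnit a := FiniteAdeleRing.isUnit_iff.mpr ⟨fun v => (x v).ne_zero, hx⟩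
  exact ⟨ha.unit, fun v => Units.ext rfl⟩

theorem exists_unit_toFinite_eq {x : (FiniteAdeleRing (𝓞 K) K)ˣ}
    (hx : ∀ v, Valued.v (ideleEval K v x : v.adicCompletion K) = 1) :
    ∃ u : (IntegralAdeles K)ˣ, Units.map (IntegralAdeles.toFinite K) u = x := by
  have hu : ∀ v : HeightOneSpectrum (𝓞 K), IsUnit (⟨(ideleEval K v x : v.adicCompletion K),
      (HeightOneSpectrum.mem_adicCompletionIntegers _ _ _).mpr (hx v).le⟩ :
      v.adicCompletionIntegers K) := fun v =>
    HeightOneSpectrum.adicCompletionIntegers.isUnit_iff_valued_eq_one.mpr (hx v)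
  let z : ∀ v : HeightOneSpectrum (𝓞 K), (v.adicCompletionIntegers K)ˣ := fun v => (hu v).unit
  exact ⟨MulEquiv.piUnits.symm z, idele_ext fun v => Units.ext rfl⟩

theorem ideleEval_unit (u : (IntegralAdeles K)ˣ) :
    (ideleEval K v (Units.map (IntegralAdeles.toFinite K) u) : v.adicCompletion K) =
      ((u : IntegralAdeles K) v : v.adicCompletion K) := rfl

theorem valued_unit (u : (IntegralAdeles K)ˣ) :
    Valued.v ((u : IntegralAdeles K) v : v.adicCompletion K) = 1 :=
  HeightOneSpectrum.adicCompletionIntegers.isUnit_iff_valued_eq_one.mp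
    (MulEquiv.piUnits u v).isUnit

/-- In the product of the groups `O_vˣ`, convergence is checked componentwise, and each component of
the product has at most one nontrivial factor. The result is carried to the ideles by a continuous
homomorphism. -/
theorem hasProd_localIdele_unit (u : (IntegralAdeles K)ˣ) :
    HasProd (fun v => localIdele v (ideleEval K v (Units.map (IntegralAdeles.toFinite K) u)))
      (Units.map (IntegralAdeles.toFinite K) u) := by
  classical
  let Φ : (∀ v : HeightOneSpectrum (𝓞 K), (v.adicCompletionIntegers K)ˣ) ≃ₜ*
      (IntegralAdeles K)ˣ :=
    (ContinuousMulEquiv.piUnits (M := fun v : HeightOneSpectrum (𝓞 K) =>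
      v.adicCompletionIntegers K)).symm
  let y := Φ.symm u
  have h1 : HasProd (fun v => MonoidHom.mulSingle
      (fun v : HeightOneSpectrum (𝓞 K) => (v.adicCompletionIntegers K)ˣ) v (y v)) y := by
    rw [Pi.hasProd]
    intro w
    have h2 := hasProd_single (f := fun v => MonoidHom.mulSingle
      (fun v : HeightOneSpectrum (𝓞 K) => (v.adicCompletionIntegers K)ˣ) v (y v) w) w
      fun v hv => Pi.mulSingle_eq_of_ne hv.symm _
    have e : MonoidHom.mulSingle
      (fun v : HeightOneSpectrum (𝓞 K) => (v.adicCompletionIntegers K)ˣ) w (y w) w = y w :=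
      Pi.mulSingle_eq_same (M := fun v : HeightOneSpectrum (𝓞 K) =>
        (v.adicCompletionIntegers K)ˣ) w (y w)
    rwa [e] at h2
  have h3 := h1.map ((Units.map (IntegralAdeles.toFinite K)).comp
    Φ.toMulEquiv.toMonoidHom) ((Units.continuous_map (continuous_toFinite K)).comp Φ.continuous)
  have e1 : ((Units.map (IntegralAdeles.toFinite K)).comp Φ.toMulEquiv.toMonoidHom) y =
      Units.map (IntegralAdeles.toFinite K) u :=
    congrArg (Units.map (IntegralAdeles.toFinite K)) (Φ.apply_symm_apply u)
  rw [e1] at h3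
  convert h3 using 1
  funext v
  refine idele_ext fun w => ?_
  by_cases h : w = v
  · subst h
    rw [ideleEval_localIdele_same]
    refine Units.ext (congrArg Subtype.val (?_ : (u : IntegralAdeles K) w = _))
    change _ = ((Pi.mulSingle w (y w) : ∀ v : HeightOneSpectrum (𝓞 K),
      (v.adicCompletionIntegers K)ˣ) w : w.adicCompletionIntegers K)
    rw [Pi.mulSingle_eq_same]
    rfl
  · rw [ideleEval_localIdele_of_ne v h]
    refine Units.ext ?_
    change ((1 : w.adicCompletionIntegers K) : w.adicCompletion K) =
      (((Pi.mulSingle v (y v) : ∀ v : HeightOneSpectrum (𝓞 K),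
        (v.adicCompletionIntegers K)ˣ) w : w.adicCompletionIntegers K) : w.adicCompletion K)
    rw [Pi.mulSingle_eq_of_ne h]
    rfl

/-- A finite idele is the product of its local components. -/
theorem hasProd_localIdele (x : (FiniteAdeleRing (𝓞 K) K)ˣ) :
    HasProd (fun v => localIdele v (ideleEval K v x)) x := by
  classical
  have hfin : {v | ¬ Valued.v (ideleEval K v x : v.adicCompletion K) = 1}.Finite :=
    eventually_valued_ideleEval x
  -- `y` collects the finitely many components that are not units, so its product is finite; the
  -- remaining factor `y⁻¹ * x` is a unit everywhere.
  obtain ⟨y, hy⟩ := exists_idele_of_local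
    (fun v => if v ∈ hfin.toFinset then ideleEval K v x else 1) (by
      refine hfin.subset fun v hv => ?_
      by_contra h
      refine hv ?_
      have e : (if v ∈ hfin.toFinset then ideleEval K v x else 1) = 1 :=
        if_neg (by rwa [hfin.mem_toFinset])
      change Valued.v ((if v ∈ hfin.toFinset then ideleEval K v x else 1 :
        (v.adicCompletion K)ˣ) : v.adicCompletion K) = 1
      rw [e]
      exact map_one _)
  have h1 : HasProd (fun v => localIdele v (ideleEval K v y)) (∏ v ∈ hfin.toFinset,
      localIdele v (ideleEval K v y)) :=
    hasProd_prod_of_ne_finset_one fun v hv => by rw [hy, if_neg hv, map_one]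
  have e1 : ∏ v ∈ hfin.toFinset, localIdele v (ideleEval K v y) = y := by
    refine idele_ext fun w => ?_
    rw [map_prod]
    by_cases hw : w ∈ hfin.toFinset
    · rw [Finset.prod_eq_single_of_mem w hw fun v _ hv =>
        ideleEval_localIdele_of_ne v hv.symm _, ideleEval_localIdele_same]
    · rw [hy, if_neg hw]
      exact Finset.prod_eq_one fun v hv =>
        ideleEval_localIdele_of_ne v (fun h : w = v => hw (h ▸ hv)) _
  obtain ⟨u, hu⟩ := exists_unit_toFinite_eq (x := y⁻¹ * x) fun v => by
    rw [map_mul, map_inv, hy]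
    split_ifs with h
    · rw [inv_mul_cancel]
      exact map_one _
    · rw [inv_one, one_mul]
      rw [hfin.mem_toFinset] at h
      exact not_not.mp h
  have h2 := hasProd_localIdele_unit u
  rw [hu] at h2
  have h3 := (e1 ▸ h1).mul h2
  simp only [← map_mul, mul_inv_cancel_left] at h3
  exact h3

theorem hasProd_finiteRec_localIdele (x : (FiniteAdeleRing (𝓞 K) K)ˣ) :
    HasProd (fun v => finiteRec K (localIdele v (ideleEval K v x))) (finiteRec K x) :=
  (hasProd_localIdele x).map (finiteRec K) (continuous_finiteRec K)

theorem valuation_eq_exp_idealExp (v : HeightOneSpectrum (𝓞 K)) {a : 𝓞 K} (ha : a ≠ 0) :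
    v.valuation K (algebraMap (𝓞 K) K a) = WithZero.exp (-(idealExp K v ⟨Ideal.span {a},
      mem_nonZeroDivisors_of_ne_zero ((Submodule.ne_bot_iff _).mpr
        ⟨a, Ideal.mem_span_singleton_self a, ha⟩)⟩ : ℤ)) := by
  classical
  rw [HeightOneSpectrum.valuation_of_algebraMap]
  refine (v.intValuationDef_if_neg ha).trans ?_
  unfold idealExp
  congr

/-- The class of an ideal in `G_K^{ab}` has a power in the image of `Ô_K^×`. -/
theorem exists_finiteRec_idealIdele_pow_eq [Subsingleton (InfinitePlace K)]
    (𝔞 : (Ideal (𝓞 K))⁰) : ∃ N : ℕ, N ≠ 0 ∧ ∃ u : (IntegralAdeles K)ˣ,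
      finiteRec K (idealIdele K 𝔞) ^ N = unitRec K u := by
  -- The class number makes the power of the ideal principal. A generator, up to sign, has trivial
  -- class, and dividing by it leaves a unit idele.
  refine ⟨Fintype.card (ClassGroup (𝓞 K)), Fintype.card_ne_zero, ?_⟩
  set N := Fintype.card (ClassGroup (𝓞 K))
  have h1 : ClassGroup.mk0 (𝔞 ^ N) = 1 := by rw [map_pow, pow_card_eq_one]
  obtain ⟨a, ha⟩ := ((ClassGroup.mk0_eq_one_iff (𝔞 ^ N).2).mp h1).principal
  change ((𝔞 ^ N : (Ideal (𝓞 K))⁰) : Ideal (𝓞 K)) = Ideal.span {a} at ha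
  have ha0 : a ≠ 0 := by
    rintro rfl
    rw [Ideal.span_singleton_eq_bot.mpr rfl] at ha
    exact nonZeroDivisors.coe_ne_zero _ ha
  have ha0' : algebraMap (𝓞 K) K a ≠ 0 := by simpa using ha0
  have hval : ∀ v : HeightOneSpectrum (𝓞 K), v.valuation K (algebraMap (𝓞 K) K a) =
      WithZero.exp (-(idealExp K v (𝔞 ^ N) : ℤ)) := by
    intro v
    rw [valuation_eq_exp_idealExp v ha0]
    have e : (⟨Ideal.span {a}, mem_nonZeroDivisors_of_ne_zero ((Submodule.ne_bot_iff _).mpr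
        ⟨a, Ideal.mem_span_singleton_self a, ha0⟩)⟩ : (Ideal (𝓞 K))⁰) = 𝔞 ^ N :=
      Subtype.ext ha.symm
    rw [e]
  obtain ⟨k, hk, hkv⟩ : ∃ k : Kˣ, finiteRec K (finiteEmbedding K k) = 1 ∧
      ∀ v : HeightOneSpectrum (𝓞 K), v.valuation K (k : K) =
        WithZero.exp (-(idealExp K v (𝔞 ^ N) : ℤ)) := by
    rcases finiteRec_finiteEmbedding_eq_one_or (Units.mk0 _ ha0') with h | h
    · exact ⟨_, h, hval⟩
    · refine ⟨_, h, fun v => ?_⟩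
      rw [Units.val_neg, Valuation.map_neg]
      exact hval v
  obtain ⟨u, hu⟩ := exists_unit_toFinite_eq
    (x := idealIdele K (𝔞 ^ N) * (finiteEmbedding K k)⁻¹) fun v => by
      rw [map_mul, map_inv, Units.val_mul, Units.val_inv_eq_inv_val, map_mul, map_inv₀]
      have e1 : Valued.v (ideleEval K v (idealIdele K (𝔞 ^ N)) : v.adicCompletion K) =
        WithZero.exp (-(idealExp K v (𝔞 ^ N) : ℤ)) := valued_idealAdele K (𝔞 ^ N) v
      have e2 : Valued.v (ideleEval K v (finiteEmbedding K k) : v.adicCompletion K) =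
        WithZero.exp (-(idealExp K v (𝔞 ^ N) : ℤ)) := by
        rw [← hkv v, ← HeightOneSpectrum.adicCompletion.valued_coe]
        rfl
      rw [e1, e2, mul_inv_cancel₀ WithZero.exp_ne_zero]
  refine ⟨u, ?_⟩
  rw [← map_pow, ← map_pow]
  change _ = finiteRec K (Units.map (IntegralAdeles.toFinite K) u)
  rw [hu, map_mul, map_inv, hk, inv_one, mul_one]

theorem tendsto_unit_pow_one (u : (IntegralAdeles K)ˣ) {m : ℕ → ℕ}
    (hm : ∀ d : ℕ, d ≠ 0 → ∀ᶠ n in atTop, d ∣ m n) :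
    Tendsto (fun n => u ^ m n) atTop (𝓝 1) := by
  have key : ∀ w : (IntegralAdeles K)ˣ,
      Tendsto (fun n => ((w ^ m n : (IntegralAdeles K)ˣ) : IntegralAdeles K)) atTop (𝓝 1) := by
    intro w
    rw [tendsto_pi_nhds]
    intro v
    rw [tendsto_subtype_rng]
    exact tendsto_pow_one_of_eventually_dvd v (valued_unit v w) hm
  rw [Units.isInducing_embedProduct.tendsto_nhds_iff]
  refine (key u).prodMk_nhds ((MulOpposite.continuous_op.tendsto _).comp ?_)
  have := key u⁻¹
  simpa only [inv_pow, inv_one, Units.val_one] using this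

theorem eventually_dvd_factorial_div {N : ℕ} (hN : N ≠ 0) (d : ℕ) (hd : d ≠ 0) :
    ∀ᶠ n : ℕ in atTop, d ∣ n.factorial / N := by
  filter_upwards [eventually_ge_atTop (N * d)] with n hn
  have h : N * d ∣ n.factorial :=
    Nat.dvd_factorial (Nat.mul_pos (Nat.pos_of_ne_zero hN) (Nat.pos_of_ne_zero hd)) hn
  exact Nat.dvd_div_of_mul_dvd h

theorem idealExp_asIdeal_self (v : HeightOneSpectrum (𝓞 K)) :
    idealExp K v ⟨v.asIdeal, mem_nonZeroDivisors_of_ne_zero v.ne_bot⟩ = 1 := by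
  classical
  exact Associates.count_self v.associates_irreducible

theorem idealExp_asIdeal_of_ne {v w : HeightOneSpectrum (𝓞 K)} (h : w ≠ v) :
    idealExp K w ⟨v.asIdeal, mem_nonZeroDivisors_of_ne_zero v.ne_bot⟩ = 0 := by
  classical
  refine Associates.count_eq_zero_of_ne w.associates_irreducible v.associates_irreducible ?_
  intro h'
  exact h (HeightOneSpectrum.ext (associated_iff_eq.mp (Associates.mk_eq_mk_iff_associated.mp h')))

/-- The idempotent of `DR_K` attached to `𝔭` is the limit of `𝔭 ^ (n!)`. -/
theorem tendsto_idealToDR_pow_factorial [Subsingleton (InfinitePlace K)]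
    (v : HeightOneSpectrum (𝓞 K)) :
    Tendsto (fun n : ℕ =>
      idealToDR K ⟨v.asIdeal, mem_nonZeroDivisors_of_ne_zero v.ne_bot⟩ ^ n.factorial) atTop
      (𝓝 (DR.mk K (localIntegral v 0, 1))) := by
  set 𝔭 : (Ideal (𝓞 K))⁰ := ⟨v.asIdeal, mem_nonZeroDivisors_of_ne_zero v.ne_bot⟩
  have h1 : Tendsto (fun n : ℕ => idealAdele K 𝔭 ^ n.factorial) atTop
      (𝓝 (localIntegral v 0)) := by
    rw [tendsto_pi_nhds]
    intro w
    by_cases h : w = v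
    · subst h
      rw [localIntegral_same, tendsto_subtype_rng]
      refine (tendsto_pow_of_valued_lt_one w ?_).comp
        (tendsto_atTop_mono Nat.self_le_factorial tendsto_id)
      change Valued.v (idealAdele K 𝔭 w : w.adicCompletion K) < 1
      rw [valued_idealAdele, idealExp_asIdeal_self]
      rw [← WithZero.exp_zero, WithZero.exp_lt_exp]
      norm_num
    · rw [localIntegral_of_ne v h]
      have e : idealAdele K 𝔭 w = 1 := by
        change algebraMap (𝓞 K) (w.adicCompletionIntegers K) (unif K w) ^ idealExp K w 𝔭 = _
        rw [idealExp_asIdeal_of_ne h, pow_zero]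
      simp only [Pi.pow_apply, e, one_pow]
      exact tendsto_const_nhds
  -- For the Galois component: for `n ≥ N`, the power with exponent `n!` is the power of a class
  -- from `Ô_Kˣ` with exponent `n! / N`, and unit powers with ever more divisible exponents tend to
  -- `1`.
  obtain ⟨N, hN, u, hu⟩ := exists_finiteRec_idealIdele_pow_eq 𝔭
  have h2 : Tendsto (fun n : ℕ => (finiteRec K (idealIdele K 𝔭))⁻¹ ^ n.factorial) atTop
      (𝓝 1) := by
    have h3 := ((continuous_unitRec K).tendsto 1).comp
      (tendsto_unit_pow_one u⁻¹ (eventually_dvd_factorial_div hN))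
    rw [map_one] at h3
    refine h3.congr' ?_
    filter_upwards [eventually_ge_atTop N] with n hn
    obtain ⟨c, hc⟩ := Nat.dvd_factorial (Nat.pos_of_ne_zero hN) hn
    rw [Function.comp_apply, hc, Nat.mul_div_cancel_left _ (Nat.pos_of_ne_zero hN), pow_mul,
      map_pow, map_inv, inv_pow _ N, hu]
  have h4 := ((DR.isOpenQuotientMap_mk K).continuous.tendsto (localIntegral v 0, 1)).comp
    (h1.prodMk_nhds h2)
  refine h4.congr fun n => ?_
  exact map_pow (DR.mk K) (idealAdele K 𝔭, (finiteRec K (idealIdele K 𝔭))⁻¹) n.factorial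

end LocalIdeles

/-! ### Idempotents, local monoids and ideals inside `DR K` -/

section DeligneRibetStructure

variable {K : Type*} [Field K] [NumberField K]

namespace DR

/-- The embedding of `O_𝔭` in `DR_K`. -/
noncomputable def localMap (v : HeightOneSpectrum (𝓞 K)) : v.adicCompletionIntegers K →* DR K :=
  ((DR.mk K).comp (MonoidHom.inl _ _)).comp (localIntegral v)

theorem localMap_apply (v : HeightOneSpectrum (𝓞 K)) (a : v.adicCompletionIntegers K) :
    localMap v a = DR.mk K (localIntegral v a, 1) := rfl

/-- The embedding of `G_K^{ab}` in `DR_K`. -/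
noncomputable def galMap (K : Type*) [Field K] [NumberField K] : GalAb K →* (DR K)ˣ :=
  (Units.map ((DR.mk K).comp (MonoidHom.inr _ _))).comp toUnits.toMonoidHom

theorem galMap_apply (s : GalAb K) : (galMap K s : DR K) = DR.mk K (1, s) := rfl

theorem continuous_galMap : Continuous (galMap K) := by
  have h : Continuous fun s : GalAb K => DR.mk K (1, s) :=
    (DR.isOpenQuotientMap_mk K).continuous.comp (continuous_const.prodMk continuous_id)
  exact Units.continuous_iff.mpr ⟨h, h.comp continuous_inv⟩

theorem galMap_injective : Function.Injective (galMap K) := by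
  intro s t h
  obtain ⟨u, hu⟩ := DR.mk_eq_mk_iff.mp (congrArg Units.val h :
    DR.mk K (1, s) = DR.mk K (1, t))
  obtain ⟨h1, h2⟩ := Prod.ext_iff.mp hu
  change (1 : IntegralAdeles K) = 1 * u at h1
  change t = (unitRec K u)⁻¹ * s at h2
  rw [one_mul] at h1
  have h3 : u = 1 := Units.ext h1.symm
  rw [h2, h3, map_one, inv_one, one_mul]

theorem mk_eq_of_unit (ρ : IntegralAdeles K) (s : GalAb K) (u : (IntegralAdeles K)ˣ)
    (h : unitRec K u = s) : DR.mk K (ρ, s) = DR.mk K (ρ * u, 1) :=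
  DR.mk_eq_mk_iff.mpr ⟨u, by rw [h, inv_mul_cancel]⟩

/-- The first component of an invertible element is itself invertible in `Ô_K`, so it can be
absorbed into the Galois component. -/
theorem galMap_surjective : Function.Surjective (galMap K) := by
  intro x
  obtain ⟨⟨ρ, s⟩, hρ⟩ := DR.mk_surjective (x : DR K)
  obtain ⟨⟨σ, t⟩, hσ⟩ := DR.mk_surjective ((x⁻¹ : (DR K)ˣ) : DR K)
  have h1 : DR.mk K ((ρ, s) * (σ, t)) = DR.mk K (1, 1) := by
    rw [map_mul, hρ, hσ, Units.mul_inv]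
    exact (map_one (DR.mk K)).symm
  obtain ⟨u, hu⟩ := DR.mk_eq_mk_iff.mp h1
  have h2 : ρ * (σ * u) = 1 := by
    rw [← mul_assoc]
    exact (congrArg Prod.fst hu).symm
  let w : (IntegralAdeles K)ˣ := Units.mkOfMulEqOne ρ (σ * u) h2
  refine ⟨unitRec K w * s, Units.ext ?_⟩
  rw [galMap_apply, ← hρ]
  refine DR.mk_eq_mk_iff.mpr ⟨w, Prod.ext ?_ ?_⟩
  · exact (one_mul ρ).symm
  · exact (inv_mul_cancel_left _ _).symm

/-- The equality `[ρ², s²] = [ρ, s]` provides a unit `u` with `s = [u]` and `ρ = ρ² u`. The first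
relation normalizes the class to `[ρ u, 1]`; the second makes `ρ u` idempotent, hence `0` or `1` in
each domain `O_v`. -/
theorem exists_mk_of_isIdempotentElem {x : DR K} (hx : x * x = x) :
    ∃ χ : IntegralAdeles K, (∀ v, χ v = 0 ∨ χ v = 1) ∧ x = DR.mk K (χ, 1) := by
  obtain ⟨⟨ρ, s⟩, rfl⟩ := DR.mk_surjective x
  rw [← map_mul] at hx
  obtain ⟨u, hu⟩ := DR.mk_eq_mk_iff.mp hx
  obtain ⟨h1, h2⟩ := Prod.ext_iff.mp hu
  change ρ = ρ * ρ * u at h1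
  change s = (unitRec K u)⁻¹ * (s * s) at h2
  refine ⟨ρ * u, fun v => ?_, mk_eq_of_unit _ _ _ ?_⟩
  · have h3 : ρ v = ρ v * ρ v * (u : IntegralAdeles K) v := congrFun h1 v
    by_cases h : ρ v = 0
    · exact Or.inl (by rw [Pi.mul_apply, h, zero_mul])
    · right
      rw [mul_assoc] at h3
      exact (mul_eq_left₀ h).mp h3.symm
  · rw [eq_inv_mul_iff_mul_eq] at h2
    exact mul_right_cancel h2

theorem mk_ne_one {χ : IntegralAdeles K} {s : GalAb K} {v : HeightOneSpectrum (𝓞 K)}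
    (h : χ v = 0) : DR.mk K (χ, s) ≠ 1 := by
  rw [← map_one (DR.mk K)]
  intro h'
  obtain ⟨u, hu⟩ := DR.mk_eq_mk_iff.mp h'
  have h1 : (1 : v.adicCompletionIntegers K) = χ v * (u : IntegralAdeles K) v :=
    congrFun (congrArg Prod.fst hu) v
  rw [h, zero_mul] at h1
  exact one_ne_zero h1

theorem localMap_zero_ne_one (v : HeightOneSpectrum (𝓞 K)) : localMap v 0 ≠ 1 :=
  mk_ne_one (localIntegral_same v 0)

theorem localMap_zero_mul_self (v : HeightOneSpectrum (𝓞 K)) :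
    localMap v 0 * localMap v 0 = localMap v 0 := by
  rw [← map_mul, zero_mul]

/-- If `x = [ρ, s]` is absorbed, the unit `u` comparing the two representatives satisfies `s = [u]`
and `ρ_w u_w = 1` for all `w ≠ v`. Thus `x = [ρ u, 1]`, with only a `v`-component left. -/
theorem mul_localMap_zero_iff {x : DR K} (v : HeightOneSpectrum (𝓞 K)) :
    x * localMap v 0 = localMap v 0 ↔ x ∈ Set.range (localMap v) := by
  constructor
  · obtain ⟨⟨ρ, s⟩, rfl⟩ := DR.mk_surjective x
    intro hx
    rw [localMap_apply, ← map_mul] at hx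
    obtain ⟨u, hu⟩ := DR.mk_eq_mk_iff.mp hx
    obtain ⟨h1, h2⟩ := Prod.ext_iff.mp hu
    change localIntegral v 0 = ρ * localIntegral v 0 * u at h1
    change 1 = (unitRec K u)⁻¹ * (s * 1) at h2
    rw [mul_one, eq_inv_mul_iff_mul_eq, mul_one] at h2
    refine ⟨ρ v * (u : IntegralAdeles K) v, ?_⟩
    rw [mk_eq_of_unit ρ s u h2, localMap_apply]
    congr 2
    funext w
    by_cases h : w = v
    · subst h
      rw [localIntegral_same]
      rfl
    · have h3 : localIntegral v 0 w = ρ w * localIntegral v 0 w * (u : IntegralAdeles K) w :=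
        congrFun h1 w
      rw [localIntegral_of_ne v h, mul_one] at h3
      rw [localIntegral_of_ne v h, h3]
      rfl
  · rintro ⟨a, rfl⟩
    rw [← map_mul, mul_zero]

theorem eq_localIntegral_zero {χ : IntegralAdeles K} {v : HeightOneSpectrum (𝓞 K)}
    (hv : χ v = 0) (h : ∀ w, w ≠ v → χ w = 1) : χ = localIntegral v 0 := by
  funext w
  by_cases hw : w = v
  · subst hw
    rw [localIntegral_same, hv]
  · rw [localIntegral_of_ne v hw, h w hw]

theorem localMap_zero_maximal (v : HeightOneSpectrum (𝓞 K)) {x : DR K} (hx : x * x = x)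
    (h : localMap v 0 * x = localMap v 0) : x = localMap v 0 ∨ x = 1 := by
  rw [mul_comm, mul_localMap_zero_iff] at h
  obtain ⟨a, rfl⟩ := h
  obtain ⟨χ, hχ, h1⟩ := exists_mk_of_isIdempotentElem hx
  obtain ⟨u, hu⟩ := DR.mk_eq_mk_iff.mp h1
  obtain ⟨h2, -⟩ := Prod.ext_iff.mp hu
  have h3 : ∀ w, w ≠ v → χ w = 1 := by
    intro w hw
    have h4 : χ w = localIntegral v a w * (u : IntegralAdeles K) w := congrFun h2 w
    rw [localIntegral_of_ne v hw, one_mul] at h4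
    refine (hχ w).resolve_left fun h5 => ?_
    rw [h5] at h4
    exact (MulEquiv.piUnits u w).ne_zero h4.symm
  rw [h1]
  rcases hχ v with h4 | h4
  · exact Or.inl (by rw [eq_localIntegral_zero h4 h3, localMap_apply])
  · right
    have : χ = 1 := funext fun w => by
      by_cases hw : w = v
      · subst hw
        exact h4
      · exact h3 w hw
    rw [this]
    exact map_one (DR.mk K)

/-- A nontrivial idempotent vanishes at some place `v` and then lies below the idempotent of `v`;
maximality makes them equal. -/
theorem exists_localMap_zero_eq {x : DR K} (hx : x * x = x) (hx1 : x ≠ 1)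
    (h : ∀ y : DR K, y * y = y → x * y = x → y = x ∨ y = 1) : ∃ v, localMap v 0 = x := by
  obtain ⟨χ, hχ, rfl⟩ := exists_mk_of_isIdempotentElem hx
  obtain ⟨v, hv⟩ : ∃ v, χ v = 0 := by
    by_contra! h'
    have : χ = 1 := funext fun v => (hχ v).resolve_left (h' v)
    rw [this] at hx1
    exact hx1 (map_one (DR.mk K))
  refine ⟨v, (h _ (localMap_zero_mul_self v) ?_).resolve_right (localMap_zero_ne_one v)⟩
  rw [localMap_apply, ← map_mul, Prod.mk_mul_mk, mul_one]
  congr 2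
  funext w
  by_cases hw : w = v
  · subst hw
    rw [Pi.mul_apply, hv, zero_mul]
  · rw [Pi.mul_apply, localIntegral_of_ne v hw, mul_one]

theorem localMap_zero_injective :
    Function.Injective fun v : HeightOneSpectrum (𝓞 K) => localMap v 0 := by
  intro v w h
  obtain ⟨u, hu⟩ := DR.mk_eq_mk_iff.mp h
  by_contra hne
  have h1 : localIntegral w 0 v = localIntegral v 0 v * (u : IntegralAdeles K) v :=
    congrFun (congrArg Prod.fst hu) v
  rw [localIntegral_same, localIntegral_of_ne w hne, zero_mul] at h1
  exact one_ne_zero h1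

/-- A unit `u` identifying two elements has trivial class, so it comes from some `k` in `Kˣ`. Its
component at any second place is `1`, which forces `k = 1`. -/
theorem localMap_injective [Finite (𝓞 K)ˣ] (v : HeightOneSpectrum (𝓞 K)) :
    Function.Injective (localMap v) := by
  intro a b h
  obtain ⟨u, hu⟩ := DR.mk_eq_mk_iff.mp h
  obtain ⟨h1, h2⟩ := Prod.ext_iff.mp hu
  change localIntegral v b = localIntegral v a * u at h1
  change 1 = (unitRec K u)⁻¹ * 1 at h2
  rw [mul_one, eq_comm, inv_eq_one] at h2
  obtain ⟨k, hk⟩ := exists_finiteEmbedding_eq_of_finiteRec_eq_one h2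
  obtain ⟨w, hw⟩ := exists_heightOneSpectrum_notMem (Set.finite_singleton v)
  have hwv : w ≠ v := hw
  have h3 : localIntegral v b w = localIntegral v a w * (u : IntegralAdeles K) w := congrFun h1 w
  rw [localIntegral_of_ne v hwv, localIntegral_of_ne v hwv, one_mul] at h3
  have h4 : algebraMap K (w.adicCompletion K) k = 1 := by
    have h5 := congrArg (fun x => (ideleEval K w x : w.adicCompletion K)) hk
    rw [ideleEval_unit, ← h3] at h5
    exact h5
  have h6 : k = 1 := by
    refine Units.ext ((algebraMap K (w.adicCompletion K)).injective ?_)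
    rw [h4, Units.val_one, map_one]
  have h7 : u = 1 := by
    rw [h6, map_one] at hk
    refine Units.ext (toFinite_injective K ?_)
    exact (congrArg Units.val hk).symm
  have h8 : localIntegral v b v = localIntegral v a v * (u : IntegralAdeles K) v := congrFun h1 v
  rw [h7, Units.val_one, Pi.one_apply, mul_one, localIntegral_same, localIntegral_same] at h8
  exact h8.symm

theorem isClosedEmbedding_localMap [Finite (𝓞 K)ˣ] (v : HeightOneSpectrum (𝓞 K)) :
    IsClosedEmbedding (localMap v) := by
  refine Continuous.isClosedEmbedding ?_ (localMap_injective v)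
  exact (DR.isOpenQuotientMap_mk K).continuous.comp
    ((continuous_localIntegral v).prodMk continuous_const)

theorem localMap_mul_galMap (v : HeightOneSpectrum (𝓞 K)) (a : v.adicCompletionIntegers K)
    (s : GalAb K) : localMap v a * galMap K s = DR.mk K (localIntegral v a, s) := by
  rw [localMap_apply, galMap_apply, ← map_mul, Prod.mk_mul_mk, one_mul, mul_one]

theorem idealExp_pow (v : HeightOneSpectrum (𝓞 K)) (𝔞 : (Ideal (𝓞 K))⁰) (n : ℕ) :
    idealExp K v (𝔞 ^ n) = n * idealExp K v 𝔞 := by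
  induction n with
  | zero => rw [pow_zero, idealExp_one, zero_mul]
  | succ n ih => rw [pow_succ, idealExp_mul, ih, Nat.succ_mul]

/-- This turns `I_K` into the local class map. If `[a, s]` is the class of an ideal, the idele of
that ideal is `a u` with `u` a unit, and `u` cancels from the second component. Conversely, `a`
generates a power of `𝔭` locally everywhere. -/
theorem localMap_mul_galMap_mem_ideals_iff {v : HeightOneSpectrum (𝓞 K)}
    {a : v.adicCompletionIntegers K} {x : (v.adicCompletion K)ˣ}
    (hx : (x : v.adicCompletion K) = a) (s : GalAb K) :
    localMap v a * galMap K s ∈ DR.ideals K ↔ s = (finiteRec K (localIdele v x))⁻¹ := by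
  have hax : IntegralAdeles.toFinite K (localIntegral v a) = localIdele v x := by
    rw [toFinite_localIntegral, ← hx]
    rfl
  rw [localMap_mul_galMap]
  constructor
  · rintro ⟨𝔞, h𝔞⟩
    obtain ⟨u, hu⟩ := DR.mk_eq_mk_iff.mp h𝔞.symm
    obtain ⟨h1, h2⟩ := Prod.ext_iff.mp hu
    have h3 : idealIdele K 𝔞 = localIdele v x * Units.map (IntegralAdeles.toFinite K) u := by
      refine Units.ext ?_
      rw [Units.val_mul, ← hax]
      change IntegralAdeles.toFinite K (idealAdele K 𝔞) = _
      rw [show idealAdele K 𝔞 = localIntegral v a * u from h1, map_mul]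
      rfl
    change (finiteRec K (idealIdele K 𝔞))⁻¹ = (unitRec K u)⁻¹ * s at h2
    rw [eq_inv_mul_iff_mul_eq, h3, map_mul, mul_inv, mul_comm] at h2
    change _ * (unitRec K u)⁻¹ * _ = s at h2
    rw [inv_mul_cancel_right] at h2
    exact h2.symm
  · rintro rfl
    have h0 : Valued.v (x : v.adicCompletion K) ≠ 0 := (Valuation.ne_zero_iff _).mpr x.ne_zero
    have h1 : Valued.v (x : v.adicCompletion K) ≤ 1 := hx ▸ a.2
    obtain ⟨n, hn⟩ : ∃ n : ℕ, Valued.v (x : v.adicCompletion K) = WithZero.exp (-(n : ℤ)) := by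
      rw [← WithZero.exp_log h0, ← WithZero.exp_zero, WithZero.exp_le_exp] at h1
      refine ⟨(-(WithZero.log (Valued.v (x : v.adicCompletion K)))).toNat, ?_⟩
      rw [Int.toNat_of_nonneg (by omega), neg_neg, WithZero.exp_log h0]
    refine ⟨⟨v.asIdeal, mem_nonZeroDivisors_of_ne_zero v.ne_bot⟩ ^ n,
      idealToDR_eq K _ _ _ hax fun w => ?_⟩
    rw [idealExp_pow]
    by_cases h : w = v
    · subst h
      rw [localIntegral_same, idealExp_asIdeal_self, mul_one, ← hx, hn]
    · rw [localIntegral_of_ne v h, idealExp_asIdeal_of_ne h, mul_zero]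
      simp

end DR

end DeligneRibetStructure

/-! ### The local part of the reconstruction: `K_𝔭ˣ`, its units and the class map -/

section Model

section

variable {K : Type*} [Field K] [NumberField K] (v : HeightOneSpectrum (𝓞 K))

/-- The inclusion of `O_𝔭 ∖ {0}` in `K_𝔭ˣ`. -/
noncomputable def nonzeroToUnits :
    (v.adicCompletionIntegers K)⁰ →* (v.adicCompletion K)ˣ where
  toFun a := Units.mk0 (a : v.adicCompletionIntegers K) fun h =>
    nonZeroDivisors.coe_ne_zero a (Subtype.ext h)
  map_one' := Units.ext rfl
  map_mul' _ _ := Units.ext rfl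

theorem nonzeroToUnits_val (a : (v.adicCompletionIntegers K)⁰) :
    (nonzeroToUnits v a : v.adicCompletion K) = (a : v.adicCompletionIntegers K) := rfl

theorem exists_nonzeroToUnits_eq {x : (v.adicCompletion K)ˣ}
    (hx : Valued.v (x : v.adicCompletion K) ≤ 1) : ∃ a, nonzeroToUnits v a = x :=
  ⟨⟨⟨x, hx⟩, mem_nonZeroDivisors_of_ne_zero fun h => x.ne_zero (congrArg Subtype.val h)⟩,
    Units.ext rfl⟩

theorem exists_nonzeroToUnits_mul_eq (x : (v.adicCompletion K)ˣ) :
    ∃ a b, x * nonzeroToUnits v b = nonzeroToUnits v a := by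
  rcases le_total (Valued.v (x : v.adicCompletion K)) 1 with h | h
  · obtain ⟨a, ha⟩ := exists_nonzeroToUnits_eq v h
    exact ⟨a, 1, by rw [map_one, mul_one, ha]⟩
  · obtain ⟨b, hb⟩ := exists_nonzeroToUnits_eq v (x := x⁻¹) (by
      rw [Units.val_inv_eq_inv_val, map_inv₀]
      exact inv_le_one_of_one_le₀ h)
    exact ⟨1, b, by rw [map_one, hb, mul_inv_cancel]⟩

theorem valued_eq_one_of_valued_sub_one_lt_one {x : v.adicCompletion K}
    (hx : Valued.v (x - 1) < 1) : Valued.v x = 1 := by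
  have h := Valuation.map_add_eq_of_lt_right Valued.v (x := x - 1) (y := 1) (by rwa [map_one])
  rwa [sub_add_cancel, map_one] at h

end

variable {K : Type*} [Field K] [NumberField K] {M : Type*} [CommMonoid M] [TopologicalSpace M]
  (φ : M ≃ₜ* DR K)

/-- The embedding of `O_𝔭` in a monoid isomorphic to `DR_K`. -/
noncomputable def localHom (v : HeightOneSpectrum (𝓞 K)) : v.adicCompletionIntegers K →* M :=
  φ.symm.toMulEquiv.toMonoidHom.comp (DR.localMap v)

theorem apply_localHom (v : HeightOneSpectrum (𝓞 K)) (a : v.adicCompletionIntegers K) :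
    φ (localHom φ v a) = DR.localMap v a := φ.apply_symm_apply _

theorem localHom_eq_iff {v : HeightOneSpectrum (𝓞 K)} {a : v.adicCompletionIntegers K} {x : M} :
    x = localHom φ v a ↔ φ x = DR.localMap v a := by
  rw [← apply_localHom φ, φ.injective.eq_iff]

theorem localHom_injective [Finite (𝓞 K)ˣ] (v : HeightOneSpectrum (𝓞 K)) :
    Function.Injective (localHom φ v) :=
  φ.symm.injective.comp (DR.localMap_injective v)

theorem isClosedEmbedding_localHom [Finite (𝓞 K)ˣ] (v : HeightOneSpectrum (𝓞 K)) :
    IsClosedEmbedding (localHom φ v) :=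
  φ.symm.toHomeomorph.isClosedEmbedding.comp (DR.isClosedEmbedding_localMap v)

/-- The embedding of `G_K^{ab}` in a monoid isomorphic to `DR_K`. -/
noncomputable def galHom : GalAb K →* Mˣ :=
  (Units.map φ.symm.toMulEquiv.toMonoidHom).comp (DR.galMap K)

theorem apply_galHom (s : GalAb K) : φ (galHom φ s : M) = DR.galMap K s := φ.apply_symm_apply _

theorem continuous_galHom : Continuous (galHom φ) :=
  (Units.continuous_map (f := φ.symm.toMulEquiv.toMonoidHom) φ.symm.continuous).comp
    DR.continuous_galMap

theorem galHom_injective : Function.Injective (galHom φ) :=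
  (Units.map_injective (f := φ.symm.toMulEquiv.toMonoidHom) φ.symm.injective).comp
    DR.galMap_injective

theorem galHom_surjective : Function.Surjective (galHom φ) := by
  intro x
  obtain ⟨s, hs⟩ := DR.galMap_surjective (Units.map φ.toMulEquiv.toMonoidHom x)
  refine ⟨s, Units.ext (φ.injective ?_)⟩
  rw [apply_galHom, hs]
  rfl

/-- The maximal idempotents correspond to the maximal ideals. -/
noncomputable def maxIdempotentEquiv : HeightOneSpectrum (𝓞 K) ≃ MaxIdempotent M :=
  Equiv.ofBijective (fun v => ⟨localHom φ v 0, by rw [← map_mul, zero_mul], fun h => by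
      rw [eq_comm, localHom_eq_iff, map_one] at h
      exact DR.localMap_zero_ne_one v h.symm, fun x hx h => by
      have h1 := DR.localMap_zero_maximal v (x := φ x) (by rw [← map_mul, hx])
        (by rw [← apply_localHom φ, ← map_mul, h])
      rw [← apply_localHom φ, ← map_one φ, φ.injective.eq_iff, φ.injective.eq_iff] at h1
      exact h1⟩) (by
    constructor
    · intro v w h
      exact DR.localMap_zero_injective (φ.symm.injective (congrArg Subtype.val h))
    · rintro ⟨e, he, he1, hmax⟩
      obtain ⟨v, hv⟩ := DR.exists_localMap_zero_eq (x := φ e) (by rw [← map_mul, he])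
        (by rwa [← map_one φ, φ.injective.ne_iff]) fun y hy h => by
          rw [← φ.apply_symm_apply y, φ.injective.eq_iff, ← map_one φ, φ.injective.eq_iff]
          refine hmax _ (by rw [← map_mul, hy]) (φ.injective ?_)
          rw [map_mul, φ.apply_symm_apply, h]
      exact ⟨v, Subtype.ext ((localHom_eq_iff φ).mpr hv.symm).symm⟩)

variable [Finite (𝓞 K)ˣ] (v : HeightOneSpectrum (𝓞 K))

/-- The set generating `localNonzero` is the image of the nonzero elements of a domain, so it is
already a submonoid and the closure adds nothing. -/
theorem mem_localNonzero_iff {x : M} :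
    x ∈ localNonzero (localHom φ v 0) ↔ ∃ a ≠ 0, localHom φ v a = x := by
  have h : {x | x * localHom φ v 0 = localHom φ v 0 ∧ x ≠ localHom φ v 0} =
      (Submonoid.map (localHom φ v) (v.adicCompletionIntegers K)⁰ : Set M) := by
    ext x
    rw [Set.mem_ofPred_eq, SetLike.mem_coe, Submonoid.mem_map, ← φ.injective.eq_iff, map_mul,
      apply_localHom, DR.mul_localMap_zero_iff]
    constructor
    · rintro ⟨⟨a, ha⟩, h⟩
      have hx := (localHom_eq_iff φ).mpr ha.symm
      exact ⟨a, mem_nonZeroDivisors_of_ne_zero fun h0 => h (h0 ▸ hx), hx.symm⟩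
    · rintro ⟨a, ha, rfl⟩
      exact ⟨⟨a, (apply_localHom φ v a).symm⟩, fun h =>
        nonZeroDivisors.ne_zero ha (localHom_injective φ v h)⟩
  rw [localNonzero, h, Submonoid.closure_eq, Submonoid.mem_map]
  exact exists_congr fun a => and_congr_left fun _ => mem_nonZeroDivisors_iff_ne_zero

/-- `O_𝔭 ∖ {0}` as a submonoid of a monoid isomorphic to `DR_K`. -/
noncomputable def localNonzeroEquiv :
    (v.adicCompletionIntegers K)⁰ ≃* localNonzero (localHom φ v 0) :=
  MulEquiv.ofBijective (((localHom φ v).comp (v.adicCompletionIntegers K)⁰.subtype).codRestrict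
    _ fun a => (mem_localNonzero_iff φ v).mpr ⟨a, nonZeroDivisors.coe_ne_zero a, rfl⟩) (by
    constructor
    · intro a b h
      exact Subtype.ext (localHom_injective φ v (congrArg Subtype.val h))
    · rintro ⟨x, hx⟩
      obtain ⟨a, ha, rfl⟩ := (mem_localNonzero_iff φ v).mp hx
      exact ⟨⟨a, mem_nonZeroDivisors_of_ne_zero ha⟩, rfl⟩)

theorem localNonzeroEquiv_val (a : (v.adicCompletionIntegers K)⁰) :
    (localNonzeroEquiv φ v a : M) = localHom φ v a := rfl

/-- The homomorphism from the groupification of `O_𝔭 ∖ {0}` to `K_𝔭ˣ`. -/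
noncomputable def localMulHom : LocalMul (localHom φ v 0) →* (v.adicCompletion K)ˣ :=
  Algebra.GrothendieckGroup.lift
    ((nonzeroToUnits v).comp (localNonzeroEquiv φ v).symm.toMonoidHom)

theorem localMulHom_of (a : (v.adicCompletionIntegers K)⁰) :
    localMulHom φ v (Algebra.GrothendieckGroup.of (localNonzeroEquiv φ v a)) =
      nonzeroToUnits v a := by
  refine (Submonoid.LocalizationMap.lift_eq _ _ _).trans ?_
  exact congrArg (nonzeroToUnits v) ((localNonzeroEquiv φ v).symm_apply_apply a)

theorem LocalMul.exists_of_mul_eq (y : LocalMul (localHom φ v 0)) :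
    ∃ a b, y * Algebra.GrothendieckGroup.of (localNonzeroEquiv φ v b) =
      Algebra.GrothendieckGroup.of (localNonzeroEquiv φ v a) := by
  obtain ⟨⟨x, z⟩, h⟩ :=
    (Localization.monoidOf (⊤ : Submonoid (localNonzero (localHom φ v 0)))).surj y
  refine ⟨(localNonzeroEquiv φ v).symm x, (localNonzeroEquiv φ v).symm z, ?_⟩
  rw [MulEquiv.apply_symm_apply, MulEquiv.apply_symm_apply]
  exact h

theorem localMulHom_bijective : Function.Bijective (localMulHom φ v) := by
  constructor
  · rw [injective_iff_map_eq_one]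
    intro y hy
    obtain ⟨a, b, h⟩ := LocalMul.exists_of_mul_eq φ v y
    have h1 := congrArg (localMulHom φ v) h
    rw [map_mul, hy, one_mul, localMulHom_of, localMulHom_of] at h1
    have h2 : b = a := Subtype.ext (Subtype.ext (congrArg Units.val h1))
    rw [h2] at h
    exact mul_eq_right.mp h
  · intro x
    obtain ⟨a, b, h⟩ := exists_nonzeroToUnits_mul_eq v x
    refine ⟨Algebra.GrothendieckGroup.of (localNonzeroEquiv φ v a) *
      (Algebra.GrothendieckGroup.of (localNonzeroEquiv φ v b))⁻¹, ?_⟩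
    rw [map_mul, map_inv, localMulHom_of, localMulHom_of, ← h, mul_inv_cancel_right]

/-- The groupification of `O_𝔭 ∖ {0}` is `K_𝔭ˣ`. -/
noncomputable def localMulEquiv : LocalMul (localHom φ v 0) ≃* (v.adicCompletion K)ˣ :=
  MulEquiv.ofBijective (localMulHom φ v) (localMulHom_bijective φ v)

theorem localMulEquiv_of (a : (v.adicCompletionIntegers K)⁰) :
    localMulEquiv φ v (Algebra.GrothendieckGroup.of (localNonzeroEquiv φ v a)) =
      nonzeroToUnits v a := localMulHom_of φ v a

theorem mem_localIntegers_iff (y : LocalMul (localHom φ v 0)) :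
    y ∈ localIntegers (localHom φ v 0) ↔
      Valued.v (localMulEquiv φ v y : v.adicCompletion K) ≤ 1 := by
  constructor
  · rintro ⟨x, rfl⟩
    obtain ⟨a, rfl⟩ := (localNonzeroEquiv φ v).surjective x
    rw [localMulEquiv_of]
    exact a.1.2
  · intro h
    obtain ⟨a, ha⟩ := exists_nonzeroToUnits_eq v h
    rw [← localMulEquiv_of φ] at ha
    exact ⟨_, (localMulEquiv φ v).injective ha⟩

theorem mem_localUnits_iff (y : LocalMul (localHom φ v 0)) :
    y ∈ localUnits (localHom φ v 0) ↔
      Valued.v (localMulEquiv φ v y : v.adicCompletion K) = 1 := by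
  -- The units of the submonoid are the integral elements with integral inverse, which reduces the
  -- claim to `mem_localIntegers_iff`.
  have key : y ∈ localUnits (localHom φ v 0) ↔
      y ∈ localIntegers (localHom φ v 0) ∧ y⁻¹ ∈ localIntegers (localHom φ v 0) := by
    constructor
    · rintro ⟨u, rfl⟩
      exact ⟨⟨u, rfl⟩, ⟨(u⁻¹ : (localNonzero (localHom φ v 0))ˣ), by
        rw [eq_inv_iff_mul_eq_one, MonoidHom.comp_apply, Units.coeHom_apply, ← map_mul,
          Units.inv_mul, map_one]⟩⟩
    · rintro ⟨⟨x, rfl⟩, ⟨z, hz⟩⟩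
      obtain ⟨a, rfl⟩ := (localNonzeroEquiv φ v).surjective x
      obtain ⟨b, rfl⟩ := (localNonzeroEquiv φ v).surjective z
      have h1 := congrArg (localMulEquiv φ v) hz
      rw [map_inv, localMulEquiv_of, localMulEquiv_of, eq_inv_iff_mul_eq_one, ← map_mul] at h1
      have h2 : a * b = 1 := by
        rw [mul_comm]
        exact Subtype.ext (Subtype.ext (congrArg Units.val h1))
      exact ⟨Units.map (localNonzeroEquiv φ v).toMonoidHom (Units.mkOfMulEqOne a b h2), rfl⟩
  rw [key, mem_localIntegers_iff, mem_localIntegers_iff, map_inv, Units.val_inv_eq_inv_val,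
    map_inv₀]
  have h0 : 0 < Valued.v (localMulEquiv φ v y : v.adicCompletion K) :=
    zero_lt_iff.mpr ((Valuation.ne_zero_iff _).mpr (Units.ne_zero _))
  rw [inv_le_one₀ h0]
  exact ⟨fun h => le_antisymm h.1 h.2, fun h => ⟨h.le, h.ge⟩⟩

theorem localMulEquiv_of_injective : Function.Injective fun x : localNonzero (localHom φ v 0) =>
    localMulEquiv φ v (Algebra.GrothendieckGroup.of x) := by
  intro x z h
  obtain ⟨a, rfl⟩ := (localNonzeroEquiv φ v).surjective x
  obtain ⟨b, rfl⟩ := (localNonzeroEquiv φ v).surjective z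
  dsimp only at h
  rw [localMulEquiv_of, localMulEquiv_of] at h
  have hab : a = b := Subtype.ext (Subtype.ext (congrArg Units.val h))
  rw [hab]

/-- Since `O_𝔭` is embedded as a closed subspace, convergence in `M` is the same as `𝔭`-adic
convergence. -/
theorem mem_primaryUnits_iff (u : (localNonzero (localHom φ v 0))ˣ) (ℓ : ℕ) :
    u ∈ primaryUnits (localHom φ v 0) ℓ ↔ Tendsto (fun n : ℕ => (localMulEquiv φ v
      (Algebra.GrothendieckGroup.of (u : localNonzero (localHom φ v 0))) :
        v.adicCompletion K) ^ ℓ ^ n) atTop (𝓝 1) := by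
  obtain ⟨a, ha⟩ := (localNonzeroEquiv φ v).surjective u
  rw [← ha, localMulEquiv_of, nonzeroToUnits_val]
  have h1 : ((u : localNonzero (localHom φ v 0)) : M) = localHom φ v a := by
    rw [← ha, localNonzeroEquiv_val]
  rw [primaryUnits, Set.mem_ofPred_eq, h1]
  have h2 : (fun n : ℕ => localHom φ v a ^ ℓ ^ n) =
      localHom φ v ∘ fun n => (a : v.adicCompletionIntegers K) ^ ℓ ^ n := by
    funext n
    rw [Function.comp_apply, map_pow]
  rw [h2, ← map_one (localHom φ v),
    ← (isClosedEmbedding_localHom φ v).isInducing.tendsto_nhds_iff, tendsto_subtype_rng]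
  rfl

theorem valued_localMulEquiv_unit (u : (localNonzero (localHom φ v 0))ˣ) :
    Valued.v (localMulEquiv φ v (Algebra.GrothendieckGroup.of
      (u : localNonzero (localHom φ v 0))) : v.adicCompletion K) = 1 :=
  (mem_localUnits_iff φ v _).mp ⟨u, rfl⟩

theorem exists_localNonzero_unit_eq {x : v.adicCompletion K} (hx : Valued.v x = 1) :
    ∃ u : (localNonzero (localHom φ v 0))ˣ, (localMulEquiv φ v (Algebra.GrothendieckGroup.of
      (u : localNonzero (localHom φ v 0))) : v.adicCompletion K) = x := by
  have h0 : x ≠ 0 := (Valuation.ne_zero_iff Valued.v).mp (hx ▸ one_ne_zero)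
  obtain ⟨u, hu⟩ := (mem_localUnits_iff φ v ((localMulEquiv φ v).symm (Units.mk0 x h0))).mpr (by
    rw [MulEquiv.apply_symm_apply]
    exact hx)
  refine ⟨u, ?_⟩
  change ((localMulEquiv φ v) (((Algebra.GrothendieckGroup.of
    (M := localNonzero (localHom φ v 0))).comp (Units.coeHom _)) u) : v.adicCompletion K) = x
  rw [hu, MulEquiv.apply_symm_apply]
  rfl

theorem mem_primaryUnits_iff_of_valued_lt_one {ℓ : ℕ} (hℓ : ℓ.Prime)
    (h : Valued.v (ℓ : v.adicCompletion K) < 1) (u : (localNonzero (localHom φ v 0))ˣ) :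
    u ∈ primaryUnits (localHom φ v 0) ℓ ↔ Valued.v ((localMulEquiv φ v
      (Algebra.GrothendieckGroup.of (u : localNonzero (localHom φ v 0))) :
        v.adicCompletion K) - 1) < 1 := by
  rw [mem_primaryUnits_iff]
  exact ⟨valued_sub_one_lt_one_of_tendsto v hℓ h (valued_localMulEquiv_unit φ v u).le,
    tendsto_pow_prime_pow v h⟩

theorem infinite_primaryUnits {ℓ : ℕ} (hℓ : ℓ.Prime)
    (h : Valued.v (ℓ : v.adicCompletion K) < 1) :
    (primaryUnits (localHom φ v 0) ℓ).Infinite := by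
  -- The elements `1 + ℓ n` supply infinitely many, distinct because the completion has
  -- characteristic zero.
  have h1 : ∀ n : ℕ, Valued.v ((1 + ℓ * n : v.adicCompletion K) - 1) < 1 := by
    intro n
    rw [add_sub_cancel_left, map_mul]
    exact mul_lt_one_of_lt_of_le h (valued_natCast_le_one v n)
  choose u hu using fun n : ℕ => exists_localNonzero_unit_eq φ v
    (valued_eq_one_of_valued_sub_one_lt_one v (h1 n))
  refine Set.infinite_of_injective_forall_mem (f := u) (fun m n hmn => ?_) fun n => ?_
  · have : CharZero (v.adicCompletion K) := charZero_of_injective_algebraMap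
      (algebraMap K (v.adicCompletion K)).injective
    have h2 : (1 + ℓ * m : v.adicCompletion K) = 1 + ℓ * n := by rw [← hu m, ← hu n, hmn]
    have h3 : (ℓ : v.adicCompletion K) ≠ 0 := Nat.cast_ne_zero.mpr hℓ.ne_zero
    exact Nat.cast_injective (mul_left_cancel₀ h3 (add_left_cancel h2))
  · rw [mem_primaryUnits_iff_of_valued_lt_one φ v hℓ h, hu]
    exact h1 n

/-- Reduction to the finite residue field is injective on these units: the quotient of two congruent
ones lies in `1 + 𝔭 O_𝔭` and is again `ℓ`-primary, and `ℓ` being a unit at `𝔭`, it equals `1`. -/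
theorem finite_primaryUnits {ℓ : ℕ} (h : Valued.v (ℓ : v.adicCompletion K) = 1) :
    (primaryUnits (localHom φ v 0) ℓ).Finite := by
  let f : (localNonzero (localHom φ v 0))ˣ → v.adicCompletionIntegers K := fun u =>
    ⟨localMulEquiv φ v (Algebra.GrothendieckGroup.of (u : localNonzero (localHom φ v 0))),
      (valued_localMulEquiv_unit φ v u).le⟩
  refine Set.Finite.of_finite_image (f := fun u =>
    IsLocalRing.residue (v.adicCompletionIntegers K) (f u)) (Set.toFinite _) fun a ha b hb hab => ?_
  dsimp only at hab
  rw [← sub_eq_zero, ← map_sub, IsLocalRing.residue_eq_zero_iff, IsLocalRing.mem_maximalIdeal,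
    mem_nonunits_iff, HeightOneSpectrum.adicCompletionIntegers.isUnit_iff_valued_eq_one] at hab
  have hlt := lt_of_le_of_ne (f a - f b).2 hab
  set x := localMulEquiv φ v (Algebra.GrothendieckGroup.of (a : localNonzero (localHom φ v 0)))
    with hx
  set y := localMulEquiv φ v (Algebra.GrothendieckGroup.of (b : localNonzero (localHom φ v 0)))
    with hy
  have hlt' : Valued.v ((x : v.adicCompletion K) - y) < 1 := hlt
  rw [mem_primaryUnits_iff] at ha hb
  have hy1 : Valued.v (y : v.adicCompletion K) = 1 := valued_localMulEquiv_unit φ v b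
  have h1 : ((x : v.adicCompletion K) / y) = 1 := by
    refine eq_one_of_tendsto v h ?_ ?_
    · rw [div_sub_one y.ne_zero, map_div₀, hy1, div_one]
      exact hlt'
    · have h2 := ha.div hb one_ne_zero
      rw [div_one] at h2
      exact h2.congr fun n => (div_pow _ _ _).symm
  exact Units.ext (localMulEquiv_of_injective φ v (Units.ext ((div_eq_one_iff_eq y.ne_zero).mp h1)))

/-- The condition of infinitude singles out the residue characteristic among all primes `ℓ`, and for
it the primary units are exactly the principal ones. -/
theorem mem_principalUnits_iff (y : LocalMul (localHom φ v 0)) :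
    y ∈ principalUnits (localHom φ v 0) ↔
      Valued.v ((localMulEquiv φ v y : v.adicCompletion K) - 1) < 1 := by
  constructor
  · rintro ⟨ℓ, hℓ, hinf, u, hu, rfl⟩
    rcases (valued_natCast_le_one v ℓ).lt_or_eq with h | h
    · exact (mem_primaryUnits_iff_of_valued_lt_one φ v hℓ h u).mp hu
    · exact absurd (finite_primaryUnits φ v h) hinf
  · intro h
    obtain ⟨p, hp, hpv⟩ := exists_prime_mem v
    have hpv' : Valued.v (p : v.adicCompletion K) < 1 := by
      rw [valued_natCast]
      exact (valuation_natCast_lt_one_iff v p).mpr hpv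
    obtain ⟨u, hu⟩ := exists_localNonzero_unit_eq φ v (valued_eq_one_of_valued_sub_one_lt_one v h)
    refine ⟨p, hp, infinite_primaryUnits φ v hp hpv', u, ?_, ?_⟩
    · rw [mem_primaryUnits_iff_of_valued_lt_one φ v hp hpv', hu]
      exact h
    · exact (localMulEquiv φ v).injective (Units.ext hu.symm)

/-- The generating pairs lie on the graph of a homomorphism `R`, and every element of the group
completion is a quotient of two elements occurring in such pairs, so they generate the whole graph.
-/
theorem mem_localRec_iff {I : Submonoid M} (hI : ∀ x, φ x ∈ DR.ideals K ↔ x ∈ I)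
    (y : LocalMul (localHom φ v 0)) (σ : Mˣ) : (y, σ) ∈ localRec I (localHom φ v 0) ↔
      σ = galHom φ (finiteRec K (localIdele v (localMulEquiv φ v y)))⁻¹ := by
  have gen : ∀ (a : (v.adicCompletionIntegers K)⁰) (τ : Mˣ),
      (localNonzeroEquiv φ v a : M) * τ ∈ I ↔
        τ = galHom φ (finiteRec K (localIdele v (nonzeroToUnits v a)))⁻¹ := by
    intro a τ
    obtain ⟨s, rfl⟩ := galHom_surjective φ τ
    rw [← hI, map_mul, apply_galHom, localNonzeroEquiv_val, apply_localHom,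
      DR.localMap_mul_galMap_mem_ideals_iff (nonzeroToUnits_val v a), (galHom_injective φ).eq_iff]
  let R : LocalMul (localHom φ v 0) →* Mˣ := ((galHom φ).comp ((finiteRec K).comp
    ((localIdele v).comp (localMulEquiv φ v).toMonoidHom)))⁻¹
  have hR : ∀ y, R y = galHom φ (finiteRec K (localIdele v (localMulEquiv φ v y)))⁻¹ := by
    intro y
    rw [map_inv]
    rfl
  rw [← hR]
  constructor
  · intro h
    have hle : localRec I (localHom φ v 0) ≤ R.graph := by
      refine (Subgroup.closure_le _).mpr ?_
      rintro _ ⟨ρ, τ, h1, rfl⟩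
      obtain ⟨a, rfl⟩ := (localNonzeroEquiv φ v).surjective ρ
      refine MonoidHom.mem_graph.mpr ?_
      rw [hR, localMulEquiv_of]
      exact ((gen a τ).mp h1).symm
    exact (MonoidHom.mem_graph.mp (hle h)).symm
  · rintro rfl
    have h1 : ∀ a, (Algebra.GrothendieckGroup.of (localNonzeroEquiv φ v a),
        R (Algebra.GrothendieckGroup.of (localNonzeroEquiv φ v a))) ∈
          localRec I (localHom φ v 0) := fun a => by
      refine Subgroup.subset_closure ⟨localNonzeroEquiv φ v a, _, (gen a _).mpr ?_, rfl⟩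
      rw [hR, localMulEquiv_of]
    obtain ⟨a, b, h⟩ := LocalMul.exists_of_mul_eq φ v y
    have h2 := Subgroup.mul_mem _ (h1 a) (Subgroup.inv_mem _ (h1 b))
    rw [← h, map_mul, Prod.inv_mk, Prod.mk_mul_mk, mul_inv_cancel_right, mul_inv_cancel_right] at h2
    exact h2

end Model

/-! ### The global part of the reconstruction: the multiplicative group of `K` -/

section RecUnits

/-- The diagonal embedding of `Kˣ` in the product of the groups `K_𝔭ˣ`. -/
noncomputable def diagonal (K : Type*) [Field K] [NumberField K] :
    Kˣ →* ∀ v : HeightOneSpectrum (𝓞 K), (v.adicCompletion K)ˣ :=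
  MonoidHom.pi fun v => (ideleEval K v).comp (finiteEmbedding K)

variable {K : Type*} [Field K] [NumberField K]

theorem diagonal_apply (k : Kˣ) (v : HeightOneSpectrum (𝓞 K)) :
    (diagonal K k v : v.adicCompletion K) = algebraMap K (v.adicCompletion K) k := rfl

theorem valued_diagonal (k : Kˣ) (v : HeightOneSpectrum (𝓞 K)) :
    Valued.v (diagonal K k v : v.adicCompletion K) = v.valuation K (k : K) := by
  rw [← HeightOneSpectrum.adicCompletion.valued_coe]
  rfl

theorem diagonal_injective [Finite (𝓞 K)ˣ] : Function.Injective (diagonal K) := by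
  intro k l h
  obtain ⟨v, -⟩ := exists_heightOneSpectrum_notMem (K := K) Set.finite_empty
  exact Units.ext ((algebraMap K (v.adicCompletion K)).injective
    (congrArg Units.val (congrFun h v)))

theorem diagonal_neg_one : diagonal K (-1) = -1 := by
  funext v
  refine Units.ext ?_
  rw [diagonal_apply, Units.val_neg, Units.val_one, map_neg, map_one]
  rfl

theorem units_eq_neg_one_iff_orderOf {F : Type*} [Field F] [CharZero F] (x : Fˣ) :
    x = -1 ↔ orderOf x = 2 := by
  rw [orderOf_eq_prime_iff]
  constructor
  · rintro rfl
    exact ⟨by simp, fun h => by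
      have h1 := congrArg Units.val h
      rw [Units.val_neg, Units.val_one] at h1
      norm_num at h1⟩
  · rintro ⟨h1, h2⟩
    rw [sq, ← Units.val_inj, Units.val_mul, Units.val_one, mul_self_eq_one_iff] at h1
    exact Units.ext (h1.resolve_left fun h => h2 (Units.ext h))

variable {M : Type*} [CommMonoid M] [TopologicalSpace M] (φ : M ≃ₜ* DR K) [Finite (𝓞 K)ˣ]

/-- The product of the groupifications of the monoids `O_𝔭 ∖ {0}` is `∏ K_𝔭ˣ`. -/
noncomputable def familyEquiv : (∀ e : MaxIdempotent M, LocalMul e.1) ≃*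
    ∀ v : HeightOneSpectrum (𝓞 K), (v.adicCompletion K)ˣ :=
  MulEquiv.ofBijective
    ({  toFun := fun x v => localMulEquiv φ v (x (maxIdempotentEquiv φ v))
        map_one' := funext fun v => map_one (localMulEquiv φ v)
        map_mul' := fun _ _ => funext fun v => map_mul (localMulEquiv φ v) _ _ } :
      (∀ e : MaxIdempotent M, LocalMul e.1) →* ∀ v : HeightOneSpectrum (𝓞 K),
        (v.adicCompletion K)ˣ) (by
    constructor
    · intro x y h
      funext e
      obtain ⟨v, rfl⟩ := (maxIdempotentEquiv φ).surjective e
      exact (localMulEquiv φ v).injective (congrFun h v)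
    · intro y
      refine ⟨(maxIdempotentEquiv φ).piCongrLeft (fun e => LocalMul e.1)
        fun v => (localMulEquiv φ v).symm (y v), funext fun v => ?_⟩
      exact (localMulEquiv φ v).eq_symm_apply.mp
        (Equiv.piCongrLeft_apply_apply (fun e : MaxIdempotent M => LocalMul e.1) _ _ v))

theorem familyEquiv_apply (x : ∀ e : MaxIdempotent M, LocalMul e.1)
    (v : HeightOneSpectrum (𝓞 K)) :
    familyEquiv φ x v = localMulEquiv φ v (x (maxIdempotentEquiv φ v)) := rfl

/-- In a field of characteristic zero, `-1` is the only element of order two, so there is exactly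
one family of signs. -/
theorem mem_signs_iff (x : ∀ e : MaxIdempotent M, LocalMul e.1) :
    x ∈ signs M ↔ familyEquiv φ x = -1 := by
  have key : ∀ v : HeightOneSpectrum (𝓞 K),
      orderOf (x (maxIdempotentEquiv φ v)) = 2 ↔ familyEquiv φ x v = -1 := by
    intro v
    have : CharZero (v.adicCompletion K) := charZero_of_injective_algebraMap
      (algebraMap K (v.adicCompletion K)).injective
    rw [units_eq_neg_one_iff_orderOf, familyEquiv_apply]
    exact (MulEquiv.orderOf_eq (localMulEquiv φ v) _).symm ▸ Iff.rfl
  constructor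
  · intro h
    exact funext fun v => (key v).mp (h _)
  · intro h e
    obtain ⟨v, rfl⟩ := (maxIdempotentEquiv φ).surjective e
    exact (key v).mpr (congrFun h v)

variable [ContinuousMul M] {I : Submonoid M}

/-- The components of `x` form an idele `y`. The elements `s e` are the inverse classes of its local
components, so their product is the inverse class of `y`; as limits in `Mˣ` are unique, `y` has
trivial class and is global. -/
theorem exists_diagonal_eq_of_mem_recKernel (hI : ∀ x, φ x ∈ DR.ideals K ↔ x ∈ I)
    {x : ∀ e : MaxIdempotent M, LocalMul e.1}
    (hx : x ∈ recKernel I) : ∃ k : Kˣ, diagonal K k = familyEquiv φ x := by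
  obtain ⟨h1, s, hs, hprod⟩ := hx
  have : T2Space M := φ.toHomeomorph.symm.t2Space
  obtain ⟨y, hy⟩ := exists_idele_of_local (familyEquiv φ x) (by
    filter_upwards [(maxIdempotentEquiv φ).injective.tendsto_cofinite.eventually h1] with v hv
    exact (mem_localUnits_iff φ v _).mp hv)
  have h2 : ∀ v, s (maxIdempotentEquiv φ v) =
      (galHom φ (finiteRec K (localIdele v (ideleEval K v y))))⁻¹ := by
    intro v
    rw [hy, ← map_inv]
    exact (mem_localRec_iff φ v hI _ _).mp (hs (maxIdempotentEquiv φ v))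
  have h3 := ((hasProd_finiteRec_localIdele y).map (galHom φ) (continuous_galHom φ)).inv
  have h4 := (maxIdempotentEquiv φ).hasProd_iff.mpr hprod
  have h5 : s ∘ maxIdempotentEquiv φ = fun v =>
      ((galHom φ ∘ fun v => finiteRec K (localIdele v (ideleEval K v y))) v)⁻¹ := funext h2
  rw [h5] at h4
  have h6 := h3.unique h4
  rw [inv_eq_one] at h6
  have h7 : finiteRec K y = 1 := galHom_injective φ (by rw [h6, map_one])
  obtain ⟨k, hk⟩ := exists_finiteEmbedding_eq_of_finiteRec_eq_one h7
  refine ⟨k, funext fun v => ?_⟩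
  rw [← hy, ← hk]
  rfl

/-- Conversely, the local components of a global `k` with trivial class have classes whose product
converges to `1`. -/
theorem mem_recKernel_of_finiteRec_eq_one (hI : ∀ x, φ x ∈ DR.ideals K ↔ x ∈ I)
    {x : ∀ e : MaxIdempotent M, LocalMul e.1} {k : Kˣ}
    (hk : finiteRec K (finiteEmbedding K k) = 1) (h : diagonal K k = familyEquiv φ x) :
    x ∈ recKernel I := by
  have hval := eventually_valued_ideleEval (finiteEmbedding K k)
  have hprod := ((hasProd_finiteRec_localIdele (finiteEmbedding K k)).map (galHom φ)
    (continuous_galHom φ)).inv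
  rw [hk, map_one, inv_one] at hprod
  let t : HeightOneSpectrum (𝓞 K) → Mˣ := fun v =>
    (galHom φ (finiteRec K (localIdele v (ideleEval K v (finiteEmbedding K k)))))⁻¹
  refine ⟨?_, fun e => t ((maxIdempotentEquiv φ).symm e), fun e => ?_, ?_⟩
  · have h1 := (maxIdempotentEquiv φ).symm.injective.tendsto_cofinite.eventually hval
    filter_upwards [h1] with e he
    obtain ⟨v, rfl⟩ := (maxIdempotentEquiv φ).surjective e
    rw [Equiv.symm_apply_apply] at he
    refine (mem_localUnits_iff φ v _).mpr ?_
    rw [← familyEquiv_apply, ← h]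
    exact he
  · obtain ⟨v, rfl⟩ := (maxIdempotentEquiv φ).surjective e
    refine (mem_localRec_iff φ v hI _ _).mpr ?_
    rw [← familyEquiv_apply, ← h, map_inv]
    change t ((maxIdempotentEquiv φ).symm (maxIdempotentEquiv φ v)) = _
    rw [Equiv.symm_apply_apply]
    rfl
  · rw [← (maxIdempotentEquiv φ).hasProd_iff]
    convert hprod using 1
    funext v
    rw [Function.comp_apply, Equiv.symm_apply_apply]
    rfl

variable [Subsingleton (InfinitePlace K)]

/-- The kernel only accounts for elements with trivial class. Of `k` and `-k` at least one is of
this kind, so the sign `-1` supplies the rest. -/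
theorem mem_recUnits_iff (hI : ∀ x, φ x ∈ DR.ideals K ↔ x ∈ I)
    (x : ∀ e : MaxIdempotent M, LocalMul e.1) :
    x ∈ recUnits I ↔ ∃ k : Kˣ, diagonal K k = familyEquiv φ x := by
  constructor
  · have h : recUnits I ≤ (diagonal K).range.comap (familyEquiv φ).toMonoidHom := by
      refine sup_le (fun y hy => exists_diagonal_eq_of_mem_recKernel φ hI hy)
        ((Subgroup.closure_le _).mpr fun y hy => ⟨-1, ?_⟩)
      rw [diagonal_neg_one]
      exact ((mem_signs_iff φ y).mp hy).symm
    exact fun hx => h hx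
  · rintro ⟨k, hk⟩
    rcases finiteRec_finiteEmbedding_eq_one_or k with h | h
    · exact Subgroup.mem_sup_left (mem_recKernel_of_finiteRec_eq_one φ hI h hk)
    · have h1 : (familyEquiv φ).symm (diagonal K (-k)) ∈ recUnits I :=
        Subgroup.mem_sup_left (mem_recKernel_of_finiteRec_eq_one φ hI h
          ((familyEquiv φ).apply_symm_apply _).symm)
      have h2 : (familyEquiv φ).symm (diagonal K (-1)) ∈ recUnits I := by
        refine Subgroup.mem_sup_right (Subgroup.subset_closure ((mem_signs_iff φ _).mpr ?_))
        rw [MulEquiv.apply_symm_apply, diagonal_neg_one]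
      have h3 := (recUnits I).mul_mem h1 h2
      rw [← map_mul, ← map_mul, neg_mul_neg, mul_one, hk, MulEquiv.symm_apply_apply] at h3
      exact h3

variable (hI : ∀ x, φ x ∈ DR.ideals K ↔ x ∈ I)

/-- The reconstructed multiplicative group is `Kˣ`. -/
noncomputable def recUnitsEquiv : Kˣ ≃* recUnits I :=
  MulEquiv.ofBijective (((familyEquiv φ).symm.toMonoidHom.comp (diagonal K)).codRestrict
    (recUnits I) fun k => (mem_recUnits_iff φ hI _).mpr
      ⟨k, ((familyEquiv φ).apply_symm_apply _).symm⟩) (by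
    constructor
    · intro k l h
      exact diagonal_injective ((familyEquiv φ).symm.injective (congrArg Subtype.val h))
    · rintro ⟨x, hx⟩
      obtain ⟨k, hk⟩ := (mem_recUnits_iff φ hI x).mp hx
      exact ⟨k, Subtype.ext ((familyEquiv φ).symm_apply_eq.mpr hk)⟩)

theorem localMulEquiv_recUnitsEquiv (k : Kˣ) (v : HeightOneSpectrum (𝓞 K)) :
    localMulEquiv φ v ((recUnitsEquiv φ hI k).1 (maxIdempotentEquiv φ v)) = diagonal K k v :=
  congrFun ((familyEquiv φ).apply_symm_apply (diagonal K k)) v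

theorem recUnitsEquiv_mem_localIntegers_iff (k : Kˣ) (v : HeightOneSpectrum (𝓞 K)) :
    (recUnitsEquiv φ hI k).1 (maxIdempotentEquiv φ v) ∈ localIntegers (maxIdempotentEquiv φ v).1 ↔
      v.valuation K (k : K) ≤ 1 := by
  refine (mem_localIntegers_iff φ v _).trans ?_
  rw [localMulEquiv_recUnitsEquiv, valued_diagonal]

theorem recUnitsEquiv_mem_localUnits_iff (k : Kˣ) (v : HeightOneSpectrum (𝓞 K)) :
    (recUnitsEquiv φ hI k).1 (maxIdempotentEquiv φ v) ∈ localUnits (maxIdempotentEquiv φ v).1 ↔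
      v.valuation K (k : K) = 1 := by
  refine (mem_localUnits_iff φ v _).trans ?_
  rw [localMulEquiv_recUnitsEquiv, valued_diagonal]

theorem recUnitsEquiv_mem_principalUnits_iff (k : Kˣ) (v : HeightOneSpectrum (𝓞 K)) :
    (recUnitsEquiv φ hI k).1 (maxIdempotentEquiv φ v) ∈
      principalUnits (maxIdempotentEquiv φ v).1 ↔ v.valuation K ((k : K) - 1) < 1 := by
  refine (mem_principalUnits_iff φ v _).trans ?_
  rw [localMulEquiv_recUnitsEquiv, ← HeightOneSpectrum.adicCompletion.valued_coe]
  have h : ((k - 1 : K) : v.adicCompletion K) = (diagonal K k v : v.adicCompletion K) - 1 := by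
    rw [diagonal_apply, ← map_one (algebraMap K (v.adicCompletion K)), ← map_sub]
    rfl
  rw [h]

open Classical in
/-- The reconstructed field is `K`. -/
noncomputable def recFieldEquiv : (reconstruction I).F ≃* K :=
  (MulEquiv.withZero (recUnitsEquiv φ hI).symm).trans WithZero.withZeroUnitsEquiv

theorem recFieldEquiv_coe (k : Kˣ) :
    recFieldEquiv φ hI ((recUnitsEquiv φ hI k : recUnits I) : WithZero (recUnits I)) = k := by
  classical
  change WithZero.withZeroUnitsEquiv
    (((recUnitsEquiv φ hI).symm (recUnitsEquiv φ hI k) : Kˣ) : WithZero Kˣ) = k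
  rw [MulEquiv.symm_apply_apply]
  rfl

theorem recFieldEquiv_zero : recFieldEquiv φ hI (0 : WithZero (recUnits I)) = 0 :=
  map_zero (recFieldEquiv φ hI)

end RecUnits

/-! ### The isomorphism with the arithmetic data of `K` and its uniqueness -/

section ReconstructionIso

theorem MulFieldData.Iso.ext_of_apply {D E : MulFieldData} {f g : D.Iso E}
    (h : ∀ x, f.toMulEquiv x = g.toMulEquiv x) (hp : ∀ p, f.primes p = g.primes p) : f = g := by
  obtain ⟨f₁, f₂, _, _, _⟩ := f
  obtain ⟨g₁, g₂, _, _, _⟩ := g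
  obtain rfl : f₁ = g₁ := MulEquiv.ext h
  obtain rfl : f₂ = g₂ := Equiv.ext hp
  rfl

theorem mem_range_algebraMap_iff {K : Type*} [Field K] [NumberField K] (x : K) :
    x ∈ Set.range (algebraMap (𝓞 K) K) ↔
      ∀ v : HeightOneSpectrum (𝓞 K), v.valuation K x ≤ 1 := by
  constructor
  · rintro ⟨r, rfl⟩ v
    exact v.valuation_le_one r
  · intro h
    exact HeightOneSpectrum.mem_integers_of_valuation_le_one K x h

theorem mem_image_asIdeal_iff {K : Type*} [Field K] [NumberField K]
    (v : HeightOneSpectrum (𝓞 K)) (x : K) :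
    x ∈ algebraMap (𝓞 K) K '' (v.asIdeal : Set (𝓞 K)) ↔
      (∀ w : HeightOneSpectrum (𝓞 K), w.valuation K x ≤ 1) ∧ v.valuation K x ≠ 1 := by
  rw [← mem_range_algebraMap_iff]
  constructor
  · rintro ⟨r, hr, rfl⟩
    exact ⟨⟨r, rfl⟩, ((v.valuation_lt_one_iff_mem r).mpr hr).ne⟩
  · rintro ⟨⟨r, rfl⟩, h⟩
    exact ⟨r, (v.valuation_lt_one_iff_mem (K := K) r).mp
      (lt_of_le_of_ne (v.valuation_le_one r) h), rfl⟩

section Membership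

variable {M : Type*} [CommMonoid M] [TopologicalSpace M] [ContinuousMul M] {I : Submonoid M}

/-- The sets `O` and `ideal e` are defined by a condition on every `y` with `x = y`, which is
vacuous at zero; the set `U e` is defined by an existential and therefore excludes zero. -/
theorem zero_mem_reconstruction_O : (0 : (reconstruction I).F) ∈ (reconstruction I).O :=
  fun _ h => absurd h.symm (WithZero.coe_ne_zero)

theorem coe_mem_reconstruction_O (y : recUnits I) :
    ((y : WithZero (recUnits I)) : (reconstruction I).F) ∈ (reconstruction I).O ↔
      ∀ e, y.1 e ∈ localIntegers e.1 := by
  refine ⟨fun h => h y rfl, fun h z hz => ?_⟩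
  rwa [← WithZero.coe_injective hz]

theorem zero_mem_reconstruction_ideal (e : MaxIdempotent M) :
    (0 : (reconstruction I).F) ∈ (reconstruction I).ideal e :=
  fun _ h => absurd h.symm (WithZero.coe_ne_zero)

theorem coe_mem_reconstruction_ideal (e : MaxIdempotent M) (y : recUnits I) :
    ((y : WithZero (recUnits I)) : (reconstruction I).F) ∈ (reconstruction I).ideal e ↔
      (∀ e', y.1 e' ∈ localIntegers e'.1) ∧ y.1 e ∉ localUnits e.1 := by
  refine ⟨fun h => h y rfl, fun h z hz => ?_⟩
  rwa [← WithZero.coe_injective hz]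

theorem zero_notMem_reconstruction_U (e : MaxIdempotent M) :
    (0 : (reconstruction I).F) ∉ (reconstruction I).U e := by
  rintro ⟨_, h, -⟩
  exact WithZero.coe_ne_zero h.symm

theorem coe_mem_reconstruction_U (e : MaxIdempotent M) (y : recUnits I) :
    ((y : WithZero (recUnits I)) : (reconstruction I).F) ∈ (reconstruction I).U e ↔
      y.1 e ∈ principalUnits e.1 := by
  refine ⟨?_, fun h => ⟨y, rfl, h⟩⟩
  rintro ⟨z, hz, h⟩
  rwa [WithZero.coe_injective hz]

end Membership

variable {K : Type*} [Field K] [NumberField K] {M : Type*} [CommMonoid M] [TopologicalSpace M]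
  [ContinuousMul M] {I : Submonoid M}

/-- Limits in `DR K` are unique, so compatibility prescribes the idempotent of each prime. -/
theorem IsCompatible.primes_symm_eq [Subsingleton (InfinitePlace K)] {φ : M ≃ₜ* DR K}
    {f : (reconstruction I).Iso (numberFieldData K)}
    (hf : IsCompatible φ f) (v : HeightOneSpectrum (𝓞 K)) :
    f.primes.symm v = maxIdempotentEquiv φ v := by
  have h := tendsto_nhds_unique (hf v) (tendsto_idealToDR_pow_factorial v)
  refine Subtype.ext (φ.injective (h.trans ?_))
  exact (apply_localHom φ v 0).symm

variable [Finite (𝓞 K)ˣ] [Subsingleton (InfinitePlace K)] (φ : M ≃ₜ* DR K)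
  (hI : ∀ x, φ x ∈ DR.ideals K ↔ x ∈ I)

theorem reconstruction_cases {p : (reconstruction I).F → Prop}
    (h0 : p (0 : WithZero (recUnits I)))
    (h1 : ∀ k : Kˣ, p ((recUnitsEquiv φ hI k : recUnits I) : WithZero (recUnits I)))
    (x : (reconstruction I).F) : p x := by
  rcases (x : WithZero (recUnits I)) with _ | y
  · exact h0
  · have := h1 ((recUnitsEquiv φ hI).symm y)
    rwa [MulEquiv.apply_symm_apply] at this

theorem forall_recUnitsEquiv_mem_localIntegers_iff (k : Kˣ) :
    (∀ e, (recUnitsEquiv φ hI k).1 e ∈ localIntegers e.1) ↔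
      ∀ v : HeightOneSpectrum (𝓞 K), v.valuation K (k : K) ≤ 1 := by
  rw [← (maxIdempotentEquiv φ).forall_congr_right]
  exact forall_congr' fun v => recUnitsEquiv_mem_localIntegers_iff φ hI k v

theorem recFieldEquiv_mem_range_iff (x : (reconstruction I).F) :
    recFieldEquiv φ hI x ∈ Set.range (algebraMap (𝓞 K) K) ↔ x ∈ (reconstruction I).O := by
  refine reconstruction_cases φ hI (p := fun x => recFieldEquiv φ hI x ∈
    Set.range (algebraMap (𝓞 K) K) ↔ x ∈ (reconstruction I).O) ?_ (fun k => ?_) x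
  · exact iff_of_true ⟨0, by rw [map_zero, recFieldEquiv_zero]⟩ zero_mem_reconstruction_O
  · refine Iff.trans ?_ (coe_mem_reconstruction_O _).symm
    rw [recFieldEquiv_coe, forall_recUnitsEquiv_mem_localIntegers_iff, mem_range_algebraMap_iff]

theorem recFieldEquiv_mem_image_iff {e : MaxIdempotent M} {v : HeightOneSpectrum (𝓞 K)}
    (he : maxIdempotentEquiv φ v = e) (x : (reconstruction I).F) :
    recFieldEquiv φ hI x ∈ algebraMap (𝓞 K) K '' (v.asIdeal : Set (𝓞 K)) ↔
      x ∈ (reconstruction I).ideal e := by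
  subst he
  refine reconstruction_cases φ hI (p := fun x => recFieldEquiv φ hI x ∈
    algebraMap (𝓞 K) K '' (v.asIdeal : Set (𝓞 K)) ↔
      x ∈ (reconstruction I).ideal (maxIdempotentEquiv φ v)) ?_ (fun k => ?_) x
  · exact iff_of_true ⟨0, v.asIdeal.zero_mem, by rw [map_zero, recFieldEquiv_zero]⟩
      (zero_mem_reconstruction_ideal _)
  · refine Iff.trans ?_ (coe_mem_reconstruction_ideal _ _).symm
    rw [recFieldEquiv_coe, forall_recUnitsEquiv_mem_localIntegers_iff, mem_image_asIdeal_iff]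
    exact and_congr_right fun _ => not_congr (recUnitsEquiv_mem_localUnits_iff φ hI k v).symm

theorem valuation_recFieldEquiv_sub_one_lt_one_iff {e : MaxIdempotent M}
    {v : HeightOneSpectrum (𝓞 K)} (he : maxIdempotentEquiv φ v = e) (x : (reconstruction I).F) :
    v.valuation K (recFieldEquiv φ hI x - 1) < 1 ↔ x ∈ (reconstruction I).U e := by
  subst he
  refine reconstruction_cases φ hI (p := fun x => v.valuation K (recFieldEquiv φ hI x - 1) < 1 ↔
    x ∈ (reconstruction I).U (maxIdempotentEquiv φ v)) ?_ (fun k => ?_) x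
  · refine iff_of_false (fun h => ?_) (zero_notMem_reconstruction_U _)
    rw [recFieldEquiv_zero, zero_sub, Valuation.map_neg, map_one] at h
    exact lt_irrefl _ h
  · refine Iff.trans ?_ (coe_mem_reconstruction_U _ _).symm
    rw [recFieldEquiv_coe]
    exact (recUnitsEquiv_mem_principalUnits_iff φ hI k v).symm

/-- The isomorphism between the reconstructed data and the arithmetic data of `K`. -/
noncomputable def reconstructionIso : (reconstruction I).Iso (numberFieldData K) where
  toMulEquiv := recFieldEquiv φ hI
  primes := (maxIdempotentEquiv φ).symm
  mem_O := recFieldEquiv_mem_range_iff φ hI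
  mem_ideal e := recFieldEquiv_mem_image_iff φ hI ((maxIdempotentEquiv φ).apply_symm_apply e)
  mem_U e := valuation_recFieldEquiv_sub_one_lt_one_iff φ hI
    ((maxIdempotentEquiv φ).apply_symm_apply e)

theorem isCompatible_reconstructionIso : IsCompatible φ (reconstructionIso φ hI) := by
  intro v
  have h : φ (Subtype.val ((reconstructionIso φ hI).primes.symm v)) =
      DR.mk K (localIntegral v 0, 1) :=
    apply_localHom φ v 0
  rw [h]
  exact tendsto_idealToDR_pow_factorial v

variable {φ}

/-- Two compatible isomorphisms induce the same bijection of primes. Passing from one to the other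
gives an automorphism of `K` that is additive and preserves all places, hence is trivial. -/
theorem IsCompatible.eq {f g : (reconstruction I).Iso (numberFieldData K)}
    (hf : IsCompatible φ f) (hg : IsCompatible φ g) : f = g := by
  have hp : ∀ e, f.primes e = g.primes e := by
    intro e
    rw [← f.primes.symm.injective.eq_iff, Equiv.symm_apply_apply]
    exact (g.primes.symm_apply_apply e).symm.trans
      ((hg.primes_symm_eq _).trans (hf.primes_symm_eq _).symm)
  refine MulFieldData.Iso.ext_of_apply (fun x => ?_) hp
  have h1 := ringEquiv_eq_refl_of_valuation_lt_one (f.symm.trans g).fieldRingEquiv (fun v y hy => by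
    have h2 := ((f.symm.trans g).valuation_fieldEquiv_lt_one_iff v y).mpr hy
    have h3 : (f.symm.trans g).primeEquiv v = v :=
      (hp _).symm.trans (f.primes.apply_symm_apply v)
    rw [h3] at h2
    exact h2) (f.toField x)
  have h4 : (f.symm.trans g).fieldRingEquiv (f.toField x) = g.toField x :=
    congrArg g.toMulEquiv (f.toMulEquiv.symm_apply_apply x)
  exact (h4.symm.trans h1).symm

end ReconstructionIso

/-! ### The two statements of the reconstruction theorem -/

theorem existsUnique_isCompatible {K : Type*} [Field K] [NumberField K]
    (hK : IsRationalOrImaginaryQuadratic K) {M : Type*} [CommMonoid M] [TopologicalSpace M]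
    [ContinuousMul M] {I : Submonoid M} (φ : M ≃ₜ* DR K)
    (hI : ∀ x, φ x ∈ DR.ideals K ↔ x ∈ I) :
    ∃! f : (reconstruction I).Iso (numberFieldData K), IsCompatible φ f := by
  have := NumberField.IsRationalOrImaginaryQuadratic.subsingleton_infinitePlace hK
  have := finite_units_of_subsingleton_infinitePlace (K := K)
  exact ⟨_, isCompatible_reconstructionIso φ hI, fun f hf =>
    hf.eq (isCompatible_reconstructionIso φ hI)⟩

/-- Addition is transported along `f`. Any other `g` differs from `f` by an isomorphism of data of
number fields, which is additive; the condition for `f` itself gives uniqueness. -/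
theorem existsUnique_add {D : MulFieldData.{v}} {K : Type u} [Field K] [NumberField K]
    (hK : IsRationalOrImaginaryQuadratic K) (f : D.Iso (numberFieldData K)) :
    ∃! add : D.F → D.F → D.F, ∀ (K' : Type u) [Field K'] [NumberField K'],
      IsRationalOrImaginaryQuadratic K' → ∀ (g : D.Iso (numberFieldData K')) (x y : D.F),
        g.toField (add x y) = g.toField x + g.toField y := by
  refine ⟨fun x y => f.toField.symm (f.toField x + f.toField y), ?_, ?_⟩
  · intro K' _ _ hK' g x y
    have := NumberField.IsRationalOrImaginaryQuadratic.subsingleton_infinitePlace hK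
    have := finite_units_of_subsingleton_infinitePlace (K := K)
    have := NumberField.IsRationalOrImaginaryQuadratic.subsingleton_infinitePlace hK'
    have := finite_units_of_subsingleton_infinitePlace (K := K')
    have h := (f.symm.trans g).fieldEquiv_add (f.toField x) (f.toField y)
    have h1 : ∀ z, (f.symm.trans g).fieldEquiv (f.toField z) = g.toField z := fun z =>
      congrArg g.toMulEquiv (f.toMulEquiv.symm_apply_apply z)
    rw [h1, h1] at h
    exact h
  · intro add h
    funext x y
    rw [MulEquiv.eq_symm_apply]
    exact h K hK f x y

/-! ### Isomorphisms of Deligne-Ribet monoids -/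

section Functoriality

/-- Representatives of the same class differ by a unit of `Ô_K`, which does not affect valuations,
so the exponents at all primes agree. -/
theorem idealToDR_injective (K : Type*) [Field K] [NumberField K] :
    Function.Injective (idealToDR K) := by
  classical
  intro 𝔞 𝔟 h
  obtain ⟨u, hu⟩ := DR.mk_eq_mk_iff.mp h
  have h1 : idealAdele K 𝔟 = idealAdele K 𝔞 * u := congrArg Prod.fst hu
  have h2 : ∀ v, idealExp K v 𝔞 = idealExp K v 𝔟 := by
    intro v
    have h3 := valued_idealAdele K 𝔟 v
    have h4 : (idealAdele K 𝔟 v : v.adicCompletion K) =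
        idealAdele K 𝔞 v * ((u : IntegralAdeles K) v : v.adicCompletion K) :=
      congrArg Subtype.val (congrFun h1 v)
    rw [h4, map_mul, valued_unit, mul_one, valued_idealAdele, WithZero.exp_inj] at h3
    omega
  refine Subtype.ext (Associates.mk_injective (Associates.eq_of_eq_counts
    (Associates.mk_ne_zero.mpr (nonZeroDivisors.coe_ne_zero 𝔞))
    (Associates.mk_ne_zero.mpr (nonZeroDivisors.coe_ne_zero 𝔟)) fun p hp => ?_))
  obtain ⟨P, rfl⟩ := Associates.mk_surjective p
  rw [Associates.irreducible_mk, UniqueFactorizationMonoid.irreducible_iff_prime] at hp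
  exact h2 ⟨P, Ideal.isPrime_of_prime hp, hp.ne_zero⟩

theorem mapRingEquiv_mem_map_iff {K L : Type*} [Field K] [Field L] (ψ : K ≃+* L)
    (𝔞 : Ideal (𝓞 K)) (r : 𝓞 K) :
    RingOfIntegers.mapRingEquiv ψ r ∈ 𝔞.map (RingOfIntegers.mapRingEquiv ψ) ↔ r ∈ 𝔞 := by
  rw [Ideal.mem_map_of_equiv]
  exact ⟨fun ⟨x, hx, h⟩ => (RingOfIntegers.mapRingEquiv ψ).injective h ▸ hx,
    fun h => ⟨r, h, rfl⟩⟩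

theorem map_mapRingEquiv_mem_nonZeroDivisors {K L : Type*} [Field K] [NumberField K]
    [Field L] (ψ : K ≃+* L) (𝔞 : (Ideal (𝓞 K))⁰) :
    (𝔞 : Ideal (𝓞 K)).map (RingOfIntegers.mapRingEquiv ψ) ∈ (Ideal (𝓞 L))⁰ := by
  refine mem_nonZeroDivisors_of_ne_zero fun h => nonZeroDivisors.coe_ne_zero 𝔞 ?_
  exact (Ideal.map_eq_bot_iff_of_injective (RingOfIntegers.mapRingEquiv ψ).injective).mp h

/-- An isomorphism of fields is determined by the images of the maximal ideals. -/
theorem ringEquiv_eq_of_map_asIdeal_eq {K L : Type*} [Field K] [NumberField K] [Field L]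
    [Finite (𝓞 K)ˣ] {ψ ψ' : K ≃+* L}
    (h : ∀ v : HeightOneSpectrum (𝓞 K), v.asIdeal.map (RingOfIntegers.mapRingEquiv ψ') =
      v.asIdeal.map (RingOfIntegers.mapRingEquiv ψ)) : ψ' = ψ := by
  -- The automorphism comparing `ψ'` with `ψ` preserves every maximal ideal, hence every place, and
  -- is therefore trivial.
  let τ : K ≃+* K := ψ'.trans ψ.symm
  have hτ : ∀ (v : HeightOneSpectrum (𝓞 K)) (r : 𝓞 K),
      RingOfIntegers.mapRingEquiv τ r ∈ v.asIdeal ↔ r ∈ v.asIdeal := by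
    intro v r
    rw [← mapRingEquiv_mem_map_iff ψ, ← h, ← mapRingEquiv_mem_map_iff ψ']
    have e : RingOfIntegers.mapRingEquiv ψ (RingOfIntegers.mapRingEquiv τ r) =
        RingOfIntegers.mapRingEquiv ψ' r :=
      RingOfIntegers.ext (ψ.apply_symm_apply _)
    rw [e]
  have h1 := ringEquiv_eq_refl_of_valuation_lt_one τ (fun v x hx => by
    obtain ⟨r, ⟨s, hs⟩, hrs⟩ := v.exists_primeCompl_mul_eq_of_integer (K := K) x hx.le
    have hs' : s ∉ v.asIdeal := hs
    have h2 : τ x * algebraMap (𝓞 K) K (RingOfIntegers.mapRingEquiv τ s) =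
        algebraMap (𝓞 K) K (RingOfIntegers.mapRingEquiv τ r) := by
      change τ x * τ (algebraMap (𝓞 K) K s) = τ (algebraMap (𝓞 K) K r)
      rw [← map_mul]
      exact congrArg τ hrs
    have h3 : r ∈ v.asIdeal := by
      rw [← v.valuation_lt_one_iff_mem (K := K), Algebra.cast, ← hrs, map_mul,
        (v.valuation_eq_one_iff_notMem (K := K)).mpr hs', mul_one]
      exact hx
    rw [← hτ, ← v.valuation_lt_one_iff_mem (K := K), Algebra.cast, ← h2, map_mul,
      (v.valuation_eq_one_iff_notMem (K := K)).mpr (mt (hτ v s).mp hs'), mul_one] at h3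
    exact h3)
  refine RingEquiv.ext fun x => ?_
  rw [← ψ.symm_apply_eq]
  exact h1 x

variable {K L : Type*} [Field K] [NumberField K] [Field L] [NumberField L]

theorem fieldRingEquiv_map_asIdeal [Finite (𝓞 K)ˣ] [Finite (𝓞 L)ˣ]
    (f : (numberFieldData K).Iso (numberFieldData L)) (v : HeightOneSpectrum (𝓞 K)) :
    v.asIdeal.map (RingOfIntegers.mapRingEquiv f.fieldRingEquiv) = (f.primeEquiv v).asIdeal := by
  ext s
  obtain ⟨r, rfl⟩ := (RingOfIntegers.mapRingEquiv f.fieldRingEquiv).surjective s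
  obtain ⟨s, hs, h⟩ := f.exists_fieldEquiv_eq r
  have e : RingOfIntegers.mapRingEquiv f.fieldRingEquiv r = s := RingOfIntegers.ext hs
  rw [mapRingEquiv_mem_map_iff, e, h]

theorem RestrictsTo.eq [Finite (𝓞 K)ˣ] {φ : DR K ≃ₜ* DR L} {ψ ψ' : K ≃+* L}
    (h' : RestrictsTo φ ψ') (h : RestrictsTo φ ψ) : ψ' = ψ := by
  refine ringEquiv_eq_of_map_asIdeal_eq fun v => ?_
  have h1 := h ⟨v.asIdeal, mem_nonZeroDivisors_of_ne_zero v.ne_bot⟩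
    ⟨_, map_mapRingEquiv_mem_nonZeroDivisors ψ _⟩ rfl
  have h2 := h' ⟨v.asIdeal, mem_nonZeroDivisors_of_ne_zero v.ne_bot⟩
    ⟨_, map_mapRingEquiv_mem_nonZeroDivisors ψ' _⟩ rfl
  exact congrArg Subtype.val (idealToDR_injective L (h2.symm.trans h1))

variable (φ : DR K ≃ₜ* DR L) (hφ : ∀ x, φ x ∈ DR.ideals L ↔ x ∈ DR.ideals K)

/-- The isomorphism of the monoids of ideals induced by an isomorphism of Deligne-Ribet monoids. -/
noncomputable def idealEquiv : (Ideal (𝓞 K))⁰ ≃* (Ideal (𝓞 L))⁰ :=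
  (MulEquiv.ofBijective (idealToDR K).mrangeRestrict
    ⟨fun _ _ h => idealToDR_injective K (congrArg Subtype.val h),
      (idealToDR K).mrangeRestrict_surjective⟩).trans
  ((φ.toMulEquiv.submonoidMap (DR.ideals K)).trans
    ((MulEquiv.submonoidCongr (show (DR.ideals K).map φ.toMulEquiv = DR.ideals L by
      ext x
      obtain ⟨y, rfl⟩ := φ.surjective x
      rw [hφ]
      exact φ.injective.mem_set_image)).trans
    (MulEquiv.ofBijective (idealToDR L).mrangeRestrict
      ⟨fun _ _ h => idealToDR_injective L (congrArg Subtype.val h),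
        (idealToDR L).mrangeRestrict_surjective⟩).symm))

theorem idealToDR_idealEquiv (𝔞 : (Ideal (𝓞 K))⁰) :
    idealToDR L (idealEquiv φ hφ 𝔞) = φ (idealToDR K 𝔞) :=
  congrArg Subtype.val ((MulEquiv.ofBijective (idealToDR L).mrangeRestrict
      ⟨fun _ _ h => idealToDR_injective L (congrArg Subtype.val h),
        (idealToDR L).mrangeRestrict_surjective⟩).apply_symm_apply _)

theorem irreducible_nonZeroDivisors_iff {R : Type*} [CommRing R] [IsDedekindDomain R]
    (𝔞 : (Ideal R)⁰) : Irreducible 𝔞 ↔ Irreducible (𝔞 : Ideal R) := by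
  have hu : ∀ 𝔟 : (Ideal R)⁰, IsUnit 𝔟 ↔ IsUnit (𝔟 : Ideal R) := fun 𝔟 => by
    rw [isUnit_iff_eq_one, isUnit_iff_eq_one, ← Subtype.val_inj]
    rfl
  rw [irreducible_iff, irreducible_iff, hu]
  refine and_congr_right fun _ => ⟨fun h a b hab => ?_, fun h a b hab => ?_⟩
  · have hne : a * b ≠ 0 := hab ▸ nonZeroDivisors.coe_ne_zero 𝔞
    have := h (a := ⟨a, mem_nonZeroDivisors_of_ne_zero (left_ne_zero_of_mul hne)⟩)
      (b := ⟨b, mem_nonZeroDivisors_of_ne_zero (right_ne_zero_of_mul hne)⟩) (Subtype.ext hab)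
    rwa [hu, hu] at this
  · rw [hu, hu]
    exact h (congrArg Subtype.val hab)

/-- Maximal ideals are the irreducible elements of the monoid of nonzero ideals, and irreducibility
is a purely multiplicative notion. -/
theorem exists_idealEquiv_asIdeal_eq (v : HeightOneSpectrum (𝓞 K)) :
    ∃ w : HeightOneSpectrum (𝓞 L),
      idealEquiv φ hφ ⟨v.asIdeal, mem_nonZeroDivisors_of_ne_zero v.ne_bot⟩ =
        ⟨w.asIdeal, mem_nonZeroDivisors_of_ne_zero w.ne_bot⟩ := by
  set 𝔭 : (Ideal (𝓞 K))⁰ := ⟨v.asIdeal, mem_nonZeroDivisors_of_ne_zero v.ne_bot⟩ with h𝔭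
  have h1 : Irreducible 𝔭 := (irreducible_nonZeroDivisors_iff 𝔭).mpr v.irreducible
  have h2 := (irreducible_nonZeroDivisors_iff _).mp
    ((MulEquiv.irreducible_iff (idealEquiv φ hφ)).mpr h1)
  rw [UniqueFactorizationMonoid.irreducible_iff_prime] at h2
  exact ⟨⟨_, Ideal.isPrime_of_prime h2, h2.ne_zero⟩, rfl⟩

/-- The image of `𝔭` is some prime, whose idempotent is the limit of the powers with exponent `n!`.
By continuity this is the image under `φ` of the idempotent of `𝔭`, and distinct primes have
distinct idempotents. -/
theorem idealEquiv_asIdeal [Subsingleton (InfinitePlace K)] [Subsingleton (InfinitePlace L)]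
    {v : HeightOneSpectrum (𝓞 K)} {w : HeightOneSpectrum (𝓞 L)}
    (h : φ (DR.localMap v 0) = DR.localMap w 0) :
    (idealEquiv φ hφ ⟨v.asIdeal, mem_nonZeroDivisors_of_ne_zero v.ne_bot⟩ : Ideal (𝓞 L)) =
      w.asIdeal := by
  obtain ⟨w', hw'⟩ := exists_idealEquiv_asIdeal_eq φ hφ v
  have h1 := (φ.continuous.tendsto _).comp (tendsto_idealToDR_pow_factorial v)
  have h2 := tendsto_idealToDR_pow_factorial w'
  rw [← hw', idealToDR_idealEquiv] at h2
  have h3 := tendsto_nhds_unique h2 (h1.congr fun n => map_pow φ _ _)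
  have h4 : DR.localMap w' 0 = DR.localMap w 0 := h3.trans h
  rw [hw', DR.localMap_zero_injective h4]

/-- Both sides are multiplicative in the ideal, so unique factorization reduces the claim to primes.
-/
theorem restrictsTo_of_map_asIdeal_eq {ψ : K ≃+* L}
    (h : ∀ v : HeightOneSpectrum (𝓞 K),
      (idealEquiv φ hφ ⟨v.asIdeal, mem_nonZeroDivisors_of_ne_zero v.ne_bot⟩ : Ideal (𝓞 L)) =
        v.asIdeal.map (RingOfIntegers.mapRingEquiv ψ)) : RestrictsTo φ ψ := by
  have key : ∀ (𝔞 : Ideal (𝓞 K)) (h𝔞 : 𝔞 ∈ (Ideal (𝓞 K))⁰),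
      (idealEquiv φ hφ ⟨𝔞, h𝔞⟩ : Ideal (𝓞 L)) = 𝔞.map (RingOfIntegers.mapRingEquiv ψ) := by
    intro 𝔞
    induction 𝔞 using UniqueFactorizationMonoid.induction_on_prime with
    | h₁ => exact fun h0 => absurd rfl (nonZeroDivisors.ne_zero h0)
    | h₂ 𝔞 hu =>
      intro h𝔞
      obtain rfl := isUnit_iff_eq_one.mp hu
      have e : (⟨1, h𝔞⟩ : (Ideal (𝓞 K))⁰) = 1 := rfl
      rw [e, map_one, Ideal.one_eq_top, Ideal.map_top]
      exact Ideal.one_eq_top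
    | h₃ 𝔞 𝔭 ha hp ih =>
      intro h𝔞
      have e : (⟨𝔭 * 𝔞, h𝔞⟩ : (Ideal (𝓞 K))⁰) =
        ⟨𝔭, mem_nonZeroDivisors_of_ne_zero hp.ne_zero⟩ *
          ⟨𝔞, mem_nonZeroDivisors_of_ne_zero ha⟩ := rfl
      rw [e, map_mul, Submonoid.coe_mul, ih, Ideal.map_mul]
      congr 1
      exact h ⟨𝔭, Ideal.isPrime_of_prime hp, hp.ne_zero⟩
  intro 𝔞 𝔟 h𝔟
  rw [← idealToDR_idealEquiv φ hφ]
  congr 1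
  exact Subtype.ext ((key 𝔞 𝔞.2).trans h𝔟.symm)

/-- Compatibility of `f` and `g` says that the maximal idempotent corresponding to `𝔭` through `f`
corresponds through `g` to the image of `𝔭` under the field isomorphism. So `φ` matches the two
idempotents, and hence the two primes. -/
theorem IsCompatible.restrictsTo [Finite (𝓞 K)ˣ] [Finite (𝓞 L)ˣ]
    [Subsingleton (InfinitePlace K)] [Subsingleton (InfinitePlace L)] {φ : DR K ≃ₜ* DR L}
    (hφ : ∀ x, φ x ∈ DR.ideals L ↔ x ∈ DR.ideals K)
    {f : (reconstruction (DR.ideals K)).Iso (numberFieldData K)}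
    {g : (reconstruction (DR.ideals K)).Iso (numberFieldData L)}
    (hf : IsCompatible (ContinuousMulEquiv.refl (DR K)) f) (hg : IsCompatible φ g) :
    RestrictsTo φ (f.symm.trans g).fieldRingEquiv := by
  refine restrictsTo_of_map_asIdeal_eq φ hφ fun v => ?_
  rw [fieldRingEquiv_map_asIdeal]
  refine idealEquiv_asIdeal φ hφ ?_
  have h1 := hg.primes_symm_eq ((f.symm.trans g).primeEquiv v)
  have h2 : g.primes.symm ((f.symm.trans g).primeEquiv v) = f.primes.symm v :=
    g.primes.symm_apply_apply _
  rw [h2, hf.primes_symm_eq] at h1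
  have h3 := congrArg φ (congrArg Subtype.val h1)
  have h4 : φ (maxIdempotentEquiv φ ((f.symm.trans g).primeEquiv v)).1 =
    DR.localMap ((f.symm.trans g).primeEquiv v) 0 := apply_localHom φ _ 0
  rw [h4] at h3
  exact h3

end Functoriality

/-! ### The main theorem -/

theorem mainTheorem5 {K : Type u} [Field K] [NumberField K]
    (hK : IsRationalOrImaginaryQuadratic K) :
    (∀ (M : Type v) [CommMonoid M] [TopologicalSpace M] [ContinuousMul M] (I : Submonoid M)
        (φ : M ≃ₜ* DR K), (∀ x, φ x ∈ DR.ideals K ↔ x ∈ I) →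
      (∃! f : (reconstruction I).Iso (numberFieldData K), IsCompatible φ f) ∧
      (∃! add : (reconstruction I).F → (reconstruction I).F → (reconstruction I).F,
        ∀ (K' : Type u) [Field K'] [NumberField K'], IsRationalOrImaginaryQuadratic K' →
          ∀ (f : (reconstruction I).Iso (numberFieldData K')) (x y : (reconstruction I).F),
            f.toField (add x y) = f.toField x + f.toField y)) ∧
    (∀ (L : Type w) [Field L] [NumberField L], IsRationalOrImaginaryQuadratic L →
      ∀ φ : DR K ≃ₜ* DR L, (∀ x, φ x ∈ DR.ideals L ↔ x ∈ DR.ideals K) →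
        ∃ ψ : K ≃+* L,
          RestrictsTo φ ψ ∧
          (∀ ψ' : K ≃+* L, RestrictsTo φ ψ' → ψ' = ψ) ∧
          ∀ (f : (reconstruction (DR.ideals K)).Iso (numberFieldData K))
            (g : (reconstruction (DR.ideals K)).Iso (numberFieldData L)),
            IsCompatible (ContinuousMulEquiv.refl (DR K)) f → IsCompatible φ g →
              ∀ x, g.toField x = ψ (f.toField x)) := by
  have := NumberField.IsRationalOrImaginaryQuadratic.subsingleton_infinitePlace hK
  have := finite_units_of_subsingleton_infinitePlace (K := K)
  refine ⟨fun M _ _ _ I φ hI => ⟨existsUnique_isCompatible hK φ hI,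
    existsUnique_add hK (reconstructionIso φ hI)⟩, fun L _ _ hL φ hφ => ?_⟩
  have := NumberField.IsRationalOrImaginaryQuadratic.subsingleton_infinitePlace hL
  have := finite_units_of_subsingleton_infinitePlace (K := L)
  obtain ⟨f, hf, -⟩ := existsUnique_isCompatible hK (ContinuousMulEquiv.refl (DR K))
    (I := DR.ideals K) fun _ => Iff.rfl
  obtain ⟨g, hg, -⟩ := existsUnique_isCompatible hL φ hφ
  have h := hf.restrictsTo hφ hg
  refine ⟨_, h, fun ψ' h' => h'.eq h, fun f' g' hf' hg' x => ?_⟩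
  -- By uniqueness, any compatible pair is the pair from which `ψ` was formed.
  rw [hf'.eq hf, hg'.eq hg]
  exact (congrArg g.toMulEquiv (f.toMulEquiv.symm_apply_apply x)).symm
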